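/- Let $K\subset\mathbb{C}$ be an imaginary quadratic field of class number $1$ with ring of integers $\mathcal{O}_K$. Let $\mathbb{H}^3=\{P=z+rj : z\in\mathbb{C},\ r>0\}$ be hyperbolic $3$-space, regarded as a subset of Hamilton's quaternions, and write $r(P)$ for the coordinate $r$ of $P$. Let $\Gamma=\mathrm{PSL}_2(\mathcal{O}_K)$ act on $\mathbb{H}^3$ by $\begin{pmatrix}a&b\\c&d\end{pmatrix}P=(aP+b)(cP+d)^{-1}$, and let $\Gamma'_\infty=\{\gamma\in\Gamma : \gamma\infty=\infty,\ |\operatorname{tr}\gamma|=2\}$. For $P\in\mathbb{H}^3$ consider the Eisenstein series $$E(P,s)=\sum_{\gamma\in\Gamma'_\infty\backslash\Gamma} r(\gamma P)^{1+s},\qquad \operatorname{Re}(s)>2 .$$ For every $P\in\mathbb{H}^3$ this series converges absolutely for $\operatorname{Re}(s)>2$, and $E(P,\cdot)$ has a meromorphic continuation to $\mathbb{C}$ which is holomorphic at every point of the line $\operatorname{Re}(s)=0$. Moreover, for every compact $\Omega\subset\mathbb{H}^3$ and every $\varepsilon>0$ there is a constant $C=C(K,\Omega,\varepsilon)$ such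 that $$\sup_{P\in\Omega}|E(P,it)|\le C\,(1+|t|)^{1+\varepsilon}\qquad\text{for all } t\in\mathbb{R}.$$ -/

import Mathlib

open scoped NumberField Quaternion MatrixGroups Topology

noncomputable section

namespace HypThree

/-- Hyperbolic `3`-space `{z + r j : z ∈ ℂ, r > 0}`; the point `z + r j` is the pair `(z, r)`.
Its topology is the one induced from `ℂ × ℝ`. -/
abbrev H3 : Type := {P : ℂ × ℝ // 0 < P.2}

/-- The height `r` of the point `z + r j`. -/
def H3.r (P : H3) : ℝ := P.1.2

/-- The point `P = z + r j` as a Hamilton quaternion with vanishing fourth component. -/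
def H3.toQuaternion (P : H3) : ℍ[ℝ] := ⟨P.1.1.re, P.1.1.im, P.1.2, 0⟩

@[simp] theorem H3.re_toQuaternion (P : H3) : P.toQuaternion.re = P.1.1.re := rfl
@[simp] theorem H3.imI_toQuaternion (P : H3) : P.toQuaternion.imI = P.1.1.im := rfl
@[simp] theorem H3.imJ_toQuaternion (P : H3) : P.toQuaternion.imJ = P.1.2 := rfl
@[simp] theorem H3.imK_toQuaternion (P : H3) : P.toQuaternion.imK = 0 := rfl

/-- The quaternion `(a P + b) (c P + d)⁻¹`, for `g = (a, b; c, d)`. -/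
def quaternionAct (g : SL(2, ℂ)) (P : H3) : ℍ[ℝ] :=
  (Quaternion.coeComplex (g 0 0) * P.toQuaternion + Quaternion.coeComplex (g 0 1)) *
    (Quaternion.coeComplex (g 1 0) * P.toQuaternion + Quaternion.coeComplex (g 1 1))⁻¹

/-- `‖c P + d‖²` in coordinates. -/
theorem normSq_denom (c d : ℂ) (P : H3) :
    Quaternion.normSq (Quaternion.coeComplex c * P.toQuaternion + Quaternion.coeComplex d) =
      Complex.normSq (c * P.1.1 + d) + Complex.normSq c * P.1.2 ^ 2 := by
  simp only [Quaternion.normSq_def', Complex.normSq_apply]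
  simp
  ring

theorem normSq_denom_pos (g : SL(2, ℂ)) (P : H3) :
    0 < Complex.normSq (g 1 0 * P.1.1 + g 1 1) + Complex.normSq (g 1 0) * P.1.2 ^ 2 := by
  have hr : 0 < P.1.2 := P.2
  rcases eq_or_ne (g 1 0) 0 with hc | hc
  · have hdet := g.det_coe
    rw [Matrix.det_fin_two] at hdet
    have hd : g 1 1 ≠ 0 := by
      rintro hd
      rw [hc, hd] at hdet
      simp at hdet
    rw [hc]
    simpa using hd
  · have h1 : 0 < Complex.normSq (g 1 0) := Complex.normSq_pos.2 hc
    have h2 := Complex.normSq_nonneg (g 1 0 * P.1.1 + g 1 1)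
    positivity

/-- The height of `g P` in coordinates: `r / (|c z + d|² + |c|² r²)`. -/
theorem quaternionAct_imJ (g : SL(2, ℂ)) (P : H3) :
    (quaternionAct g P).imJ =
      P.1.2 / (Complex.normSq (g 1 0 * P.1.1 + g 1 1) + Complex.normSq (g 1 0) * P.1.2 ^ 2) := by
  have hdet := g.det_coe
  rw [Matrix.det_fin_two] at hdet
  have hre := congrArg Complex.re hdet
  have him := congrArg Complex.im hdet
  simp at hre him
  rw [quaternionAct, Quaternion.inv_def, normSq_denom]
  simp
  rw [div_eq_inv_mul]
  linear_combination (Complex.normSq (g 1 0 * P.1.1 + g 1 1) +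
    Complex.normSq (g 1 0) * P.1.2 ^ 2)⁻¹ * P.1.2 * hre

/-- The quaternion `(a P + b) (c P + d)⁻¹` has vanishing fourth component. -/
theorem quaternionAct_imK (g : SL(2, ℂ)) (P : H3) : (quaternionAct g P).imK = 0 := by
  have hdet := g.det_coe
  rw [Matrix.det_fin_two] at hdet
  have him := congrArg Complex.im hdet
  simp at him
  rw [quaternionAct, Quaternion.inv_def, normSq_denom]
  simp
  linear_combination (Complex.normSq (g 1 0 * P.1.1 + g 1 1) +
    Complex.normSq (g 1 0) * P.1.2 ^ 2)⁻¹ * P.1.2 * him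

/-- The action `g P = (a P + b) (c P + d)⁻¹` on hyperbolic `3`-space. -/
def act (g : SL(2, ℂ)) (P : H3) : H3 :=
  ⟨(⟨(quaternionAct g P).re, (quaternionAct g P).imI⟩, (quaternionAct g P).imJ), by
    have h := normSq_denom_pos g P
    have hr : 0 < P.1.2 := P.2
    change 0 < (quaternionAct g P).imJ
    rw [quaternionAct_imJ]
    positivity⟩

theorem act_toQuaternion (g : SL(2, ℂ)) (P : H3) : (act g P).toQuaternion = quaternionAct g P := by
  ext <;> simp [act, H3.toQuaternion, quaternionAct_imK]

/-- The height of `g P` in coordinates: `r / (|c z + d|² + |c|² r²)`. -/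
theorem r_act (g : SL(2, ℂ)) (P : H3) : (act g P).r =
    P.r / (Complex.normSq (g 1 0 * P.1.1 + g 1 1) + Complex.normSq (g 1 0) * P.r ^ 2) :=
  quaternionAct_imJ g P

variable {K : Type*} [Field K]

/-- The map `SL₂(𝓞 K) → SL₂(ℂ)` induced by a complex embedding of `K`. -/
def toSLC (φ : K →+* ℂ) : SL(2, 𝓞 K) →* SL(2, ℂ) :=
  Matrix.SpecialLinearGroup.map (φ.comp (algebraMap (𝓞 K) K))

theorem toSLC_apply (φ : K →+* ℂ) (γ : SL(2, 𝓞 K)) (i j : Fin 2) :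
    toSLC φ γ i j = φ (algebraMap (𝓞 K) K (γ i j)) := rfl

variable [NumberField K] [Algebra.IsQuadraticExtension ℚ K] [NumberField.IsTotallyComplex K]

/-- Units of an imaginary quadratic field have absolute value `1`. -/
theorem norm_eq_one_of_mul_eq_one (φ : K →+* ℂ) {a d : 𝓞 K} (h : a * d = 1) :
    ‖φ (a : K)‖ = 1 := by
  have hu : IsUnit a := IsUnit.of_mul_eq_one d h
  have hN : |(Algebra.norm ℚ (a : K) : ℚ)| = 1 := by
    have := NumberField.isUnit_iff_norm.1 hu
    rwa [RingOfIntegers.coe_norm] at this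
  have hprod := NumberField.InfinitePlace.prod_eq_abs_norm (a : K)
  rw [hN] at hprod
  have hcard : Fintype.card (NumberField.InfinitePlace K) = 1 := by
    have h1 := NumberField.InfinitePlace.card_add_two_mul_card_eq_rank K
    have h2 := NumberField.InfinitePlace.card_eq_nrRealPlaces_add_nrComplexPlaces K
    have h3 := NumberField.IsTotallyComplex.nrRealPlaces_eq_zero K
    have h4 := Algebra.IsQuadraticExtension.finrank_eq_two ℚ K
    omega
  obtain ⟨w, hw⟩ := Fintype.card_eq_one_iff.1 hcard
  have huniv : (Finset.univ : Finset (NumberField.InfinitePlace K)) =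
      {NumberField.InfinitePlace.mk φ} := by
    ext v
    simp [hw v, hw (NumberField.InfinitePlace.mk φ)]
  rw [huniv, Finset.prod_singleton] at hprod
  have hne := NumberField.InfinitePlace.mult_ne_zero (w := NumberField.InfinitePlace.mk φ)
  rw [NumberField.InfinitePlace.apply] at hprod
  norm_cast at hprod
  exact (pow_eq_one_iff_of_nonneg (norm_nonneg _) hne).1 (by exact_mod_cast hprod)

/-- For `c = 0` the condition `|tr γ| = 2` means that `γ` has diagonal `(1, 1)` or `(-1, -1)`. -/
theorem parabolic_iff (φ : K →+* ℂ) (γ : SL(2, 𝓞 K)) :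
    (γ 1 0 = 0 ∧ ‖φ (γ 0 0 + γ 1 1 : K)‖ = 2) ↔
      γ 1 0 = 0 ∧ (γ 0 0 = 1 ∧ γ 1 1 = 1 ∨ γ 0 0 = -1 ∧ γ 1 1 = -1) := by
  refine and_congr_right fun hc => ⟨fun htr => ?_, ?_⟩
  · have hdet := γ.det_coe
    rw [Matrix.det_fin_two, hc, mul_zero, sub_zero] at hdet
    have ha := norm_eq_one_of_mul_eq_one φ hdet
    have hd := norm_eq_one_of_mul_eq_one φ ((mul_comm _ _).trans hdet)
    have hinj : Function.Injective fun x : 𝓞 K => φ (x : K) :=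
      φ.injective.comp NumberField.RingOfIntegers.coe_injective
    have had : φ (γ 0 0 : K) * φ (γ 1 1 : K) = 1 := by
      rw [← map_mul]
      have := congrArg (fun x : 𝓞 K => (x : K)) hdet
      simp at this
      rw [this, map_one]
    have heq : φ (γ 0 0 : K) = φ (γ 1 1 : K) := by
      rw [map_add] at htr
      have hsame : SameRay ℝ (φ (γ 0 0 : K)) (φ (γ 1 1 : K)) := by
        rw [sameRay_iff_norm_add, htr, ha, hd]
        norm_num
      exact hsame.eq_of_norm_eq (ha.trans hd.symm)
    have h01 : γ 0 0 = γ 1 1 := hinj heq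
    rw [← h01] at hdet ⊢
    rcases mul_self_eq_one_iff.1 hdet with h | h <;> simp [h]
  · rintro (⟨h1, h2⟩ | ⟨h1, h2⟩)
    · rw [h1, h2]
      norm_num [map_ofNat]
    · rw [h1, h2]
      norm_num [map_ofNat]

/-- The group `Γ'_∞ = {γ : γ ∞ = ∞, |tr γ| = 2}`, as a subgroup of `SL₂(𝓞 K)`. It contains `-1`,
so that its cosets in `SL₂(𝓞 K)` are those of its image in `PSL₂(𝓞 K)`. -/
def parabolicSubgroup (φ : K →+* ℂ) : Subgroup SL(2, 𝓞 K) where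
  carrier := {γ | γ 1 0 = 0 ∧ ‖φ (γ 0 0 + γ 1 1 : K)‖ = 2}
  one_mem' := by
    simp only [Set.mem_ofPred_eq, parabolic_iff]
    simp
  mul_mem' {x y} hx hy := by
    simp only [Set.mem_ofPred_eq, parabolic_iff] at hx hy ⊢
    obtain ⟨h1, h2⟩ := hx
    obtain ⟨h3, h4⟩ := hy
    simp only [Matrix.SpecialLinearGroup.coe_mul, Matrix.mul_apply, Fin.sum_univ_two, h1, h3]
    rcases h2 with ⟨h2, h2'⟩ | ⟨h2, h2'⟩ <;> rcases h4 with ⟨h4, h4'⟩ | ⟨h4, h4'⟩ <;>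
      simp [h2, h2', h4, h4']
  inv_mem' {x} hx := by
    simp only [Set.mem_ofPred_eq, parabolic_iff] at hx ⊢
    obtain ⟨h1, h2⟩ := hx
    rw [Matrix.SpecialLinearGroup.SL2_inv_expl]
    rcases h2 with ⟨h2, h2'⟩ | ⟨h2, h2'⟩ <;> simp [h1, h2, h2']

/-- The term `r(γ P)^{1+s}` of the Eisenstein series, as a function of the coset of `γ` in
`Γ'_∞ \ Γ`. -/
def eisensteinTerm (φ : K →+* ℂ) (P : H3) (s : ℂ) :
    Quotient (QuotientGroup.rightRel (parabolicSubgroup φ)) → ℂ :=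
  Quotient.lift (fun γ : SL(2, 𝓞 K) => ((act (toSLC φ γ) P).r : ℂ) ^ (1 + s)) (by
    intro x y hxy
    have hmem : y * x⁻¹ ∈ parabolicSubgroup φ := QuotientGroup.rightRel_apply.1 hxy
    obtain ⟨h1, h2⟩ := (parabolic_iff φ _).1 hmem
    have hy : y = (y * x⁻¹) * x := by group
    have h10 : y 1 0 = (y * x⁻¹) 1 1 * x 1 0 := by
      conv_lhs => rw [hy, Matrix.SpecialLinearGroup.coe_mul, Matrix.mul_apply]
      rw [Fin.sum_univ_two, h1, zero_mul, zero_add]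
    have h11 : y 1 1 = (y * x⁻¹) 1 1 * x 1 1 := by
      conv_lhs => rw [hy, Matrix.SpecialLinearGroup.coe_mul, Matrix.mul_apply]
      rw [Fin.sum_univ_two, h1, zero_mul, zero_add]
    have hr : (act (toSLC φ x) P).r = (act (toSLC φ y) P).r := by
      rw [r_act, r_act]
      simp only [toSLC_apply, h10, h11]
      rcases h2 with ⟨_, h2⟩ | ⟨_, h2⟩
      · simp [h2]
      · simp only [h2, neg_mul, one_mul, map_neg, Complex.normSq_neg, ← neg_add]
    simp only [hr])

/-- `F` is the meromorphic continuation of `s ↦ E(P, s) = ∑_{γ ∈ Γ'_∞ \ Γ} r(γ P)^{1+s}`: it is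
meromorphic on `ℂ`, and for `Re s > 2` the series converges to `F s`. The normal form fixes the
values of `F`: it says that `F` has no removable singularities (and the value `0` at its poles). -/
def IsEisensteinContinuation (φ : K →+* ℂ) (P : H3) (F : ℂ → ℂ) : Prop :=
  MeromorphicNFOn F Set.univ ∧ ∀ s : ℂ, 2 < s.re → HasSum (eisensteinTerm φ P s) (F s)

/-- There is at most one meromorphic continuation. -/
theorem IsEisensteinContinuation.unique {φ : K →+* ℂ} {P : H3} {F G : ℂ → ℂ}
    (hF : IsEisensteinContinuation φ P F) (hG : IsEisensteinContinuation φ P G) : F = G := by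
  have hmer : Meromorphic (F - G) := fun z =>
    (hF.1 (Set.mem_univ z)).meromorphicAt.sub (hG.1 (Set.mem_univ z)).meromorphicAt
  have hopen : IsOpen {s : ℂ | 2 < s.re} := isOpen_lt continuous_const Complex.continuous_re
  have h3 : F - G =ᶠ[𝓝[≠] (3 : ℂ)] 0 := by
    refine Filter.Eventually.filter_mono nhdsWithin_le_nhds ?_
    filter_upwards [hopen.mem_nhds (show (2 : ℝ) < (3 : ℂ).re by norm_num)] with s hs
    simp [(hF.2 s hs).unique (hG.2 s hs)]
  have htop : ∀ z, meromorphicOrderAt (F - G) z = ⊤ := by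
    by_contra! h
    exact hmer.exists_meromorphicOrderAt_ne_top_iff_forall.1 h 3
      (meromorphicOrderAt_eq_top_iff.2 h3)
  funext z
  refine (((hF.1 (Set.mem_univ z)).eventuallyEq_nhdsNE_iff_eventuallyEq_nhds
    (hG.1 (Set.mem_univ z))).1 ?_).eq_of_nhds
  filter_upwards [meromorphicOrderAt_eq_top_iff.1 (htop z)] with s hs
  exact sub_eq_zero.1 hs

/-- The Eisenstein series `E(P, s)`, for all `s ∈ ℂ`: the meromorphic continuation of the series
`∑_{γ ∈ Γ'_∞ \ Γ} r(γ P)^{1+s}`. -/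
def eisenstein (φ : K →+* ℂ) (P : H3) : ℂ → ℂ :=
  Classical.epsilon (IsEisensteinContinuation φ P)

end HypThree

end

/-!
The Eisenstein series is a quotient of two zeta functions. Write `w = 1 + s`. A coset of `Γ'_∞` is
determined by the bottom row `(c, d)` of its elements up to sign, which is a coprime pair, and the
height of `γ P` is `r / Q(c, d)` for the hermitian form `Q(c, d) = |c z + d|² + |c|² r²`
(`heightForm`). In a principal ideal domain, every nonzero pair is uniquely a coprime pair times the
chosen generator of a nonzero ideal, so that summing over all pairs instead of the coprime ones
multiplies the sum by the Dedekind zeta function `ζ(w)` of the field (`hasSum_eisensteinTerm`):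
`E(P, s) = r ^ w / 2 · (∑ Q(c, d)⁻ʷ) / ζ(w)`.

Both zeta functions are Epstein zeta functions `∑ q(m)⁻ʷ` of positive definite real quadratic
forms, in 4 variables for the numerator and in 2 variables for `ζ`, where the form is the norm and
the sum counts each ideal once per unit. Poisson summation (`tsum_int_eq_tsum_integral`) exchanges
the theta series of a form and of its dual form (`exists_thetaPair`), and the Mellin transform
of the theta series gives the continuation and the functional equation (`ThetaPair.zetaMul`). The
Phragmén-Lindelöf principle and Stirling's bounds for the Gamma function turn the functional
equation into a convexity bound (`ThetaPair.exists_norm_zetaMul_le`), in which the form enters only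
through a lower bound for it and for its dual form; such lower bounds are uniform for `P` in a
compact set. On `Re w = 1` the numerator, multiplied by `w - 2`, is `≪ |t| ^ (2 + δ)`.

It remains to bound `1 / ζ` on the line `Re w = 1`. The convexity bound gives `ζ ≪ |t| ^ δ` in a
fixed neighbourhood of that line, Cauchy's estimate the same for `ζ'`, and the classical `3-4-1`
inequality `|ζ(σ)|³ |ζ(σ + i t)|⁴ |ζ(σ + 2 i t)| ≥ 1`, with `σ - 1` a small negative power of
`|t|`, then bounds `ζ(1 + i t)` from below by `|t| ^ (-ε)`
(`exists_le_norm_of_three_four_one`). The `3-4-1`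
inequality comes from sieving the sum over the ideals by the prime ideals
(`tendsto_prod_one_sub_mul_tsum`). In particular `ζ` has no zeros there, so that the quotient is
holomorphic on `Re s = 0`.
-/

open Complex.HadamardThreeLines

noncomputable section

namespace HypThree

/-! ### Vertical strips and Stirling's bounds -/

theorem one_add_abs_rpow_mul_exp_le {p : ℝ} (hp : 0 ≤ p) (y v : ℝ) :
    (1 + |y + v|) ^ p * Real.exp (-v ^ 2) ≤ Real.exp (p ^ 2) * (1 + |y|) ^ p := by
  have h1 : 1 + |y + v| ≤ (1 + |y|) * Real.exp |v| := by
    have h2 := Real.add_one_le_exp |v|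
    have h3 := abs_add_le y v
    nlinarith [abs_nonneg y, abs_nonneg v]
  calc (1 + |y + v|) ^ p * Real.exp (-v ^ 2)
      ≤ ((1 + |y|) * Real.exp |v|) ^ p * Real.exp (-v ^ 2) := by gcongr
    _ = (1 + |y|) ^ p * Real.exp (|v| * p - v ^ 2) := by
        rw [Real.mul_rpow (by positivity) (by positivity), ← Real.exp_mul, mul_assoc,
          ← Real.exp_add, sub_eq_add_neg]
    _ ≤ (1 + |y|) ^ p * Real.exp (p ^ 2) := by
        gcongr
        rw [← sq_abs v]
        nlinarith [sq_nonneg (|v| - p), abs_nonneg v, sq_nonneg p, sq_nonneg |v|]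
    _ = _ := mul_comm _ _

/-- A convexity bound for functions decaying like `exp (-π |Im z| / 2)` on vertical lines. -/
theorem norm_le_of_verticalClosedStrip {l u p q N A B : ℝ} {f : ℂ → ℂ} (hlu : l < u)
    (hp : 0 ≤ p) (hq : 0 ≤ q) (hN : 0 ≤ N) (hA : 0 < A)
    (hd : DiffContOnCl ℂ f (verticalStrip l u))
    (hB : ∀ z ∈ verticalClosedStrip l u, ‖f z‖ ≤ B * (1 + |z.im|) ^ N)
    (hl : ∀ z : ℂ, z.re = l →
      ‖f z‖ ≤ A * (1 + |z.im|) ^ p * Real.exp (-(Real.pi / 2 * |z.im|)))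
    (hu : ∀ z : ℂ, z.re = u →
      ‖f z‖ ≤ A * (1 + |z.im|) ^ q * Real.exp (-(Real.pi / 2 * |z.im|)))
    {z : ℂ} (hz : z ∈ verticalClosedStrip l u) :
    ‖f z‖ ≤ Real.exp ((u - l) ^ 2 + p ^ 2 + q ^ 2) * A *
      (1 + |z.im|) ^ (p * (1 - (z.re - l) / (u - l)) + q * ((z.re - l) / (u - l))) *
      Real.exp (-(Real.pi / 2 * |z.im|)) := by
  obtain ⟨σ, hσ, hσ1⟩ : ∃ σ : ℝ, σ * z.im = |z.im| ∧ |σ| = 1 := by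
    rcases le_total 0 z.im with h | h
    · exact ⟨1, by rw [abs_of_nonneg h, one_mul], abs_one⟩
    · exact ⟨-1, by rw [abs_of_nonpos h, neg_one_mul], by simp⟩
  -- The factor `exp ((w - z)² - i θ (w - z))` localises near `z`; the rotation `θ = ± π / 2`
  -- compensates the exponential decay of `f`.
  let h : ℂ → ℂ := fun w => Complex.exp ((w - z) ^ 2 - Complex.I * (σ * (Real.pi / 2)) * (w - z))
  have hhd : Differentiable ℂ h := by fun_prop
  have hz' : l ≤ z.re ∧ z.re ≤ u := hz
  have hnh : ∀ w ∈ verticalClosedStrip l u, ‖h w‖ ≤ Real.exp ((u - l) ^ 2) *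
      Real.exp (-(w.im - z.im) ^ 2) * Real.exp (σ * (Real.pi / 2) * (w.im - z.im)) := by
    intro w hw
    have hw' : l ≤ w.re ∧ w.re ≤ u := hw
    rw [Complex.norm_exp, ← Real.exp_add, ← Real.exp_add]
    apply Real.exp_le_exp.2
    simp [pow_two]
    have h3 : (w.re - z.re) * (w.re - z.re) ≤ (u - l) * (u - l) := by
      rw [← pow_two, ← pow_two]
      exact sq_le_sq' (by linarith [hz'.1, hz'.2, hw'.1, hw'.2])
        (by linarith [hz'.1, hz'.2, hw'.1, hw'.2])
    linarith
  have hrot : ∀ v : ℝ, -(Real.pi / 2 * |z.im + v|) + σ * (Real.pi / 2) * v ≤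
      -(Real.pi / 2 * |z.im|) := by
    intro v
    have h4 : σ * (z.im + v) ≤ |z.im + v| := by
      calc _ ≤ |σ * (z.im + v)| := le_abs_self _
        _ = _ := by rw [abs_mul, hσ1, one_mul]
    have := Real.pi_pos
    nlinarith
  have hline : ∀ {r : ℝ} (_ : 0 ≤ r) (w : ℂ) (_ : w ∈ verticalClosedStrip l u)
      (_ : ‖f w‖ ≤ A * (1 + |w.im|) ^ r * Real.exp (-(Real.pi / 2 * |w.im|))),
      ‖f w * h w‖ ≤ Real.exp ((u - l) ^ 2 + r ^ 2) * A * (1 + |z.im|) ^ r *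
        Real.exp (-(Real.pi / 2 * |z.im|)) := by
    intro r hr w hw hfw
    obtain ⟨v, hv⟩ : ∃ v, w.im = z.im + v := ⟨w.im - z.im, by ring⟩
    have h1 := hnh w hw
    rw [hv] at hfw h1
    rw [add_sub_cancel_left] at h1
    rw [norm_mul]
    calc ‖f w‖ * ‖h w‖ ≤ (A * (1 + |z.im + v|) ^ r * Real.exp (-(Real.pi / 2 * |z.im + v|))) *
          (Real.exp ((u - l) ^ 2) * Real.exp (-v ^ 2) * Real.exp (σ * (Real.pi / 2) * v)) := by
          gcongr
      _ = A * Real.exp ((u - l) ^ 2) * ((1 + |z.im + v|) ^ r * Real.exp (-v ^ 2)) *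
          Real.exp (-(Real.pi / 2 * |z.im + v|) + σ * (Real.pi / 2) * v) := by
          rw [Real.exp_add (-(Real.pi / 2 * |z.im + v|))]; ring
      _ ≤ A * Real.exp ((u - l) ^ 2) * (Real.exp (r ^ 2) * (1 + |z.im|) ^ r) *
          Real.exp (-(Real.pi / 2 * |z.im|)) := by
          have h9 := one_add_abs_rpow_mul_exp_le hr z.im v
          have h10 := Real.exp_le_exp.2 (hrot v)
          exact mul_le_mul (mul_le_mul_of_nonneg_left h9 (by positivity)) h10 (by positivity)
            (by positivity)
      _ = _ := by rw [Real.exp_add]; ring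
  have hbdd : BddAbove ((norm ∘ fun w => f w * h w) '' verticalClosedStrip l u) := by
    refine ⟨B * (Real.exp ((u - l) ^ 2) * (Real.exp ((N + 2) ^ 2) * (1 + |z.im|) ^ (N + 2))), ?_⟩
    rintro _ ⟨w, hw, rfl⟩
    obtain ⟨v, hv⟩ : ∃ v, w.im = z.im + v := ⟨w.im - z.im, by ring⟩
    have h1 := hnh w hw
    have h2 := hB w hw
    have hB0 : 0 ≤ B := by
      have := (norm_nonneg _).trans h2
      have h5 : (0 : ℝ) < (1 + |w.im|) ^ N := by positivity
      exact nonneg_of_mul_nonneg_left this h5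
    rw [hv] at h1 h2
    rw [add_sub_cancel_left] at h1
    change ‖f w * h w‖ ≤ _
    rw [norm_mul]
    have h6 : (1 + |z.im + v|) ^ N * Real.exp (σ * (Real.pi / 2) * v) * Real.exp (-v ^ 2) ≤
        Real.exp ((N + 2) ^ 2) * (1 + |z.im|) ^ (N + 2) := by
      have h7 : 1 + |z.im + v| ≤ (1 + |z.im|) * Real.exp |v| := by
        have h2 := Real.add_one_le_exp |v|
        have h3 := abs_add_le z.im v
        nlinarith [abs_nonneg z.im, abs_nonneg v]
      have h8 : σ * (Real.pi / 2) * v ≤ 2 * |v| := by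
        calc _ ≤ |σ * (Real.pi / 2) * v| := le_abs_self _
          _ = (Real.pi / 2) * |v| := by
            rw [abs_mul, abs_mul, hσ1, one_mul, abs_of_pos (by positivity)]
          _ ≤ _ := by
            gcongr
            linarith [Real.pi_le_four]
      calc (1 + |z.im + v|) ^ N * Real.exp (σ * (Real.pi / 2) * v) * Real.exp (-v ^ 2)
          ≤ ((1 + |z.im|) * Real.exp |v|) ^ N * Real.exp (2 * |v|) * Real.exp (-v ^ 2) := by
            gcongr
        _ = (1 + |z.im|) ^ N * Real.exp (|v| * N + 2 * |v| + -v ^ 2) := by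
            rw [Real.mul_rpow (by positivity) (by positivity), ← Real.exp_mul, Real.exp_add,
              Real.exp_add]
            ring
        _ ≤ (1 + |z.im|) ^ (N + 2) * Real.exp ((N + 2) ^ 2) := by
            gcongr
            · linarith [abs_nonneg z.im]
            · linarith
            · rw [← sq_abs v]
              nlinarith [sq_nonneg (|v| - (N + 2)), abs_nonneg v, sq_nonneg (N + 2), sq_nonneg |v|]
        _ = _ := mul_comm _ _
    calc ‖f w‖ * ‖h w‖ ≤ (B * (1 + |z.im + v|) ^ N) *
          (Real.exp ((u - l) ^ 2) * Real.exp (-v ^ 2) * Real.exp (σ * (Real.pi / 2) * v)) := by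
          gcongr
      _ = B * (Real.exp ((u - l) ^ 2) *
          ((1 + |z.im + v|) ^ N * Real.exp (σ * (Real.pi / 2) * v) * Real.exp (-v ^ 2))) := by ring
      _ ≤ _ := by gcongr
  have hmain := norm_le_interp_of_mem_verticalClosedStrip' (f := fun w => f w * h w)
    (a := Real.exp ((u - l) ^ 2 + p ^ 2) * A * (1 + |z.im|) ^ p *
        Real.exp (-(Real.pi / 2 * |z.im|)))
    (b := Real.exp ((u - l) ^ 2 + q ^ 2) * A * (1 + |z.im|) ^ q *
        Real.exp (-(Real.pi / 2 * |z.im|))) hlu hz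
    (hd.smul hhd.diffContOnCl) hbdd
    (fun w hw => hline hp w (by
      have : w.re = l := hw
      change w.re ∈ Set.Icc l u
      rw [this]; exact ⟨le_rfl, hlu.le⟩) (hl w hw))
    (fun w hw => hline hq w (by
      have : w.re = u := hw
      change w.re ∈ Set.Icc l u
      rw [this]; exact ⟨hlu.le, le_rfl⟩) (hu w hw))
  have hhz : h z = 1 := by simp [h]
  simp only [hhz, mul_one] at hmain
  refine hmain.trans ?_
  set τ := (z.re - l) / (u - l) with hτ
  have hτ0 : 0 ≤ τ := div_nonneg (by linarith [hz'.1]) (by linarith)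
  have hτ1 : 0 ≤ 1 - τ := by
    rw [hτ, sub_nonneg, div_le_one (by linarith)]
    linarith [hz'.2]
  set E := Real.exp (-(Real.pi / 2 * |z.im|))
  set C := Real.exp ((u - l) ^ 2 + p ^ 2 + q ^ 2)
  have hT : 0 < 1 + |z.im| := by positivity
  have e1 : (Real.exp ((u - l) ^ 2 + p ^ 2) * A * (1 + |z.im|) ^ p * E) ^ (1 - τ) ≤
      (C * A * E) ^ (1 - τ) * (1 + |z.im|) ^ (p * (1 - τ)) := by
    rw [Real.rpow_mul hT.le, ← Real.mul_rpow (by positivity) (by positivity)]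
    apply Real.rpow_le_rpow (by positivity) _ hτ1
    rw [mul_right_comm]
    have h11 : Real.exp ((u - l) ^ 2 + p ^ 2) ≤ C :=
      Real.exp_le_exp.2 (by nlinarith [sq_nonneg q])
    gcongr
  have e2 : (Real.exp ((u - l) ^ 2 + q ^ 2) * A * (1 + |z.im|) ^ q * E) ^ τ ≤
      (C * A * E) ^ τ * (1 + |z.im|) ^ (q * τ) := by
    rw [Real.rpow_mul hT.le, ← Real.mul_rpow (by positivity) (by positivity)]
    apply Real.rpow_le_rpow (by positivity) _ hτ0
    rw [mul_right_comm]
    have h11 : Real.exp ((u - l) ^ 2 + q ^ 2) ≤ C :=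
      Real.exp_le_exp.2 (by nlinarith [sq_nonneg p])
    gcongr
  calc _ ≤ (C * A * E) ^ (1 - τ) * (1 + |z.im|) ^ (p * (1 - τ)) *
        ((C * A * E) ^ τ * (1 + |z.im|) ^ (q * τ)) := by gcongr
    _ = ((C * A * E) ^ (1 - τ) * (C * A * E) ^ τ) *
        ((1 + |z.im|) ^ (p * (1 - τ)) * (1 + |z.im|) ^ (q * τ)) := by ring
    _ = (C * A * E) * (1 + |z.im|) ^ (p * (1 - τ) + q * τ) := by
        rw [← Real.rpow_add (by positivity), ← Real.rpow_add hT, sub_add_cancel, Real.rpow_one]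
    _ = _ := by ring

theorem norm_Gamma_le_Gamma_re {z : ℂ} (hz : 0 < z.re) : ‖Complex.Gamma z‖ ≤ Real.Gamma z.re := by
  rw [Complex.Gamma_eq_integral hz, Real.Gamma_eq_integral hz, Complex.GammaIntegral]
  refine (MeasureTheory.norm_integral_le_integral_norm _).trans_eq ?_
  refine MeasureTheory.setIntegral_congr_fun measurableSet_Ioi fun x hx => ?_
  have hx' : (0 : ℝ) < x := hx
  simp only [norm_mul, Complex.norm_cpow_eq_rpow_re_of_pos hx']
  rw [Complex.norm_real, Real.norm_of_nonneg (Real.exp_pos _).le]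
  simp

/-- By the reflection formula, `|Γ(1/2 + i y)|² = π / cosh (π y)`. -/
theorem norm_Gamma_half_add (y : ℝ) :
    ‖Complex.Gamma (1 / 2 + y * Complex.I)‖ ≤ 3 * Real.exp (-(Real.pi / 2 * |y|)) := by
  have h1 := Complex.Gamma_mul_Gamma_one_sub (1 / 2 + y * Complex.I)
  have h2 : (1 : ℂ) - (1 / 2 + y * Complex.I) = (starRingEnd ℂ) (1 / 2 + y * Complex.I) := by
    simp [map_ofNat]
    ring
  have h3 : Complex.sin (Real.pi * (1 / 2 + y * Complex.I)) = Real.cosh (Real.pi * y) := by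
    rw [show (Real.pi * (1 / 2 + y * Complex.I) : ℂ) =
      ((Real.pi * y : ℝ) : ℂ) * Complex.I + Real.pi / 2 by push_cast; ring,
      Complex.sin_add_pi_div_two, Complex.cos_mul_I, Complex.ofReal_cosh]
  rw [h2, Complex.Gamma_conj, Complex.mul_conj, h3, Complex.normSq_eq_norm_sq, ← Complex.ofReal_div,
    Complex.ofReal_inj] at h1
  have h4 : Real.exp (Real.pi * |y|) / 2 ≤ Real.cosh (Real.pi * y) := by
    rw [← Real.cosh_abs, abs_mul, abs_of_pos Real.pi_pos, Real.cosh_eq]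
    have := Real.exp_pos (-(Real.pi * |y|))
    linarith
  have h5 : ‖Complex.Gamma (1 / 2 + y * Complex.I)‖ ^ 2 ≤
      (3 * Real.exp (-(Real.pi / 2 * |y|))) ^ 2 := by
    rw [h1, mul_pow, ← Real.exp_nat_mul, div_le_iff₀ (Real.cosh_pos _)]
    calc Real.pi ≤ 3 ^ 2 * (1 / 2) := by linarith [Real.pi_le_four]
      _ = 3 ^ 2 * (Real.exp (-(Real.pi * |y|)) * (Real.exp (Real.pi * |y|) / 2)) := by
        rw [← mul_div_assoc (Real.exp _), ← Real.exp_add]; simp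
      _ ≤ 3 ^ 2 * (Real.exp (-(Real.pi * |y|)) * Real.cosh (Real.pi * y)) := by gcongr
      _ = _ := by
        rw [show ((2 : ℕ) : ℝ) * -(Real.pi / 2 * |y|) = -(Real.pi * |y|) by push_cast; ring]
        ring
  exact le_of_sq_le_sq h5 (by positivity)

/-- Stirling's upper bound in the strip `1/2 ≤ Re z ≤ 3/2`, interpolated between the exact values
on the boundary lines. -/
theorem exists_norm_Gamma_le_strip : ∃ C : ℝ, 0 < C ∧ ∀ z : ℂ, 1 / 2 ≤ z.re → z.re ≤ 3 / 2 →
    ‖Complex.Gamma z‖ ≤ C * (1 + |z.im|) ^ (z.re - 1 / 2) *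
      Real.exp (-(Real.pi / 2 * |z.im|)) := by
  have hdiff : ∀ z : ℂ, 0 < z.re → DifferentiableAt ℂ Complex.Gamma z := fun z hz =>
    Complex.differentiableAt_Gamma z fun m h => by
      rw [h] at hz
      simp at hz
      linarith [(Nat.cast_nonneg m : (0 : ℝ) ≤ m)]
  obtain ⟨B, hB⟩ : ∃ B, ∀ x ∈ Set.Icc (1 / 2 : ℝ) (3 / 2), ‖Real.Gamma x‖ ≤ B := by
    refine isCompact_Icc.exists_bound_of_continuousOn fun x hx => ?_
    refine (Real.differentiableAt_Gamma fun m => ?_).continuousAt.continuousWithinAt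
    have : (0 : ℝ) ≤ m := Nat.cast_nonneg m
    linarith [hx.1]
  have hhalf : ∀ z : ℂ, z.re = 1 / 2 →
      ‖Complex.Gamma z‖ ≤ 3 * Real.exp (-(Real.pi / 2 * |z.im|)) := by
    intro z hz
    have := norm_Gamma_half_add z.im
    rwa [show (1 / 2 : ℂ) + z.im * Complex.I = z by
      conv_rhs => rw [← Complex.re_add_im z, hz]
      push_cast; ring] at this
  refine ⟨Real.exp ((3 / 2 - 1 / 2) ^ 2 + 0 ^ 2 + 1 ^ 2) * 6, by positivity, fun z h1 h2 =>
    (norm_le_of_verticalClosedStrip (l := 1 / 2) (u := 3 / 2) (p := 0) (q := 1) (N := 0)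
      (A := 6) (B := B) (f := Complex.Gamma) (by norm_num) le_rfl zero_le_one le_rfl
      (by norm_num) ?_ ?_ ?_ ?_ ⟨h1, h2⟩).trans_eq ?_⟩
  · refine DifferentiableOn.diffContOnCl fun w hw => (hdiff w ?_).differentiableWithinAt
    rw [verticalStrip, Complex.closure_preimage_re, closure_Ioo (by norm_num)] at hw
    have : (1 / 2 : ℝ) ≤ w.re := hw.1
    linarith
  · intro w hw
    have h3 : (1 / 2 : ℝ) ≤ w.re := hw.1
    rw [Real.rpow_zero, mul_one]
    exact (norm_Gamma_le_Gamma_re (by linarith)).trans ((le_abs_self _).trans (hB _ hw))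
  · intro w hw
    rw [Real.rpow_zero, mul_one]
    refine (hhalf w hw).trans ?_
    gcongr
    norm_num
  · intro w hw
    have h3 : ‖Complex.Gamma (w - 1)‖ ≤ 3 * Real.exp (-(Real.pi / 2 * |w.im|)) := by
      have := hhalf (w - 1) (by simp [hw]; norm_num)
      simpa using this
    have h4 : Complex.Gamma w = (w - 1) * Complex.Gamma (w - 1) := by
      rw [← Complex.Gamma_add_one, sub_add_cancel]
      intro h
      have := congrArg Complex.re h
      simp [hw] at this
      norm_num at this
    have h5 : ‖w - 1‖ ≤ 1 + |w.im| := by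
      refine (Complex.norm_le_abs_re_add_abs_im _).trans ?_
      simp [hw]
      norm_num
    rw [h4, norm_mul, Real.rpow_one]
    calc _ ≤ (1 + |w.im|) * (3 * Real.exp (-(Real.pi / 2 * |w.im|))) := by gcongr
      _ ≤ _ := by
        have : 0 ≤ (1 + |w.im|) * Real.exp (-(Real.pi / 2 * |w.im|)) := by positivity
        linarith
  · congr 3
    ring

/-- Stirling's upper bound `|Γ(x + i y)| ≪ (1 + |y|)^{x - 1/2} e^{-π |y| / 2}`. -/
theorem exists_norm_Gamma_le (n : ℕ) : ∃ C : ℝ, 0 < C ∧ ∀ z : ℂ, 1 / 2 + n ≤ z.re →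
    z.re ≤ 3 / 2 + n → ‖Complex.Gamma z‖ ≤ C * (1 + |z.im|) ^ (z.re - 1 / 2) *
      Real.exp (-(Real.pi / 2 * |z.im|)) := by
  induction n with
  | zero => simpa using exists_norm_Gamma_le_strip
  | succ n ih =>
    obtain ⟨C, hC, h⟩ := ih
    refine ⟨(n + 2) * C, by positivity, fun z h1 h2 => ?_⟩
    push_cast at h1 h2
    have h3 := h (z - 1) (by simp; linarith) (by simp; linarith)
    have h4 : Complex.Gamma z = (z - 1) * Complex.Gamma (z - 1) := by
      rw [← Complex.Gamma_add_one, sub_add_cancel]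
      intro h0
      have := congrArg Complex.re h0
      simp at this
      have : (0 : ℝ) ≤ n := Nat.cast_nonneg n
      linarith
    have h5 : ‖z - 1‖ ≤ (n + 2) * (1 + |z.im|) := by
      refine (Complex.norm_le_abs_re_add_abs_im _).trans ?_
      have : (0 : ℝ) ≤ n := Nat.cast_nonneg n
      simp
      rw [abs_of_nonneg (by linarith)]
      nlinarith [abs_nonneg z.im]
    rw [h4, norm_mul]
    simp only [Complex.sub_im, Complex.one_im, sub_zero, Complex.sub_re, Complex.one_re] at h3
    calc _ ≤ ((n + 2) * (1 + |z.im|)) * (C * (1 + |z.im|) ^ (z.re - 1 - 1 / 2) *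
          Real.exp (-(Real.pi / 2 * |z.im|))) := by gcongr
      _ = (n + 2) * C * ((1 + |z.im|) ^ (z.re - 1 - 1 / 2) * (1 + |z.im|)) *
          Real.exp (-(Real.pi / 2 * |z.im|)) := by ring
      _ = _ := by
        rw [← Real.rpow_add_one (by positivity),
          show z.re - 1 - 1 / 2 + 1 = z.re - 1 / 2 by ring]

theorem norm_sin_le (z : ℂ) : ‖Complex.sin z‖ ≤ Real.exp |z.im| := by
  have h1 : ‖Complex.exp (-z * Complex.I)‖ ≤ Real.exp |z.im| := by
    rw [Complex.norm_exp]
    simpa using le_abs_self _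
  have h2 : ‖Complex.exp (z * Complex.I)‖ ≤ Real.exp |z.im| := by
    rw [Complex.norm_exp]
    simpa using neg_le_abs _
  rw [Complex.sin, norm_div, norm_mul, Complex.norm_I, mul_one, Complex.norm_ofNat,
    div_le_iff₀ two_pos]
  linarith [norm_sub_le (Complex.exp (-z * Complex.I)) (Complex.exp (z * Complex.I))]

/-- Stirling's lower bound for `|Γ(w + 1)|` in the strip `1/2 ≤ Re w ≤ 3/2`; by the reflection
formula it is an upper bound for `|Γ(2 - w)|`. -/
theorem exists_norm_inv_Gamma_add_one_le : ∃ C : ℝ, 0 < C ∧ ∀ w : ℂ, 1 / 2 ≤ w.re →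
    w.re ≤ 3 / 2 → ‖(Complex.Gamma (w + 1))⁻¹‖ ≤ C * (1 + |w.im|) ^ (-1 / 2 - w.re) *
      Real.exp (Real.pi / 2 * |w.im|) := by
  obtain ⟨C, hC, h⟩ := exists_norm_Gamma_le_strip
  obtain ⟨B, hB⟩ : ∃ B, ∀ w ∈ Set.Icc (1 / 2 : ℝ) (3 / 2) ×ℂ Set.Icc (-1 : ℝ) 1,
      ‖(Complex.Gamma (w + 1))⁻¹‖ ≤ B := by
    refine (isCompact_Icc.reProdIm isCompact_Icc).exists_bound_of_continuousOn ?_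
    exact (Complex.differentiable_one_div_Gamma.continuous.comp
      (continuous_add_const 1)).continuousOn
  have hB0 : 0 ≤ B := (norm_nonneg _).trans (hB 1 ⟨by norm_num, by norm_num⟩)
  refine ⟨4 * C + 4 * B, by positivity, fun w h1 h2 => ?_⟩
  rcases le_or_gt |w.im| 1 with ht | ht
  · have h3 := hB w ⟨⟨h1, h2⟩, abs_le.1 ht⟩
    have h4 : (1 / 4 : ℝ) ≤ (1 + |w.im|) ^ (-1 / 2 - w.re) := by
      calc (1 / 4 : ℝ) = 2 ^ (-2 : ℝ) := by
            rw [Real.rpow_neg two_pos.le]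
            norm_num
        _ ≤ 2 ^ (-1 / 2 - w.re) := by
            apply Real.rpow_le_rpow_of_exponent_le <;> linarith
        _ ≤ _ := by
            apply Real.rpow_le_rpow_of_nonpos <;> first | positivity | linarith
    have h5 : 1 ≤ Real.exp (Real.pi / 2 * |w.im|) := Real.one_le_exp (by positivity)
    calc _ ≤ B := h3
      _ ≤ (4 * C + 4 * B) * (1 / 4) * 1 := by linarith
      _ ≤ _ := by gcongr
  · have hT : 0 < 1 + |w.im| := by positivity
    have him : w.im ≠ 0 := fun h0 => by rw [h0, abs_zero] at ht; linarith
    have hw1 : (1 : ℂ) - w ≠ 0 := fun h0 => him (by simpa using congrArg Complex.im h0)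
    have hw0 : w ≠ 0 := fun h0 => him (by simp [h0])
    have e1 : Complex.Gamma (w + 1) = w * Complex.Gamma w := Complex.Gamma_add_one w hw0
    have e2 : Complex.Gamma (2 - w) = (1 - w) * Complex.Gamma (1 - w) := by
      rw [← Complex.Gamma_add_one _ hw1]
      congr 1
      ring
    have hsin : Complex.sin (Real.pi * w) ≠ 0 := by
      rw [Complex.sin_ne_zero_iff]
      intro n hn
      have := congrArg Complex.im hn
      simp [Real.pi_ne_zero] at this
      exact him this
    have e3 : (Complex.Gamma (w + 1))⁻¹ =
        Complex.Gamma (2 - w) * Complex.sin (Real.pi * w) / (w * (1 - w) * Real.pi) := by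
      have h6 := Complex.Gamma_mul_Gamma_one_sub w
      have h7 : Complex.Gamma w ≠ 0 := Complex.Gamma_ne_zero_of_re_pos (by linarith)
      have hpi : (Real.pi : ℂ) ≠ 0 := by exact_mod_cast Real.pi_ne_zero
      rw [eq_div_iff hsin] at h6
      rw [e1, e2]
      generalize Complex.sin (Real.pi * w) = S at *
      field_simp
      linear_combination -h6
    have h8 := h (2 - w) (by simp; linarith) (by simp; linarith)
    simp only [Complex.sub_im, Complex.sub_re, Complex.re_ofNat, Complex.im_ofNat, zero_sub,
      abs_neg] at h8
    have h9 := norm_sin_le (Real.pi * w)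
    rw [Complex.im_ofReal_mul, abs_mul, abs_of_pos Real.pi_pos] at h9
    have h10 : (1 + |w.im|) / 2 ≤ ‖w‖ := by
      have := Complex.abs_im_le_norm w
      linarith
    have h11 : (1 + |w.im|) / 2 ≤ ‖1 - w‖ := by
      have := Complex.abs_im_le_norm (1 - w)
      simp at this
      linarith
    rw [e3, norm_div, norm_mul, norm_mul, norm_mul, Complex.norm_real, Real.norm_of_nonneg
      Real.pi_pos.le, div_le_iff₀ (by positivity)]
    calc _ ≤ (C * (1 + |w.im|) ^ (2 - w.re - 1 / 2) * Real.exp (-(Real.pi / 2 * |w.im|))) *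
          Real.exp (Real.pi * |w.im|) := by gcongr
      _ = C * (1 + |w.im|) ^ (2 - w.re - 1 / 2) * Real.exp (Real.pi / 2 * |w.im|) := by
          rw [mul_assoc, ← Real.exp_add]
          ring_nf
      _ = 4 * C * (1 + |w.im|) ^ (-1 / 2 - w.re) * Real.exp (Real.pi / 2 * |w.im|) *
          ((1 + |w.im|) / 2 * ((1 + |w.im|) / 2) * 1) := by
          rw [show 2 - w.re - 1 / 2 = (-1 / 2 - w.re) + 1 + 1 by ring, Real.rpow_add_one hT.ne',
            Real.rpow_add_one hT.ne']
          ring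
      _ ≤ (4 * C + 4 * B) * (1 + |w.im|) ^ (-1 / 2 - w.re) * Real.exp (Real.pi / 2 * |w.im|) *
          (‖w‖ * ‖1 - w‖ * Real.pi) := by
          have h12 := Real.pi_gt_three
          have h13 : 1 ≤ Real.pi := by linarith
          gcongr
          linarith

/-! ### Theta series -/

section Theta

variable {d : Type*} [Fintype d]

theorem one_le_norm_of_ne_zero {m : d → ℤ} (hm : m ≠ 0) : 1 ≤ ‖m‖ := by
  obtain ⟨i, hi⟩ := Function.ne_iff.1 hm
  refine le_trans ?_ (norm_le_pi_norm m i)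
  rw [Int.norm_eq_abs]
  exact_mod_cast Int.one_le_abs hi

theorem summable_norm_int_rpow {r : ℝ} (hr : r < -(Fintype.card d : ℝ)) :
    Summable fun m : d → ℤ => ‖m‖ ^ r := by
  classical
  let b := Pi.basisFun ℝ d
  let L := Submodule.span ℤ (Set.range b)
  let bL : Module.Basis d ℤ L := b.restrictScalars ℤ
  have hfin : Module.finrank ℤ L = Fintype.card d := Module.finrank_eq_card_basis bL
  have h := ZLattice.summable_norm_rpow L r (by rw [hfin]; exact hr)
  rw [← bL.equivFun.symm.toEquiv.summable_iff] at h
  refine h.congr fun m => ?_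
  have h1 : ((bL.equivFun.symm m : L) : d → ℝ) = fun i => (m i : ℝ) := by
    have hb : ∀ x, ((bL x : L) : d → ℝ) = Pi.single x 1 := fun x =>
      (b.restrictScalars_apply ℤ x).trans (Pi.basisFun_apply ℝ d x)
    rw [bL.equivFun_symm_apply]
    ext i
    simp [hb, Pi.single_apply]
  change ‖(bL.equivFun.symm m : L)‖ ^ r = _
  rw [Submodule.coe_norm, h1]
  congr 1

/-- A function on `ℤ^d` that vanishes at `0` and dominates `κ ‖m‖²`, such as a positive definite
quadratic form. -/
structure QuadraticGrowth (κ : ℝ) (q : (d → ℤ) → ℝ) : Prop where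
  zero : q 0 = 0
  le : ∀ m, κ * ‖m‖ ^ 2 ≤ q m

/-- The theta series `∑ₘ exp (-π q(m) t)` of a function `q` on `ℤ^d`. -/
def theta (q : (d → ℤ) → ℝ) (t : ℝ) : ℝ := ∑' m, Real.exp (-Real.pi * q m * t)

namespace QuadraticGrowth

variable {κ : ℝ} {q : (d → ℤ) → ℝ}

theorem nonneg (h : QuadraticGrowth κ q) (hκ : 0 < κ) (m : d → ℤ) : 0 ≤ q m :=
  le_trans (by positivity) (h.le m)

theorem le_of_ne_zero (h : QuadraticGrowth κ q) (hκ : 0 < κ) {m : d → ℤ} (hm : m ≠ 0) :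
    κ ≤ q m := by
  refine le_trans ?_ (h.le m)
  have := one_le_pow₀ (n := 2) (one_le_norm_of_ne_zero hm)
  nlinarith

theorem eq_zero_iff (h : QuadraticGrowth κ q) (hκ : 0 < κ) (m : d → ℤ) : q m = 0 ↔ m = 0 := by
  refine ⟨fun h0 => ?_, fun h0 => h0 ▸ h.zero⟩
  by_contra hm
  linarith [h.le_of_ne_zero hκ hm]

theorem summable_exp (h : QuadraticGrowth κ q) (hκ : 0 < κ) {t : ℝ} (ht : 0 < t) :
    Summable fun m => Real.exp (-Real.pi * q m * t) := by
  let n := Fintype.card d + 1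
  have h1 : Summable fun m : d → ℤ => (n.factorial / (Real.pi * κ * t) ^ n) *
      ‖m‖ ^ (-(2 * n : ℝ)) := by
    refine (summable_norm_int_rpow ?_).mul_left _
    simp only [n]
    push_cast
    have : (0 : ℝ) ≤ Fintype.card d := Nat.cast_nonneg _
    linarith
  refine Summable.of_norm_bounded_eventually h1 ?_
  have h0 : ({0}ᶜ : Set (d → ℤ)) ∈ Filter.cofinite := (Set.finite_singleton _).compl_mem_cofinite
  filter_upwards [h0] with m hm
  have hm0 : 1 ≤ ‖m‖ := one_le_norm_of_ne_zero hm
  have hx : 0 < Real.pi * κ * t * ‖m‖ ^ 2 := by positivity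
  rw [Real.norm_of_nonneg (Real.exp_pos _).le]
  calc Real.exp (-Real.pi * q m * t) ≤ Real.exp (-(Real.pi * κ * t * ‖m‖ ^ 2)) := by
        apply Real.exp_le_exp.2
        have h3 := mul_le_mul_of_nonneg_left (h.le m) (show 0 ≤ Real.pi * t by positivity)
        linarith
    _ ≤ n.factorial / (Real.pi * κ * t * ‖m‖ ^ 2) ^ n := by
        rw [Real.exp_neg, inv_le_comm₀ (Real.exp_pos _) (by positivity), inv_div]
        exact Real.pow_div_factorial_le_exp _ hx.le n
    _ = _ := by
        rw [mul_pow, ← pow_mul, Real.rpow_neg (by positivity), div_mul_eq_div_div,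
          show (2 * n : ℝ) = ((2 * n : ℕ) : ℝ) by push_cast; ring, Real.rpow_natCast]
        rfl

theorem rpow_le (h : QuadraticGrowth κ q) (hκ : 0 < κ) {σ : ℝ} (hσ : 0 < σ) (m : d → ℤ) :
    q m ^ (-σ) ≤ κ ^ (-σ) * ‖m‖ ^ (-(2 * σ)) := by
  rcases eq_or_ne m 0 with rfl | hm
  · rw [h.zero, Real.zero_rpow (by linarith)]
    positivity
  · have hm0 : 1 ≤ ‖m‖ := one_le_norm_of_ne_zero hm
    have : ‖m‖ ^ (-(2 * σ)) = (‖m‖ ^ 2) ^ (-σ) := by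
      rw [← Real.rpow_natCast, ← Real.rpow_mul (norm_nonneg _)]
      push_cast
      ring_nf
    rw [this, ← Real.mul_rpow hκ.le (by positivity)]
    exact Real.rpow_le_rpow_of_nonpos (by positivity) (h.le m) (by linarith)

theorem summable_rpow (h : QuadraticGrowth κ q) (hκ : 0 < κ) {σ : ℝ} (hσ0 : 0 < σ)
    (hσ : (Fintype.card d : ℝ) / 2 < σ) : Summable fun m => q m ^ (-σ) :=
  Summable.of_nonneg_of_le (fun m => Real.rpow_nonneg (h.nonneg hκ m) _) (h.rpow_le hκ hσ0)
    ((summable_norm_int_rpow (by linarith)).mul_left _)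

theorem tsum_rpow_le (h : QuadraticGrowth κ q) (hκ : 0 < κ) {σ : ℝ} (hσ0 : 0 < σ)
    (hσ : (Fintype.card d : ℝ) / 2 < σ) :
    ∑' m, q m ^ (-σ) ≤ κ ^ (-σ) * ∑' m : d → ℤ, ‖m‖ ^ (-(2 * σ)) := by
  rw [← tsum_mul_left]
  exact (h.summable_rpow hκ hσ0 hσ).tsum_le_tsum (h.rpow_le hκ hσ0)
    ((summable_norm_int_rpow (by linarith)).mul_left _)

theorem norm_cpow (h : QuadraticGrowth κ q) (hκ : 0 < κ) {w : ℂ} (hw : 0 < w.re) (m : d → ℤ) :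
    ‖(q m : ℂ) ^ (-w)‖ = q m ^ (-w.re) := by
  rcases eq_or_ne (q m) 0 with h0 | h0
  · have hw0 : w ≠ 0 := fun h1 => by simp [h1] at hw
    rw [h0, Complex.ofReal_zero, Complex.zero_cpow (neg_ne_zero.2 hw0), norm_zero,
      Real.zero_rpow (by linarith)]
  · rw [Complex.norm_cpow_eq_rpow_re_of_pos ((h.nonneg hκ m).lt_of_ne' h0), Complex.neg_re]

theorem summable_cpow (h : QuadraticGrowth κ q) (hκ : 0 < κ) {w : ℂ} (hw0 : 0 < w.re)
    (hw : (Fintype.card d : ℝ) / 2 < w.re) : Summable fun m => (q m : ℂ) ^ (-w) := by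
  apply Summable.of_norm
  simp_rw [h.norm_cpow hκ hw0]
  exact h.summable_rpow hκ hw0 hw

theorem hasSum_theta_sub_one (h : QuadraticGrowth κ q) (hκ : 0 < κ) {t : ℝ} (ht : 0 < t) :
    HasSum (fun m => if q m = 0 then 0 else Real.exp (-Real.pi * q m * t)) (theta q t - 1) := by
  classical
  have h1 := (h.summable_exp hκ ht).hasSum
  have h2 := hasSum_ite_eq (0 : d → ℤ) (1 : ℝ)
  refine (h1.sub h2).congr_fun ?_
  intro m
  rcases eq_or_ne m 0 with rfl | hm
  · simp [h.zero]
  · simp [hm, mt (h.eq_zero_iff hκ m).1 hm]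

theorem one_le_theta (h : QuadraticGrowth κ q) (hκ : 0 < κ) {t : ℝ} (ht : 0 < t) :
    1 ≤ theta q t := by
  rw [← sub_nonneg]
  refine (h.hasSum_theta_sub_one hκ ht).nonneg fun m => ?_
  positivity

theorem theta_antitoneOn (h : QuadraticGrowth κ q) (hκ : 0 < κ) :
    AntitoneOn (theta q) (Set.Ioi 0) := by
  intro s hs t ht hst
  refine (h.summable_exp hκ ht).tsum_le_tsum (fun m => ?_) (h.summable_exp hκ hs)
  apply Real.exp_le_exp.2
  have := mul_le_mul_of_nonneg_left hst (mul_nonneg Real.pi_pos.le (h.nonneg hκ m))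
  linarith

theorem theta_le (h : QuadraticGrowth κ q) (hκ : 0 < κ) {t : ℝ} (ht : 0 < t) :
    theta q t ≤ theta (fun m : d → ℤ => κ * ‖m‖ ^ 2) t := by
  have h0 : QuadraticGrowth κ fun m : d → ℤ => κ * ‖m‖ ^ 2 := ⟨by simp, fun _ => le_rfl⟩
  refine (h.summable_exp hκ ht).tsum_le_tsum (fun m => ?_) (h0.summable_exp hκ ht)
  apply Real.exp_le_exp.2
  have := mul_le_mul_of_nonneg_left (h.le m) (mul_nonneg Real.pi_pos.le ht.le)
  linarith

theorem theta_sub_one_le (h : QuadraticGrowth κ q) (hκ : 0 < κ) {t : ℝ} (ht : 1 ≤ t) :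
    theta q t - 1 ≤ Real.exp (Real.pi * κ) * (theta q 1 - 1) * Real.exp (-(Real.pi * κ) * t) := by
  have h1 := (h.hasSum_theta_sub_one hκ one_pos).mul_left
    (Real.exp (Real.pi * κ) * Real.exp (-(Real.pi * κ) * t))
  rw [mul_right_comm]
  refine hasSum_le (fun m => ?_) (h.hasSum_theta_sub_one hκ (by linarith)) h1
  split_ifs with hm
  · simp
  · rw [← Real.exp_add, ← Real.exp_add]
    apply Real.exp_le_exp.2
    have h2 := h.le_of_ne_zero hκ (m := m) fun h0 => hm (by rw [h0, h.zero])
    have h3 := mul_nonneg (sub_nonneg.2 h2) (sub_nonneg.2 ht)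
    have := mul_nonneg Real.pi_pos.le h3
    linarith

theorem theta_isBigO (h : QuadraticGrowth κ q) (hκ : 0 < κ) (r : ℝ) :
    (fun t => (theta q t : ℂ) - 1) =O[Filter.atTop] fun t => t ^ r := by
  have h1 : (fun t : ℝ => (theta q t : ℂ) - 1) =O[Filter.atTop]
      fun t => Real.exp (-(Real.pi * κ) * t) := by
    refine Asymptotics.IsBigO.of_bound (Real.exp (Real.pi * κ) * (theta q 1 - 1)) ?_
    filter_upwards [Filter.eventually_ge_atTop 1] with t ht
    rw [← Complex.ofReal_one, ← Complex.ofReal_sub, Complex.norm_real, Real.norm_of_nonneg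
      (sub_nonneg.2 (h.one_le_theta hκ (by linarith))), Real.norm_of_nonneg (Real.exp_pos _).le]
    exact h.theta_sub_one_le hκ ht
  exact h1.trans (isLittleO_exp_neg_mul_rpow_atTop (by positivity) r).isBigO

theorem theta_locallyIntegrableOn (h : QuadraticGrowth κ q) (hκ : 0 < κ) :
    MeasureTheory.LocallyIntegrableOn (fun t => (theta q t : ℂ)) (Set.Ioi 0) := by
  rw [MeasureTheory.locallyIntegrableOn_iff isOpen_Ioi.isLocallyClosed]
  intro k hk hkc
  exact (((h.theta_antitoneOn hκ).mono hk).integrableOn_isCompact hkc).ofReal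

end QuadraticGrowth

/-- The theta series of `q` and `q'` are exchanged by `t ↦ 1 / t`, as happens for a positive
definite quadratic form and its dual form. -/
structure ThetaPair (κ c : ℝ) (q q' : (d → ℤ) → ℝ) : Prop where
  left : QuadraticGrowth κ q
  right : QuadraticGrowth κ q'
  feq : ∀ t : ℝ, 0 < t → theta q (1 / t) = c * t ^ ((Fintype.card d : ℝ) / 2) * theta q' t

namespace ThetaPair

variable {κ c : ℝ} {q q' : (d → ℤ) → ℝ}

theorem pos (h : ThetaPair κ c q q') (hκ : 0 < κ) : 0 < c := by
  have h1 := h.feq 1 one_pos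
  rw [Real.one_rpow, mul_one, div_one] at h1
  have h2 := h.left.one_le_theta hκ one_pos
  have h3 := h.right.one_le_theta hκ one_pos
  by_contra hc
  nlinarith

/-- The constant of the functional equation is bounded in terms of `κ` alone: compare the two theta
series at `t = 1`. -/
theorem le_theta (h : ThetaPair κ c q q') (hκ : 0 < κ) :
    c ≤ theta (fun m : d → ℤ => κ * ‖m‖ ^ 2) 1 := by
  have h1 := h.feq 1 one_pos
  rw [Real.one_rpow, mul_one, div_one] at h1
  have h2 := h.left.theta_le hκ one_pos
  have h3 := h.right.one_le_theta hκ one_pos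
  have := h.pos hκ
  nlinarith

/-- The pair of theta series as input for the Mellin transform. -/
def fePair [Nonempty d] (h : ThetaPair κ c q q') (hκ : 0 < κ) : WeakFEPair ℂ where
  f t := theta q t
  g t := theta q' t
  k := (Fintype.card d : ℝ) / 2
  ε := c
  f₀ := 1
  g₀ := 1
  hf_int := h.left.theta_locallyIntegrableOn hκ
  hg_int := h.right.theta_locallyIntegrableOn hκ
  hk := by
    have : (0 : ℝ) < Fintype.card d := by exact_mod_cast Fintype.card_pos
    positivity
  hε := by exact_mod_cast (h.pos hκ).ne'
  h_feq x hx := by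
    rw [h.feq x hx]
    push_cast
    rw [smul_eq_mul]
  hf_top := h.left.theta_isBigO hκ
  hg_top := h.right.theta_isBigO hκ

end ThetaPair

end Theta

/-! ### The Epstein zeta function -/

theorem exists_norm_Gamma_line_le {x : ℝ} (hx : 1 / 2 ≤ x) : ∃ C : ℝ, 0 < C ∧ ∀ z : ℂ, z.re = x →
    ‖Complex.Gamma z‖ ≤ C * (1 + |z.im|) ^ (x - 1 / 2) * Real.exp (-(Real.pi / 2 * |z.im|)) := by
  obtain ⟨C, hC, h⟩ := exists_norm_Gamma_le ⌊x - 1 / 2⌋₊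
  have h1 := Nat.floor_le (show 0 ≤ x - 1 / 2 by linarith)
  have h2 := Nat.lt_floor_add_one (x - 1 / 2)
  refine ⟨C, hC, fun z hz => ?_⟩
  rw [← hz]
  exact h z (by linarith) (by linarith)

/-- A Mellin transform is bounded in vertical strips of convergence. -/
theorem exists_norm_mellin_le {f : ℝ → ℂ} {l u : ℝ} (hl : MellinConvergent f l)
    (hu : MellinConvergent f u) :
    ∃ B : ℝ, ∀ s : ℂ, l ≤ s.re → s.re ≤ u → ‖mellin f s‖ ≤ B := by
  refine ⟨∫ t in Set.Ioi (0 : ℝ),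
    (‖(t : ℂ) ^ ((l : ℂ) - 1) • f t‖ + ‖(t : ℂ) ^ ((u : ℂ) - 1) • f t‖), fun s h1 h2 => ?_⟩
  refine MeasureTheory.norm_integral_le_of_norm_le (hl.norm.add hu.norm) ?_
  refine (MeasureTheory.ae_restrict_iff' measurableSet_Ioi).2 (Filter.Eventually.of_forall ?_)
  intro t ht
  have ht0 : (0 : ℝ) < t := ht
  simp only [norm_smul, Complex.norm_cpow_eq_rpow_re_of_pos ht0, ← add_mul]
  refine mul_le_mul_of_nonneg_right ?_ (norm_nonneg _)
  simp only [Complex.sub_re, Complex.ofReal_re, Complex.one_re]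
  have h3 := Real.rpow_pos_of_pos ht0 (l - 1)
  have h4 := Real.rpow_pos_of_pos ht0 (u - 1)
  rcases le_total t 1 with h | h
  · have := Real.rpow_le_rpow_of_exponent_ge ht0 h (show l - 1 ≤ s.re - 1 by linarith)
    linarith
  · have := Real.rpow_le_rpow_of_exponent_le h (show s.re - 1 ≤ u - 1 by linarith)
    linarith

namespace ThetaPair

variable {d : Type*} [Fintype d] {κ c : ℝ} {q q' : (d → ℤ) → ℝ}

theorem symm (h : ThetaPair κ c q q') (hκ : 0 < κ) : ThetaPair κ c⁻¹ q' q where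
  left := h.right
  right := h.left
  feq t ht := by
    have h1 := h.feq (1 / t) (by positivity)
    have hc := h.pos hκ
    have h2 := Real.rpow_pos_of_pos ht ((Fintype.card d : ℝ) / 2)
    rw [one_div_one_div] at h1
    rw [h1, one_div, Real.inv_rpow ht.le]
    field_simp

variable [Nonempty d]

theorem fePair_symm (h : ThetaPair κ c q q') (hκ : 0 < κ) :
    (h.fePair hκ).symm = (h.symm hκ).fePair hκ := by
  simp [fePair, WeakFEPair.symm]

/-- The entire function `w (w - n/2) π⁻ʷ Γ(w) ∑ₘ q(m)⁻ʷ`: the completed zeta function, whose only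
poles, at `0` and `n/2`, are cancelled by the first two factors. -/
def xi (h : ThetaPair κ c q q') (hκ : 0 < κ) (w : ℂ) : ℂ :=
  w * (w - (Fintype.card d : ℝ) / 2) * (h.fePair hκ).Λ₀ w - (w - (Fintype.card d : ℝ) / 2) + c * w

/-- The entire function `(w - n/2) ∑ₘ q(m)⁻ʷ`. The term `m = 0` of the sum is `0⁻ʷ = 0`. The factor
`w` of `xi` has been absorbed in `Γ(w + 1)`. -/
def zetaMul (h : ThetaPair κ c q q') (hκ : 0 < κ) (w : ℂ) : ℂ :=
  Real.pi ^ w * h.xi hκ w * (Complex.Gamma (w + 1))⁻¹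

theorem differentiable_xi (h : ThetaPair κ c q q') (hκ : 0 < κ) : Differentiable ℂ (h.xi hκ) := by
  have := (h.fePair hκ).differentiable_Λ₀
  unfold xi
  fun_prop

theorem differentiable_zetaMul (h : ThetaPair κ c q q') (hκ : 0 < κ) :
    Differentiable ℂ (h.zetaMul hκ) := by
  have h1 := h.differentiable_xi hκ
  have h2 : Differentiable ℂ fun w : ℂ => (Complex.Gamma (w + 1))⁻¹ :=
    Complex.differentiable_one_div_Gamma.comp (differentiable_id.add_const 1)
  have h3 : Differentiable ℂ fun w : ℂ => (Real.pi : ℂ) ^ w := fun w =>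
    differentiableAt_id.const_cpow (Or.inl (by exact_mod_cast Real.pi_ne_zero))
  exact (h3.mul h1).mul h2

theorem xi_sub (h : ThetaPair κ c q q') (hκ : 0 < κ) (w : ℂ) :
    h.xi hκ ((Fintype.card d : ℝ) / 2 - w) = c * (h.symm hκ).xi hκ w := by
  have h1 := (h.fePair hκ).functional_equation₀ w
  rw [fePair_symm] at h1
  have h2 : ((h.fePair hκ).k : ℂ) = (Fintype.card d : ℝ) / 2 := by simp [fePair]
  have h3 : (h.fePair hκ).ε = c := rfl
  have hc : (c : ℂ) ≠ 0 := by exact_mod_cast (h.pos hκ).ne'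
  rw [h2, h3, smul_eq_mul] at h1
  unfold xi
  rw [h1]
  push_cast
  field_simp
  ring

theorem xi_eq (h : ThetaPair κ c q q') (hκ : 0 < κ) {w : ℂ}
    (hw : (Fintype.card d : ℝ) / 2 < w.re) :
    h.xi hκ w = w * (w - (Fintype.card d : ℝ) / 2) * (Real.pi ^ (-w) * Complex.Gamma w *
      ∑' m, (q m : ℂ) ^ (-w)) := by
  have hk0 : (0 : ℝ) < (Fintype.card d : ℝ) / 2 := (h.fePair hκ).hk
  have hw0 : 0 < w.re := hk0.trans hw
  have h1 := (h.fePair hκ).hasMellin hw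
  have hw1 : w ≠ 0 := fun h0 => by simp [h0] at hw0
  have hwk : w - (Fintype.card d : ℝ) / 2 ≠ 0 := by
    rw [← Complex.ofReal_ofNat, ← Complex.ofReal_div, sub_ne_zero]
    rintro h0
    rw [h0, Complex.ofReal_re] at hw
    exact lt_irrefl _ hw
  have h2 := hasSum_mellin_pi_mul₀ (a := fun _ : d → ℤ => (1 : ℂ)) (p := q)
    (F := fun t => (theta q t : ℂ) - 1) (s := w) (h.left.nonneg hκ) hw0 (fun t ht => by
      have := Complex.hasSum_ofReal.2 (h.left.hasSum_theta_sub_one hκ ht)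
      simpa [apply_ite (Complex.ofReal)] using this) (by
      refine (h.left.summable_rpow hκ hw0 hw).congr fun m => ?_
      rw [norm_one, one_div, Real.rpow_neg (h.left.nonneg hκ m)])
  have h3 : mellin (fun t => (theta q t : ℂ) - 1) w = (h.fePair hκ).Λ w := h1.2
  have h4 : (h.fePair hκ).Λ w = Real.pi ^ (-w) * Complex.Gamma w * ∑' m, (q m : ℂ) ^ (-w) := by
    rw [← h3, ← h2.tsum_eq, ← tsum_mul_left]
    refine tsum_congr fun m => ?_
    rw [Complex.cpow_neg (q m : ℂ), mul_one, div_eq_mul_inv]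
  have h5 : ((h.fePair hκ).k : ℂ) = (Fintype.card d : ℝ) / 2 := by simp [fePair]
  rw [← h4, xi, (h.fePair hκ).Λ₀_eq, h5]
  have h6 : (Fintype.card d : ℝ) / 2 - w ≠ 0 := by
    rw [← neg_sub]
    exact neg_ne_zero.2 hwk
  change _ * _ * (_ + 1 / w * 1 + (c : ℂ) / ((Fintype.card d : ℝ) / 2 - w) * 1) - _ + _ = _
  generalize ((Fintype.card d : ℝ) / 2 : ℂ) = k at *
  field_simp
  ring

theorem zetaMul_eq (h : ThetaPair κ c q q') (hκ : 0 < κ) {w : ℂ}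
    (hw : (Fintype.card d : ℝ) / 2 < w.re) :
    h.zetaMul hκ w = (w - (Fintype.card d : ℝ) / 2) * ∑' m, (q m : ℂ) ^ (-w) := by
  have hk0 : (0 : ℝ) < (Fintype.card d : ℝ) / 2 := (h.fePair hκ).hk
  have hw0 : 0 < w.re := hk0.trans hw
  have hw1 : w ≠ 0 := fun h0 => by simp [h0] at hw0
  have h1 : Complex.Gamma w ≠ 0 := Complex.Gamma_ne_zero_of_re_pos hw0
  have h2 : (Real.pi : ℂ) ^ w ≠ 0 := by
    rw [Complex.cpow_ne_zero_iff]
    exact Or.inl (by exact_mod_cast Real.pi_ne_zero)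
  rw [zetaMul, h.xi_eq hκ hw, Complex.Gamma_add_one w hw1, Complex.cpow_neg]
  field_simp

theorem zetaMul_ne_zero (h : ThetaPair κ c q q') (hκ : 0 < κ) :
    h.zetaMul hκ ((Fintype.card d : ℝ) / 2 : ℂ) ≠ 0 := by
  have hk0 : (0 : ℝ) < (Fintype.card d : ℝ) / 2 := (h.fePair hκ).hk
  have h1 : Complex.Gamma (((Fintype.card d : ℝ) / 2 : ℂ) + 1) ≠ 0 := by
    apply Complex.Gamma_ne_zero_of_re_pos
    have : (((Fintype.card d : ℝ) / 2 : ℂ) + 1).re = (Fintype.card d : ℝ) / 2 + 1 := by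
      rw [← Complex.ofReal_ofNat, ← Complex.ofReal_div]
      simp
    rw [this]
    positivity
  have h2 : (Real.pi : ℂ) ^ ((Fintype.card d : ℝ) / 2 : ℂ) ≠ 0 := by
    rw [Complex.cpow_ne_zero_iff]
    exact Or.inl (by exact_mod_cast Real.pi_ne_zero)
  have hc : (c : ℂ) ≠ 0 := by exact_mod_cast (h.pos hκ).ne'
  have hk : ((Fintype.card d : ℝ) / 2 : ℂ) ≠ 0 := by exact_mod_cast hk0.ne'
  rw [zetaMul, xi, sub_self, mul_zero, zero_mul, sub_zero, zero_add]
  exact mul_ne_zero (mul_ne_zero h2 (mul_ne_zero hc hk)) (inv_ne_zero h1)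

/-- In the half plane of convergence the completed zeta function has the size of its Gamma factor,
uniformly in `q`. -/
theorem exists_norm_xi_right_le (hκ : 0 < κ) {δ : ℝ} (hδ : 0 < δ) : ∃ A : ℝ, 0 < A ∧
    ∀ {c : ℝ} {q q' : (d → ℤ) → ℝ} (h : ThetaPair κ c q q') (w : ℂ),
      w.re = (Fintype.card d : ℝ) / 2 + δ → ‖h.xi hκ w‖ ≤
        A * (1 + |w.im|) ^ ((Fintype.card d : ℝ) / 2 + δ + 3 / 2) *
          Real.exp (-(Real.pi / 2 * |w.im|)) := by
  set k : ℝ := (Fintype.card d : ℝ) / 2 with hk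
  have hk1 : 1 / 2 ≤ k := by
    have : (1 : ℝ) ≤ Fintype.card d := by exact_mod_cast Fintype.card_pos
    linarith
  obtain ⟨C, hC, hG⟩ := exists_norm_Gamma_line_le (x := k + δ) (by linarith)
  set S : ℝ := ∑' m : d → ℤ, ‖m‖ ^ (-(2 * (k + δ)))
  have hS0 : 0 ≤ S := tsum_nonneg fun m => by positivity
  refine ⟨(1 + k + δ) * (1 + k + δ) * (Real.pi ^ (-(k + δ)) * C * (κ ^ (-(k + δ)) * S + 1)),
    by positivity, fun {c q q'} h w hw => ?_⟩
  rw [h.xi_eq hκ (by rw [hw]; linarith)]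
  have hT : 0 < 1 + |w.im| := by positivity
  have h1 : ‖w‖ ≤ (1 + k + δ) * (1 + |w.im|) := by
    refine (Complex.norm_le_abs_re_add_abs_im w).trans ?_
    rw [hw, abs_of_pos (by linarith)]
    nlinarith [abs_nonneg w.im]
  have h2 : ‖w - (Fintype.card d : ℝ) / 2‖ ≤ (1 + k + δ) * (1 + |w.im|) := by
    rw [show ((Fintype.card d : ℝ) / 2 : ℂ) = (k : ℂ) by rw [hk]; push_cast; rfl]
    refine (Complex.norm_le_abs_re_add_abs_im _).trans ?_
    simp [hw]
    rw [abs_of_pos (by linarith)]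
    nlinarith [abs_nonneg w.im]
  have h3 : ‖∑' m, (q m : ℂ) ^ (-w)‖ ≤ κ ^ (-(k + δ)) * S + 1 := by
    have hw0 : 0 < w.re := by rw [hw]; linarith
    have hwk : (Fintype.card d : ℝ) / 2 < w.re := by rw [hw]; linarith
    have h4 := norm_tsum_le_tsum_norm (h.left.summable_cpow hκ hw0 hwk).norm
    simp_rw [h.left.norm_cpow hκ hw0] at h4
    have h5 := h.left.tsum_rpow_le hκ hw0 hwk
    rw [hw] at h4 h5
    linarith
  have h4 : ‖(Real.pi : ℂ) ^ (-w)‖ = Real.pi ^ (-(k + δ)) := by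
    rw [Complex.norm_cpow_eq_rpow_re_of_pos Real.pi_pos, Complex.neg_re, hw]
  rw [norm_mul, norm_mul, norm_mul, norm_mul, h4]
  calc _ ≤ ((1 + k + δ) * (1 + |w.im|)) * ((1 + k + δ) * (1 + |w.im|)) *
        (Real.pi ^ (-(k + δ)) * (C * (1 + |w.im|) ^ (k + δ - 1 / 2) *
          Real.exp (-(Real.pi / 2 * |w.im|))) * (κ ^ (-(k + δ)) * S + 1)) := by
        have := hG w hw
        gcongr
    _ = _ := by
        rw [show k + δ + 3 / 2 = (k + δ - 1 / 2) + 1 + 1 by ring, Real.rpow_add_one hT.ne',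
          Real.rpow_add_one hT.ne']
        ring

/-- Polynomial growth in vertical strips, with a constant that may depend on `q`: it only serves as
the growth condition of the Phragmén-Lindelöf principle. -/
theorem exists_norm_xi_le (h : ThetaPair κ c q q') (hκ : 0 < κ) (l u : ℝ) :
    ∃ B : ℝ, ∀ w ∈ verticalClosedStrip l u, ‖h.xi hκ w‖ ≤ B * (1 + |w.im|) ^ (2 : ℝ) := by
  set k : ℝ := (Fintype.card d : ℝ) / 2 with hk
  have hconv : ∀ s : ℂ, MellinConvergent (h.fePair hκ).f_modif s := fun s =>
    ((h.fePair hκ).isStrongFEPair_toStrongFEPair.hasMellin s).1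
  obtain ⟨B, hB⟩ := exists_norm_mellin_le (hconv l) (hconv u)
  set M := 1 + |l| + |u| + |k|
  have hM1 : 1 ≤ M := by
    have := abs_nonneg l
    have := abs_nonneg u
    have := abs_nonneg k
    linarith
  refine ⟨M * M * |B| + M + |c| * M, fun w hw => ?_⟩
  have hw' : l ≤ w.re ∧ w.re ≤ u := hw
  have h0 : |w.re| ≤ |l| + |u| := by
    rw [abs_le]
    constructor <;>
    linarith [neg_abs_le l, le_abs_self u, abs_nonneg l, abs_nonneg u, hw'.1, hw'.2]
  have hT : 1 ≤ 1 + |w.im| := by linarith [abs_nonneg w.im]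
  have h1 : ‖w‖ ≤ M * (1 + |w.im|) := by
    refine (Complex.norm_le_abs_re_add_abs_im w).trans ?_
    nlinarith [abs_nonneg w.im, abs_nonneg k]
  have h2 : ‖w - (Fintype.card d : ℝ) / 2‖ ≤ M * (1 + |w.im|) := by
    rw [show ((Fintype.card d : ℝ) / 2 : ℂ) = (k : ℂ) by rw [hk]; push_cast; rfl]
    refine (Complex.norm_le_abs_re_add_abs_im _).trans ?_
    simp only [Complex.sub_re, Complex.ofReal_re, Complex.sub_im, Complex.ofReal_im, sub_zero]
    nlinarith [abs_nonneg w.im, abs_sub w.re k]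
  have h3 : ‖(h.fePair hκ).Λ₀ w‖ ≤ |B| := (hB w hw'.1 hw'.2).trans (le_abs_self B)
  rw [xi, Real.rpow_two]
  refine (norm_add_le _ _).trans ?_
  have h5 := norm_sub_le (w * (w - (Fintype.card d : ℝ) / 2) * (h.fePair hκ).Λ₀ w)
    (w - (Fintype.card d : ℝ) / 2)
  have h6 : ‖w * (w - (Fintype.card d : ℝ) / 2) * (h.fePair hκ).Λ₀ w‖ ≤
      (M * (1 + |w.im|)) * (M * (1 + |w.im|)) * |B| := by
    rw [norm_mul, norm_mul]
    gcongr
  have h7 : ‖(c : ℂ) * w‖ ≤ |c| * (M * (1 + |w.im|)) := by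
    rw [norm_mul, Complex.norm_real, Real.norm_eq_abs]
    gcongr
  have h8 : 1 + |w.im| ≤ (1 + |w.im|) ^ 2 := by nlinarith
  have h9 : M * (1 + |w.im|) ≤ M * (1 + |w.im|) ^ 2 := by gcongr
  have h10 : |c| * (M * (1 + |w.im|)) ≤ |c| * (M * (1 + |w.im|) ^ 2) := by gcongr
  nlinarith

/-- Convexity bound for `(w - n/2) ∑ₘ q(m)⁻ʷ`, with a constant depending on `q` only through `κ`. -/
theorem exists_norm_zetaMul_le (hκ : 0 < κ) {δ : ℝ} (hδ : 0 < δ) : ∃ C : ℝ, 0 < C ∧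
    ∀ {c : ℝ} {q q' : (d → ℤ) → ℝ} (h : ThetaPair κ c q q') (w : ℂ), 1 / 2 ≤ w.re →
      w.re ≤ 3 / 2 → w.re ≤ (Fintype.card d : ℝ) / 2 + δ → ‖h.zetaMul hκ w‖ ≤
        C * (1 + |w.im|) ^ (1 + (Fintype.card d : ℝ) / 2 + δ - w.re) := by
  obtain ⟨A, hA, hX⟩ := exists_norm_xi_right_le (d := d) hκ hδ
  obtain ⟨G, hG0, hG⟩ := exists_norm_inv_Gamma_add_one_le
  set k : ℝ := (Fintype.card d : ℝ) / 2 with hk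
  have hk1 : 1 / 2 ≤ k := by
    have : (1 : ℝ) ≤ Fintype.card d := by exact_mod_cast Fintype.card_pos
    linarith
  set p : ℝ := k + δ + 3 / 2 with hp
  set Θ : ℝ := theta (fun m : d → ℤ => κ * ‖m‖ ^ 2) 1
  have hΘ0 : 0 ≤ Θ := tsum_nonneg fun m => by positivity
  set A' : ℝ := (1 + Θ) * A with hA'
  set E : ℝ := Real.exp ((k + δ - -δ) ^ 2 + p ^ 2 + p ^ 2)
  refine ⟨Real.pi ^ (3 / 2 : ℝ) * (E * A') * G, by positivity, fun {c q q'} h w h1 h2 h3 => ?_⟩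
  obtain ⟨B, hB⟩ := h.exists_norm_xi_le hκ (-δ) (k + δ)
  have hT : 0 < 1 + |w.im| := by positivity
  -- On the left edge `Re z = -δ` the functional equation reduces to the right edge.
  have key := norm_le_of_verticalClosedStrip (l := -δ) (u := k + δ) (p := p) (q := p) (N := 2)
    (A := A') (B := B) (f := h.xi hκ) (z := w) (by linarith) (by positivity) (by positivity)
    (by norm_num) (by positivity) (h.differentiable_xi hκ).diffContOnCl hB
    (fun z hz => by
      have h4 := hX (h.symm hκ) (k - z) (by simp [hz])
      have h5 := h.xi_sub hκ (k - z)
      rw [show ((Fintype.card d : ℝ) / 2 : ℂ) = (k : ℂ) by rw [hk]; push_cast; rfl,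
        sub_sub_cancel] at h5
      rw [h5, norm_mul, Complex.norm_real, Real.norm_of_nonneg (h.pos hκ).le]
      simp only [Complex.sub_im, Complex.ofReal_im, zero_sub, abs_neg] at h4
      calc _ ≤ (1 + Θ) * (A * (1 + |z.im|) ^ p * Real.exp (-(Real.pi / 2 * |z.im|))) := by
            have h6 : c ≤ 1 + Θ := (h.le_theta hκ).trans (by linarith)
            gcongr
        _ = _ := by rw [hA']; ring)
    (fun z hz => by
      refine (hX h z hz).trans ?_
      gcongr
      rw [hA']
      nlinarith) ⟨by linarith, h3⟩
  rw [← mul_add, sub_add_cancel, mul_one] at key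
  have hpi : ‖(Real.pi : ℂ) ^ w‖ ≤ Real.pi ^ (3 / 2 : ℝ) := by
    rw [Complex.norm_cpow_eq_rpow_re_of_pos Real.pi_pos]
    exact Real.rpow_le_rpow_of_exponent_le (by linarith [Real.pi_gt_three]) h2
  rw [zetaMul, norm_mul, norm_mul]
  calc _ ≤ Real.pi ^ (3 / 2 : ℝ) * (E * A' * (1 + |w.im|) ^ p *
          Real.exp (-(Real.pi / 2 * |w.im|))) * (G * (1 + |w.im|) ^ (-1 / 2 - w.re) *
          Real.exp (Real.pi / 2 * |w.im|)) := by
        have := hG w h1 h2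
        gcongr
    _ = Real.pi ^ (3 / 2 : ℝ) * (E * A') * G *
          ((1 + |w.im|) ^ p * (1 + |w.im|) ^ (-1 / 2 - w.re)) *
          (Real.exp (-(Real.pi / 2 * |w.im|)) * Real.exp (Real.pi / 2 * |w.im|)) := by ring
    _ = _ := by
        rw [← Real.exp_add, neg_add_cancel, Real.exp_zero, mul_one, ← Real.rpow_add hT]
        congr 2
        rw [hp]
        ring

end ThetaPair

/-! ### Poisson summation -/

section Poisson

open MeasureTheory UnitAddTorus

variable {d : Type*}

/-- The half-open unit cube with lower corner `m`. -/
def unitCube (m : d → ℤ) : Set (d → ℝ) := {x | ∀ i, x i ∈ Set.Ioc (m i : ℝ) (m i + 1)}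

theorem measurableSet_unitCube [Fintype d] (m : d → ℤ) : MeasurableSet (unitCube m) := by
  have : unitCube m = Set.univ.pi fun i => Set.Ioc (m i : ℝ) (m i + 1) := by
    ext; simp [unitCube]
  rw [this]
  exact MeasurableSet.univ_pi fun i => measurableSet_Ioc

theorem volume_unitCube [Fintype d] (m : d → ℤ) : volume (unitCube m) = 1 := by
  have : unitCube m = Set.univ.pi fun i => Set.Ioc (m i : ℝ) (m i + 1) := by
    ext; simp [unitCube]
  rw [this, Real.volume_pi_Ioc]
  simp

theorem pairwise_disjoint_unitCube :
    Pairwise (Function.onFun Disjoint (unitCube : (d → ℤ) → Set (d → ℝ))) := by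
  intro m n hmn
  refine Set.disjoint_left.2 fun x hx hy => hmn (funext fun i => ?_)
  have h1 := (Int.ceil_eq_iff (z := m i + 1) (a := x i)).2
    ⟨by push_cast; linarith [(hx i).1], by push_cast; exact (hx i).2⟩
  have h2 := (Int.ceil_eq_iff (z := n i + 1) (a := x i)).2
    ⟨by push_cast; linarith [(hy i).1], by push_cast; exact (hy i).2⟩
  omega

theorem iUnion_unitCube : ⋃ m : d → ℤ, unitCube m = Set.univ := by
  refine Set.eq_univ_of_forall fun x => Set.mem_iUnion.2 ⟨fun i => ⌈x i⌉ - 1, fun i => ?_⟩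
  push_cast
  exact ⟨by linarith [Int.ceil_lt_add_one (x i)], by linarith [Int.le_ceil (x i)]⟩

theorem norm_le_one_of_mem_unitCube [Fintype d] {x : d → ℝ} (hx : x ∈ unitCube (0 : d → ℤ)) :
    ‖x‖ ≤ 1 := by
  refine (pi_norm_le_iff_of_nonneg zero_le_one).2 fun i => ?_
  have := hx i
  simp at this
  rw [Real.norm_of_nonneg this.1.le]
  exact this.2

/-- The projection `ℝ^d → (ℝ / ℤ)^d`. -/
def toTorus (x : d → ℝ) : UnitAddTorus d := fun i => (x i : UnitAddCircle)

theorem toTorus_add_int (x : d → ℝ) (m : d → ℤ) :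
    toTorus (x + fun i => (m i : ℝ)) = toTorus x := by
  funext i
  have := (AddCircle.coe_period (1 : ℝ))
  simp only [toTorus, Pi.add_apply, AddCircle.coe_add, add_eq_left]
  exact (AddCircle.coe_eq_zero_iff (1 : ℝ)).2 ⟨m i, by simp⟩

theorem exists_int_of_toTorus_eq {x y : d → ℝ} (h : toTorus x = toTorus y) :
    ∃ m : d → ℤ, y = x + fun i => (m i : ℝ) := by
  have h1 : ∀ i, ∃ n : ℤ, y i = x i + n := by
    intro i
    have h2 : ((y i - x i : ℝ) : UnitAddCircle) = 0 := by
      rw [AddCircle.coe_sub, sub_eq_zero]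
      exact (congrFun h i).symm
    obtain ⟨n, hn⟩ := (AddCircle.coe_eq_zero_iff (1 : ℝ)).1 h2
    exact ⟨n, by simp at hn; linarith⟩
  choose m hm using h1
  exact ⟨m, funext hm⟩

theorem isQuotientMap_toTorus : Topology.IsQuotientMap (toTorus : (d → ℝ) → UnitAddTorus d) := by
  have h1 : IsOpenQuotientMap (fun x : ℝ => (x : UnitAddCircle)) :=
    QuotientAddGroup.isOpenQuotientMap_mk
  have h2 : IsOpenMap (toTorus : (d → ℝ) → UnitAddTorus d) :=
    IsOpenMap.piMap (fun _ => h1.isOpenMap) (Filter.Eventually.of_forall fun _ => h1.surjective)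
  refine h2.isQuotientMap ?_ ?_
  · exact continuous_pi fun i => h1.continuous.comp (continuous_apply i)
  · exact Function.Surjective.piMap fun _ => h1.surjective

/-- The integrand `x ↦ exp (-2π i n·x)` of the Fourier transform. -/
theorem mFourier_neg_toTorus [Fintype d] (n : d → ℤ) (x : d → ℝ) : mFourier (-n) (toTorus x) =
    Complex.exp (-2 * Real.pi * Complex.I * ∑ i, (n i : ℂ) * x i) := by
  simp only [mFourier, ContinuousMap.coe_mk, toTorus, fourier_coe_apply, Pi.neg_apply]
  rw [← Complex.exp_sum, Finset.mul_sum]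
  congr 1
  refine Finset.sum_congr rfl fun i _ => ?_
  push_cast
  ring

theorem tsum_add_int_eq {g : (d → ℝ) → ℂ} (x : d → ℝ) (k : d → ℤ) :
    ∑' m : d → ℤ, g ((x + fun i => (k i : ℝ)) + fun i => (m i : ℝ)) =
      ∑' m : d → ℤ, g (x + fun i => (m i : ℝ)) := by
  rw [← (Equiv.addLeft k).tsum_eq fun m : d → ℤ => g (x + fun i => (m i : ℝ))]
  refine tsum_congr fun m => ?_
  congr 1
  ext i
  simp
  ring

/-- The Poisson summation formula on `ℤ^d`. -/
theorem tsum_int_eq_tsum_integral [Fintype d] {g : (d → ℝ) → ℂ} (hg : Continuous g)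
    (hint : Integrable g)
    (hloc : ∀ R : ℝ, ∃ u : (d → ℤ) → ℝ, Summable u ∧
      ∀ x : d → ℝ, ‖x‖ ≤ R → ∀ m : d → ℤ, ‖g (x + fun i => (m i : ℝ))‖ ≤ u m)
    (hF : Summable fun n : d → ℤ =>
      ∫ x : d → ℝ, Complex.exp (-2 * Real.pi * Complex.I * ∑ i, (n i : ℂ) * x i) * g x) :
    ∑' m : d → ℤ, g (fun i => (m i : ℝ)) = ∑' n : d → ℤ,
      ∫ x : d → ℝ, Complex.exp (-2 * Real.pi * Complex.I * ∑ i, (n i : ℂ) * x i) * g x := by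
  -- The periodisation of `g`, as a function on the torus.
  let G : (d → ℝ) → ℂ := fun x => ∑' m : d → ℤ, g (x + fun i => (m i : ℝ))
  have hGc : Continuous G := by
    rw [continuous_iff_continuousAt]
    intro x
    obtain ⟨u, hu, hub⟩ := hloc (‖x‖ + 1)
    have h1 : ContinuousOn G (Metric.ball 0 (‖x‖ + 1)) := by
      refine continuousOn_tsum (fun m => ?_) hu fun m y hy => hub y ?_ m
      · fun_prop
      · exact (mem_ball_zero_iff.1 hy).le
    exact h1.continuousAt (Metric.isOpen_ball.mem_nhds (by simp))
  let p : C(d → ℝ, UnitAddTorus d) := ⟨toTorus, isQuotientMap_toTorus.continuous⟩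
  have hp : Topology.IsQuotientMap p := isQuotientMap_toTorus
  have hGp : Function.FactorsThrough (⟨G, hGc⟩ : C(d → ℝ, ℂ)) p := by
    intro x y hxy
    obtain ⟨k, rfl⟩ := exists_int_of_toTorus_eq (x := x) (y := y) hxy
    exact (tsum_add_int_eq x k).symm
  let F : C(UnitAddTorus d, ℂ) := hp.lift ⟨G, hGc⟩ hGp
  have hFG : ∀ x, F (toTorus x) = G x := fun x =>
    DFunLike.congr_fun (hp.lift_comp ⟨G, hGc⟩ hGp) x
  have hcoeff : ∀ n : d → ℤ, mFourierCoeff F n =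
      ∫ x : d → ℝ, Complex.exp (-2 * Real.pi * Complex.I * ∑ i, (n i : ℂ) * x i) * g x := by
    intro n
    let e : (d → ℝ) → ℂ := fun x => mFourier (-n) (toTorus x)
    have he : Continuous e := (mFourier (-n)).continuous.comp isQuotientMap_toTorus.continuous
    have hen : ∀ x, ‖e x‖ = 1 := fun x => by
      simp only [e, mFourier_neg_toTorus, Complex.norm_exp]
      simp [Complex.mul_re, Complex.re_sum, Complex.im_sum]
    have hee : ∀ (x : d → ℝ) (m : d → ℤ), e (x + fun i => (m i : ℝ)) = e x := fun x m => by
      simp only [e, toTorus_add_int]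
    have hei : Integrable fun x => e x * g x := by
      refine hint.bdd_mul (c := 1) he.aestronglyMeasurable ?_
      exact Filter.Eventually.of_forall fun x => (hen x).le
    obtain ⟨u, hu, hub⟩ := hloc 1
    have h0 : unitCube (0 : d → ℤ) = {x : d → ℝ | ∀ i, x i ∈ Set.Ioc ((0 : d → ℝ) i)
        ((0 : d → ℝ) i + 1)} := by
      ext; simp [unitCube]
    have hshift : ∀ m : d → ℤ, ∫ x in unitCube m, e x * g x =
        ∫ x in unitCube 0, e x * g (x + fun i => (m i : ℝ)) := by
      intro m
      have h1 := (measurePreserving_add_right (volume : Measure (d → ℝ))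
        (fun i => (m i : ℝ))).setIntegral_preimage_emb (measurableEmbedding_addRight _)
        (fun x => e x * g x) (unitCube m)
      rw [← h1]
      simp only [hee]
      congr 2
      ext x
      simp [unitCube]
      refine forall_congr' fun i => ?_
      rw [add_comm (m i : ℝ) 1, add_le_add_iff_right]
    have hbound : ∀ m : d → ℤ, IntegrableOn (fun x => e x * g (x + fun i => (m i : ℝ)))
        (unitCube 0) := fun m => by
      have h2 : Integrable fun x => e x * g (x + fun i => (m i : ℝ)) := by
        have := hei.comp_add_right (fun i => (m i : ℝ))
        simpa only [hee] using this
      exact h2.integrableOn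
    have hsumm : Summable fun m : d → ℤ =>
        ∫ x in unitCube 0, ‖e x * g (x + fun i => (m i : ℝ))‖ := by
      refine hu.of_nonneg_of_le (fun m => integral_nonneg fun x => norm_nonneg _) fun m => ?_
      have h3 := norm_setIntegral_le_of_norm_le_const (μ := (volume : Measure (d → ℝ)))
        (s := unitCube 0) (f := fun x => ‖e x * g (x + fun i => (m i : ℝ))‖) (C := u m)
        (by rw [volume_unitCube]; exact ENNReal.one_lt_top) (fun x hx => by
          rw [norm_norm, norm_mul, hen, one_mul]
          exact hub x (norm_le_one_of_mem_unitCube hx) m)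
      rw [Measure.real, volume_unitCube, ENNReal.toReal_one, mul_one] at h3
      exact (le_abs_self _).trans h3
    rw [mFourierCoeff_eq_integral F n 0, ← h0]
    calc ∫ x in unitCube 0, mFourier (-n) (toTorus x) • F (toTorus x)
        = ∫ x in unitCube 0, ∑' m : d → ℤ, e x * g (x + fun i => (m i : ℝ)) := by
          refine integral_congr_ae (Filter.Eventually.of_forall fun x => ?_)
          simp only [hFG, smul_eq_mul, G, e, tsum_mul_left]
      _ = ∑' m : d → ℤ, ∫ x in unitCube 0, e x * g (x + fun i => (m i : ℝ)) :=
          (hasSum_integral_of_summable_integral_norm hbound hsumm).tsum_eq.symm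
      _ = ∑' m : d → ℤ, ∫ x in unitCube m, e x * g x := by simp_rw [hshift]
      _ = ∫ x in ⋃ m : d → ℤ, unitCube m, e x * g x :=
          (integral_iUnion measurableSet_unitCube pairwise_disjoint_unitCube
            hei.integrableOn).symm
      _ = _ := by
          rw [iUnion_unitCube, Measure.restrict_univ]
          simp only [e, mFourier_neg_toTorus]
  have hs : Summable (mFourierCoeff F) := by
    refine hF.congr fun n => (hcoeff n).symm
  have hmain := (hasSum_mFourier_series_apply_of_summable hs (toTorus 0)).tsum_eq
  rw [hFG] at hmain
  simp only [G, zero_add] at hmain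
  rw [← hmain]
  refine tsum_congr fun n => ?_
  rw [hcoeff]
  have : mFourier n (toTorus (0 : d → ℝ)) = 1 := by
    have := mFourier_neg_toTorus (-n) (0 : d → ℝ)
    rw [neg_neg] at this
    simp [this]
  rw [this, smul_eq_mul, mul_one]

end Poisson

/-! ### Quadratic forms and their duals -/

section DualForm

open MeasureTheory
open scoped FourierTransform

variable {d : Type*} [Fintype d] {V : Type*} [NormedAddCommGroup V] [InnerProductSpace ℝ V]
  [FiniteDimensional ℝ V]

/-- The linear map dual to `A`: `⟪A x, dualMap A y⟫ = ∑ xᵢ yᵢ`. -/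
def dualMap (A : (d → ℝ) ≃L[ℝ] V) (y : d → ℝ) : V :=
  ∑ i, y i • (InnerProductSpace.toDual ℝ V).symm
    ((ContinuousLinearMap.proj i).comp (A.symm : V →L[ℝ] (d → ℝ)))

theorem inner_dualMap (A : (d → ℝ) ≃L[ℝ] V) (x y : d → ℝ) :
    inner ℝ (A x) (dualMap A y) = ∑ i, y i * x i := by
  simp only [dualMap, inner_sum, inner_smul_right]
  refine Finset.sum_congr rfl fun i _ => ?_
  rw [real_inner_comm, InnerProductSpace.toDual_symm_apply]
  simp

theorem norm_le_mul_norm_dualMap (A : (d → ℝ) ≃L[ℝ] V) {M : ℝ} (hM : 0 < M)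
    (h : ∀ x, ‖A x‖ ≤ M * ‖x‖) (y : d → ℝ) : ‖y‖ ≤ M * ‖dualMap A y‖ := by
  classical
  refine (pi_norm_le_iff_of_nonneg (by positivity)).2 fun i => ?_
  have h1 := inner_dualMap A (Pi.single i 1) y
  rw [Finset.sum_eq_single i (fun j _ hj => by simp [hj]) (by simp), Pi.single_eq_same,
    mul_one] at h1
  rw [← h1]
  refine (norm_inner_le_norm _ _).trans ?_
  gcongr
  simpa [Pi.norm_single] using h (Pi.single i 1)

/-- The Fourier transform of the Gaussian `exp (-π t ‖A x‖²)` is, up to the covolume of `A`, the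
Gaussian of the dual map. -/
theorem exists_integral_gaussian (A : (d → ℝ) ≃L[ℝ] V) : ∃ c : ℝ, ∀ t : ℝ, 0 < t →
    Integrable (fun x : d → ℝ => Complex.exp (-(Real.pi * t : ℝ) * ‖A x‖ ^ 2)) ∧
    ∀ y : d → ℝ, ∫ x : d → ℝ, Complex.exp (-2 * Real.pi * Complex.I * ∑ i, (y i : ℂ) * x i) *
      Complex.exp (-(Real.pi * t : ℝ) * ‖A x‖ ^ 2) =
      ((c * (1 / t) ^ ((Fintype.card d : ℝ) / 2) *
        Real.exp (-Real.pi * ‖dualMap A y‖ ^ 2 * (1 / t)) : ℝ) : ℂ) := by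
  let _ : MeasurableSpace V := borel V
  have : BorelSpace V := ⟨rfl⟩
  let ν : Measure V := Measure.map A volume
  have : ν.IsAddHaarMeasure := A.isAddHaarMeasure_map volume
  have hν : ν = ν.addHaarScalarFactor volume • (volume : Measure V) :=
    Measure.isAddLeftInvariant_eq_smul ν volume
  have hemb : MeasurableEmbedding A := A.toHomeomorph.measurableEmbedding
  refine ⟨(ν.addHaarScalarFactor volume : ℝ), fun t ht => ⟨?_, fun y => ?_⟩⟩
  · have h1 := GaussianFourier.integrable_cexp_neg_mul_sq_norm_add (V := V)
      (b := ((Real.pi * t : ℝ) : ℂ)) (by rw [Complex.ofReal_re]; positivity) 0 0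
    simp only [zero_mul, add_zero] at h1
    have h2 : Integrable (fun v : V => Complex.exp (-(Real.pi * t : ℝ) * ‖v‖ ^ 2)) ν := by
      rw [hν]
      exact h1.smul_measure_nnreal
    exact (hemb.integrable_map_iff).1 h2
  · have h1 := hemb.integral_map (μ := volume) (fun v : V =>
      Complex.exp (((-2 * Real.pi * inner ℝ v (dualMap A y) : ℝ) : ℂ) * Complex.I) •
        Complex.exp (-(Real.pi * t : ℝ) * ‖v‖ ^ 2))
    change ∫ v, _ ∂ν = _ at h1
    rw [hν, integral_smul_nnreal_measure, ← Real.fourier_eq',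
      fourier_gaussian_innerProductSpace (by rw [Complex.ofReal_re]; positivity)] at h1
    have h2 : Module.finrank ℝ V = Fintype.card d := by
      rw [← A.toLinearEquiv.finrank_eq, Module.finrank_fintype_fun_eq_card]
    have h3 : ((Real.pi : ℂ) / (Real.pi * t : ℝ)) ^ (Module.finrank ℝ V / 2 : ℂ) =
        (((1 / t) ^ ((Fintype.card d : ℝ) / 2) : ℝ) : ℂ) := by
      rw [h2, Complex.ofReal_cpow (by positivity)]
      congr 1
      · have : (Real.pi : ℂ) ≠ 0 := by exact_mod_cast Real.pi_ne_zero
        push_cast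
        field_simp
      · push_cast
        rfl
    have h4 : Complex.exp (-(Real.pi : ℂ) ^ 2 * ‖dualMap A y‖ ^ 2 / (Real.pi * t : ℝ)) =
        (Real.exp (-Real.pi * ‖dualMap A y‖ ^ 2 * (1 / t)) : ℂ) := by
      rw [Complex.ofReal_exp]
      congr 1
      have : (Real.pi : ℂ) ≠ 0 := by exact_mod_cast Real.pi_ne_zero
      have : (t : ℂ) ≠ 0 := by exact_mod_cast ht.ne'
      push_cast
      field_simp
    rw [h3, h4] at h1
    refine Eq.trans ?_ (h1.symm.trans ?_)
    · refine integral_congr_ae (Filter.Eventually.of_forall fun x => ?_)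
      simp only [inner_dualMap, smul_eq_mul]
      congr 2
      push_cast
      ring
    · rw [NNReal.smul_def, Complex.real_smul, Complex.ofReal_mul, Complex.ofReal_mul]
      ring

theorem quadraticGrowth_norm_sq {V : Type*} [NormedAddCommGroup V] {B : (d → ℝ) → V} {a : ℝ}
    (ha : 0 < a) (h0 : B 0 = 0)
    (h : ∀ x, a * ‖x‖ ≤ ‖B x‖) :
    QuadraticGrowth (a ^ 2) fun m : d → ℤ => ‖B fun i => (m i : ℝ)‖ ^ 2 where
  zero := by
    have : (fun i => (((0 : d → ℤ) i : ℤ) : ℝ)) = (0 : d → ℝ) := by ext; simp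
    rw [this, h0]
    simp
  le m := by
    have h1 := h fun i => (m i : ℝ)
    have h2 : ‖fun i => (m i : ℝ)‖ = ‖m‖ := rfl
    rw [h2] at h1
    rw [← mul_pow]
    gcongr

theorem QuadraticGrowth.mono {κ κ' : ℝ} {q : (d → ℤ) → ℝ} (h : QuadraticGrowth κ q) (hκ : κ' ≤ κ) :
    QuadraticGrowth κ' q :=
  ⟨h.zero, fun m => (mul_le_mul_of_nonneg_right hκ (by positivity)).trans (h.le m)⟩

/-- The theta functions of the positive definite quadratic form `‖A x‖²` and of its dual form are
exchanged by `t ↦ 1 / t`, and both forms are bounded from below in terms of bounds for `A`. -/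
theorem exists_thetaPair (A : (d → ℝ) ≃L[ℝ] V) {a M κ : ℝ} (ha : 0 < a) (hM : 0 < M)
    (hκa : κ ≤ a ^ 2) (hκM : κ ≤ (1 / M) ^ 2)
    (h1 : ∀ x, a * ‖x‖ ≤ ‖A x‖) (h2 : ∀ x, ‖A x‖ ≤ M * ‖x‖) :
    ∃ (c : ℝ) (q' : (d → ℤ) → ℝ),
      ThetaPair κ c (fun m : d → ℤ => ‖A fun i => (m i : ℝ)‖ ^ 2) q' := by
  obtain ⟨c, hc⟩ := exists_integral_gaussian A
  have hleft : QuadraticGrowth (a ^ 2) fun m : d → ℤ => ‖A fun i => (m i : ℝ)‖ ^ 2 :=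
    quadraticGrowth_norm_sq ha (map_zero A) h1
  have hright : QuadraticGrowth ((1 / M) ^ 2) fun m : d → ℤ =>
      ‖dualMap A fun i => (m i : ℝ)‖ ^ 2 := by
    refine quadraticGrowth_norm_sq (by positivity) (by simp [dualMap]) fun y => ?_
    have := norm_le_mul_norm_dualMap A hM h2 y
    rw [one_div, inv_mul_le_iff₀ hM]
    exact this
  refine ⟨c, fun m => ‖dualMap A fun i => (m i : ℝ)‖ ^ 2, hleft.mono hκa, hright.mono hκM,
    fun t ht => ?_⟩
  obtain ⟨hint, hft⟩ := hc (1 / t) (by positivity)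
  simp only [one_div_one_div] at hft
  have hsr := hright.summable_exp (by positivity) ht
  have hpoisson := tsum_int_eq_tsum_integral
    (g := fun x : d → ℝ => Complex.exp (-(Real.pi * (1 / t) : ℝ) * ‖A x‖ ^ 2)) (by fun_prop) hint
    (fun R => by
      -- `‖A (x + m)‖² ≥ a² (‖m‖ - R)² ≥ a² (‖m‖² / 2 - R²)`
      let q₀ : (d → ℤ) → ℝ := fun m => a ^ 2 / 2 * ‖m‖ ^ 2
      have hq₀ : QuadraticGrowth (a ^ 2 / 2) q₀ := ⟨by simp [q₀], fun _ => le_rfl⟩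
      refine ⟨fun m => Real.exp (Real.pi * (1 / t) * (a ^ 2 * R ^ 2)) *
        Real.exp (-Real.pi * q₀ m * (1 / t)),
        (hq₀.summable_exp (by positivity) (by positivity)).mul_left _, fun x hx m => ?_⟩
      beta_reduce
      rw [Complex.norm_exp, ← Real.exp_add]
      apply Real.exp_le_exp.2
      have h3 : ‖m‖ ≤ ‖x + fun i => (m i : ℝ)‖ + R := by
        have h4 : ‖m‖ = ‖(x + fun i => (m i : ℝ)) - x‖ := by
          rw [add_sub_cancel_left]
          rfl
        rw [h4]
        exact (norm_sub_le _ _).trans (by linarith)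
      set y : d → ℝ := x + fun i => (m i : ℝ)
      have h5 : (-((Real.pi * (1 / t) : ℝ) : ℂ) * (‖A y‖ : ℂ) ^ 2).re =
          -(Real.pi * (1 / t) * ‖A y‖ ^ 2) := by
        rw [← Complex.ofReal_pow, ← Complex.ofReal_neg, ← Complex.ofReal_mul, Complex.ofReal_re]
        ring
      rw [h5]
      have h6 : (a * ‖y‖) ^ 2 ≤ ‖A y‖ ^ 2 := by
        have := h1 y
        gcongr
      have h7 : ‖m‖ ^ 2 ≤ 2 * ‖y‖ ^ 2 + 2 * R ^ 2 := by
        have h8 : ‖m‖ ^ 2 ≤ (‖y‖ + R) ^ 2 := by gcongr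
        nlinarith [sq_nonneg (‖y‖ - R)]
      have h8 : a ^ 2 / 2 * ‖m‖ ^ 2 ≤ ‖A y‖ ^ 2 + a ^ 2 * R ^ 2 := by
        have := mul_le_mul_of_nonneg_left h7 (show 0 ≤ a ^ 2 / 2 by positivity)
        nlinarith
      have h9 := mul_le_mul_of_nonneg_left h8 (show 0 ≤ Real.pi * (1 / t) by positivity)
      simp only [q₀]
      linarith)
    (by
      have h3 := Complex.ofRealCLM.summable
        (hsr.mul_left (c * t ^ ((Fintype.card d : ℝ) / 2)))
      refine h3.congr fun m => ?_
      have := hft fun i => (m i : ℝ)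
      simp only [Complex.ofReal_intCast] at this
      rw [this]
      rfl)
  have h4 : ∀ m : d → ℤ, _ := fun m => hft fun i => (m i : ℝ)
  simp only [Complex.ofReal_intCast] at h4
  simp only [h4] at hpoisson
  rw [← Complex.ofReal_tsum, tsum_mul_left] at hpoisson
  have h5 : ∀ m : d → ℤ, Complex.exp (-(Real.pi * (1 / t) : ℝ) * ‖A fun i => (m i : ℝ)‖ ^ 2) =
      ((Real.exp (-Real.pi * ‖A fun i => (m i : ℝ)‖ ^ 2 * (1 / t)) : ℝ) : ℂ) := by
    intro m
    push_cast
    congr 1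
    ring
  simp only [h5] at hpoisson
  rw [← Complex.ofReal_tsum, Complex.ofReal_inj] at hpoisson
  exact hpoisson

end DualForm

/-! ### The lattices attached to the ring of integers -/

section RingOfIntegersLattice

variable {K : Type*} [Field K]

/-- The hermitian form `|c z + d|² + |c|² r²` attached to the point `P = z + r j`, evaluated at a
pair `(c, d)` of algebraic integers. -/
def heightForm (φ : K →+* ℂ) (P : H3) (p : 𝓞 K × 𝓞 K) : ℝ :=
  Complex.normSq (φ (p.1 : K) * P.1.1 + φ (p.2 : K)) + Complex.normSq (φ (p.1 : K)) * P.r ^ 2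

theorem heightForm_nonneg (φ : K →+* ℂ) (P : H3) (p : 𝓞 K × 𝓞 K) : 0 ≤ heightForm φ P p :=
  add_nonneg (Complex.normSq_nonneg _) (mul_nonneg (Complex.normSq_nonneg _) (sq_nonneg _))

variable [NumberField K]

theorem exists_im_ne_zero [NumberField.IsTotallyComplex K] (φ : K →+* ℂ) :
    ∃ a : 𝓞 K, (φ (a : K)).im ≠ 0 := by
  by_contra! h
  refine NumberField.InfinitePlace.isReal_mk_iff.not.1
    (NumberField.InfinitePlace.not_isReal_iff_isComplex.2
      (NumberField.IsTotallyComplex.isComplex (NumberField.InfinitePlace.mk φ))) ?_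
  rw [NumberField.ComplexEmbedding.isReal_iff]
  ext x
  obtain ⟨a, b, -, rfl⟩ := IsFractionRing.div_surjective (A := 𝓞 K) x
  rw [NumberField.ComplexEmbedding.conjugate_coe_eq, map_div₀, map_div₀,
    Complex.conj_eq_iff_im.2 (h a), Complex.conj_eq_iff_im.2 (h b)]

/-- An index type for a `ℤ`-basis of the ring of integers. -/
abbrev BasisIndex (K : Type*) [Field K] [NumberField K] : Type _ :=
  Module.Free.ChooseBasisIndex ℤ (𝓞 K)

/-- Coordinates of algebraic integers. -/
def intCoords (K : Type*) [Field K] [NumberField K] : (BasisIndex K → ℤ) ≃ 𝓞 K :=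
  (NumberField.RingOfIntegers.basis K).equivFun.symm.toEquiv

/-- The real-linear extension to `ℝ ⊗ 𝓞 K` of a complex embedding. -/
def latticeMap (φ : K →+* ℂ) : (BasisIndex K → ℝ) →ₗ[ℝ] ℂ :=
  Fintype.linearCombination ℝ fun i => φ (NumberField.RingOfIntegers.basis K i : K)

theorem latticeMap_int (φ : K →+* ℂ) (m : BasisIndex K → ℤ) :
    latticeMap φ (fun i => (m i : ℝ)) = φ (intCoords K m : K) := by
  rw [latticeMap, Fintype.linearCombination_apply]
  change _ = φ (((NumberField.RingOfIntegers.basis K).equivFun.symm m : 𝓞 K) : K)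
  rw [Module.Basis.equivFun_symm_apply]
  simp

theorem latticeMap_surjective [NumberField.IsTotallyComplex K] (φ : K →+* ℂ) :
    Function.Surjective (latticeMap φ) := by
  obtain ⟨a, ha⟩ := exists_im_ne_zero φ
  have h1 : ∀ x : 𝓞 K, φ (x : K) ∈ LinearMap.range (latticeMap φ) := fun x =>
    ⟨fun i => ((intCoords K).symm x i : ℝ), by rw [latticeMap_int, Equiv.apply_symm_apply]⟩
  intro z
  have h2 : z = (z.re - z.im / (φ (a : K)).im * (φ (a : K)).re) • φ ((1 : 𝓞 K) : K) +
      (z.im / (φ (a : K)).im) • φ (a : K) := by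
    apply Complex.ext <;> simp [ha]
  have h3 : z ∈ LinearMap.range (latticeMap φ) := by
    rw [h2]
    exact add_mem (Submodule.smul_mem _ _ (h1 1)) (Submodule.smul_mem _ _ (h1 a))
  exact h3

variable [Algebra.IsQuadraticExtension ℚ K]

theorem card_basisIndex : Fintype.card (BasisIndex K) = 2 := by
  rw [← Module.finrank_eq_card_chooseBasisIndex, NumberField.RingOfIntegers.rank,
    Algebra.IsQuadraticExtension.finrank_eq_two ℚ K]

instance : Nonempty (BasisIndex K) := Fintype.card_pos_iff.1 (by rw [card_basisIndex]; norm_num)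

variable [NumberField.IsTotallyComplex K]

/-- The isomorphism `ℝ ⊗ 𝓞 K ≃ ℂ`. -/
def latticeEquiv (φ : K →+* ℂ) : (BasisIndex K → ℝ) ≃ₗ[ℝ] ℂ :=
  LinearEquiv.ofBijective (latticeMap φ)
    ⟨(LinearMap.injective_iff_surjective_of_finrank_eq_finrank (by
      rw [Module.finrank_fintype_fun_eq_card, card_basisIndex, Complex.finrank_real_complex])).2
      (latticeMap_surjective φ), latticeMap_surjective φ⟩

theorem latticeEquiv_int (φ : K →+* ℂ) (m : BasisIndex K → ℤ) :
    latticeEquiv φ (fun i => (m i : ℝ)) = φ (intCoords K m : K) := latticeMap_int φ m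

theorem exists_bounds_latticeEquiv (φ : K →+* ℂ) : ∃ a M : ℝ, 0 < a ∧ 0 < M ∧
    ∀ x, a * ‖x‖ ≤ ‖latticeEquiv φ x‖ ∧ ‖latticeEquiv φ x‖ ≤ M * ‖x‖ := by
  let A := (latticeEquiv φ).toContinuousLinearEquiv
  refine ⟨(‖(A.symm : ℂ →L[ℝ] (BasisIndex K → ℝ))‖ + 1)⁻¹, ‖(A : (BasisIndex K → ℝ) →L[ℝ] ℂ)‖ + 1,
    by positivity, by positivity, fun x => ⟨?_, ?_⟩⟩
  · rw [inv_mul_le_iff₀ (by positivity)]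
    have h1 := (A.symm : ℂ →L[ℝ] (BasisIndex K → ℝ)).le_opNorm (A x)
    simp only [ContinuousLinearEquiv.coe_coe, ContinuousLinearEquiv.symm_apply_apply] at h1
    have h2 : ‖A x‖ = ‖latticeEquiv φ x‖ := rfl
    rw [h2] at h1
    nlinarith [norm_nonneg (latticeEquiv φ x)]
  · have h1 := (A : (BasisIndex K → ℝ) →L[ℝ] ℂ).le_opNorm x
    have h2 : ‖(A : (BasisIndex K → ℝ) →L[ℝ] ℂ) x‖ = ‖latticeEquiv φ x‖ := rfl
    rw [h2] at h1
    nlinarith [norm_nonneg x]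

/-- The Dirichlet series `∑ |φ a|^{-2w}` over the nonzero algebraic integers of an imaginary
quadratic field, multiplied by `w - 1`: continuation and convexity bound. -/
theorem exists_unitSum_continuation (φ : K →+* ℂ) : ∃ D : ℂ → ℂ, Differentiable ℂ D ∧ D 1 ≠ 0 ∧
    (∀ w : ℂ, 1 < w.re → Summable (fun a : 𝓞 K => (Complex.normSq (φ (a : K)) : ℂ) ^ (-w)) ∧
      D w = (w - 1) * ∑' a : 𝓞 K, (Complex.normSq (φ (a : K)) : ℂ) ^ (-w)) ∧
    ∀ δ : ℝ, 0 < δ → ∃ C : ℝ, 0 < C ∧ ∀ w : ℂ, 1 / 2 ≤ w.re → w.re ≤ 3 / 2 → w.re ≤ 1 + δ →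
      ‖D w‖ ≤ C * (1 + |w.im|) ^ (2 + δ - w.re) := by
  obtain ⟨a, M, ha, hM, haM⟩ := exists_bounds_latticeEquiv φ
  set κ : ℝ := min (a ^ 2) ((1 / M) ^ 2)
  have hκ : 0 < κ := lt_min (by positivity) (by positivity)
  obtain ⟨c, q', hpair⟩ := exists_thetaPair (latticeEquiv φ).toContinuousLinearEquiv ha hM
    (min_le_left _ _) (min_le_right _ _) (fun x => (haM x).1) (fun x => (haM x).2)
  have hq : ∀ m : BasisIndex K → ℤ,
      ‖(latticeEquiv φ).toContinuousLinearEquiv (fun i => (m i : ℝ))‖ ^ 2 =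
        Complex.normSq (φ (intCoords K m : K)) := fun m => by
    rw [Complex.normSq_eq_norm_sq, ← latticeEquiv_int]
    rfl
  have hk : ((Fintype.card (BasisIndex K) : ℝ) / 2 : ℝ) = 1 := by
    rw [card_basisIndex]; norm_num
  have hkc : ((Fintype.card (BasisIndex K) : ℝ) / 2 : ℂ) = 1 := by
    rw [card_basisIndex]; norm_num
  refine ⟨hpair.zetaMul hκ, hpair.differentiable_zetaMul hκ, ?_, fun w hw => ⟨?_, ?_⟩,
    fun δ hδ => ?_⟩
  · have := hpair.zetaMul_ne_zero hκ
    rwa [hkc] at this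
  · have := hpair.left.summable_cpow hκ (by linarith) (by rw [hk]; exact hw)
    rw [← (intCoords K).summable_iff]
    refine this.congr fun m => ?_
    rw [hq, Function.comp_apply]
  · rw [hpair.zetaMul_eq hκ (by rw [hk]; exact hw), hkc, ← (intCoords K).tsum_eq]
    simp only [hq]
  · obtain ⟨C, hC, h⟩ := ThetaPair.exists_norm_zetaMul_le (d := BasisIndex K) hκ hδ
    refine ⟨C, hC, fun w h1 h2 h3 => ?_⟩
    have := h hpair w h1 h2 (by rw [hk]; exact h3)
    rw [hk] at this
    convert this using 3
    ring

/-- The real-linear map `(c, d) ↦ (c z + d, c r)`. -/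
def pointEquiv (P : H3) : (ℂ × ℂ) ≃ₗ[ℝ] ℂ × ℂ where
  toFun p := (p.1 * P.1.1 + p.2, p.1 * P.r)
  map_add' p p' := by ext <;> simp <;> ring
  map_smul' x p := by ext <;> simp <;> ring
  invFun v := (v.2 / P.r, v.1 - v.2 / P.r * P.1.1)
  left_inv p := by
    have : (P.r : ℂ) ≠ 0 := by exact_mod_cast (show 0 < P.r from P.2).ne'
    ext1 <;> field_simp
    ring
  right_inv v := by
    have : (P.r : ℂ) ≠ 0 := by exact_mod_cast (show 0 < P.r from P.2).ne'
    ext1 <;> field_simp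
    ring

/-- The real-linear isomorphism whose squared norm is the height form of `P`. -/
def pairEquiv (φ : K →+* ℂ) (P : H3) :
    (BasisIndex K ⊕ BasisIndex K → ℝ) ≃ₗ[ℝ] WithLp 2 (ℂ × ℂ) :=
  (LinearEquiv.sumArrowLequivProdArrow (BasisIndex K) (BasisIndex K) ℝ ℝ).trans
    (((latticeEquiv φ).prodCongr (latticeEquiv φ)).trans
      ((pointEquiv P).trans (WithLp.linearEquiv 2 ℝ (ℂ × ℂ)).symm))

theorem norm_sq_pairEquiv (φ : K →+* ℂ) (P : H3) (x : BasisIndex K ⊕ BasisIndex K → ℝ) :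
    ‖pairEquiv φ P x‖ ^ 2 =
      ‖latticeEquiv φ (x ∘ Sum.inl) * P.1.1 + latticeEquiv φ (x ∘ Sum.inr)‖ ^ 2 +
      ‖latticeEquiv φ (x ∘ Sum.inl)‖ ^ 2 * P.r ^ 2 := by
  rw [WithLp.prod_norm_sq_eq_of_L2]
  have h : ‖latticeEquiv φ (x ∘ Sum.inl) * (P.r : ℂ)‖ ^ 2 =
      ‖latticeEquiv φ (x ∘ Sum.inl)‖ ^ 2 * P.r ^ 2 := by
    rw [norm_mul, Complex.norm_real, mul_pow, Real.norm_eq_abs, sq_abs]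
  rw [← h]
  rfl

/-- Coordinates of pairs of algebraic integers. -/
def pairCoords (K : Type*) [Field K] [NumberField K] :
    (BasisIndex K ⊕ BasisIndex K → ℤ) ≃ 𝓞 K × 𝓞 K :=
  (Equiv.sumArrowEquivProdArrow _ _ _).trans ((intCoords K).prodCongr (intCoords K))

theorem norm_sq_pairEquiv_int (φ : K →+* ℂ) (P : H3) (m : BasisIndex K ⊕ BasisIndex K → ℤ) :
    ‖pairEquiv φ P (fun i => (m i : ℝ))‖ ^ 2 = heightForm φ P (pairCoords K m) := by
  rw [norm_sq_pairEquiv, heightForm, Complex.normSq_eq_norm_sq, Complex.normSq_eq_norm_sq]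
  have h1 := latticeEquiv_int φ (m ∘ Sum.inl)
  have h2 := latticeEquiv_int φ (m ∘ Sum.inr)
  change _ = ‖φ (intCoords K (m ∘ Sum.inl) : K) * P.1.1 + φ (intCoords K (m ∘ Sum.inr) : K)‖ ^ 2 +
    ‖φ (intCoords K (m ∘ Sum.inl) : K)‖ ^ 2 * P.r ^ 2
  rw [← h1, ← h2]
  rfl

theorem norm_pairEquiv_le (φ : K →+* ℂ) {a M R : ℝ} (hM : 0 < M) (hR : 1 ≤ R)
    (haM : ∀ x, a * ‖x‖ ≤ ‖latticeEquiv φ x‖ ∧ ‖latticeEquiv φ x‖ ≤ M * ‖x‖) {P : H3}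
    (hz : ‖P.1.1‖ ≤ R) (hr : P.r ≤ R) (x : BasisIndex K ⊕ BasisIndex K → ℝ) :
    ‖pairEquiv φ P x‖ ≤ (2 * R + 1) * M * ‖x‖ := by
  have hr0 : 0 < P.r := P.2
  refine abs_le_of_sq_le_sq' ?_ (by positivity) |>.2
  rw [norm_sq_pairEquiv]
  have hx1 : ‖x ∘ Sum.inl‖ ≤ ‖x‖ :=
    (pi_norm_le_iff_of_nonneg (norm_nonneg _)).2 fun i => norm_le_pi_norm x _
  have hx2 : ‖x ∘ Sum.inr‖ ≤ ‖x‖ :=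
    (pi_norm_le_iff_of_nonneg (norm_nonneg _)).2 fun i => norm_le_pi_norm x _
  set c := latticeEquiv φ (x ∘ Sum.inl)
  set e := latticeEquiv φ (x ∘ Sum.inr)
  have hc : ‖c‖ ≤ M * ‖x‖ := (haM _).2.trans (by gcongr)
  have he : ‖e‖ ≤ M * ‖x‖ := (haM _).2.trans (by gcongr)
  have h1 : ‖c * P.1.1 + e‖ ≤ (M * ‖x‖) * R + M * ‖x‖ := by
    refine (norm_add_le _ _).trans ?_
    rw [norm_mul]
    gcongr
  calc _ ≤ ((M * ‖x‖) * R + M * ‖x‖) ^ 2 + (M * ‖x‖) ^ 2 * R ^ 2 := by gcongr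
    _ ≤ _ := by
      have : 0 ≤ (M * ‖x‖) ^ 2 := by positivity
      nlinarith [mul_nonneg this (show 0 ≤ R by linarith), mul_nonneg this (sq_nonneg R)]

theorem le_norm_pairEquiv (φ : K →+* ℂ) {a M R : ℝ} (ha : 0 < a) (hR : 1 ≤ R)
    (haM : ∀ x, a * ‖x‖ ≤ ‖latticeEquiv φ x‖ ∧ ‖latticeEquiv φ x‖ ≤ M * ‖x‖) {P : H3}
    (hz : ‖P.1.1‖ ≤ R) (hr : R⁻¹ ≤ P.r) (x : BasisIndex K ⊕ BasisIndex K → ℝ) :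
    a / (R * (1 + R)) * ‖x‖ ≤ ‖pairEquiv φ P x‖ := by
  have hr0 : 0 < P.r := P.2
  have hN := norm_sq_pairEquiv φ P x
  set N := ‖pairEquiv φ P x‖
  have hN0 : 0 ≤ N := norm_nonneg _
  set c := latticeEquiv φ (x ∘ Sum.inl)
  set e := latticeEquiv φ (x ∘ Sum.inr)
  have h1 : ‖c‖ * P.r ≤ N := by
    refine abs_le_of_sq_le_sq' ?_ hN0 |>.2
    rw [hN, mul_pow]
    linarith [sq_nonneg ‖c * P.1.1 + e‖]
  have h2 : ‖c * P.1.1 + e‖ ≤ N := by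
    refine abs_le_of_sq_le_sq' ?_ hN0 |>.2
    rw [hN]
    have : 0 ≤ ‖c‖ ^ 2 * P.r ^ 2 := by positivity
    linarith
  have hc : ‖c‖ ≤ R * N := by
    have h3 : 1 ≤ R * P.r := by
      have := mul_le_mul_of_nonneg_left hr (show 0 ≤ R by linarith)
      rwa [mul_inv_cancel₀ (by linarith)] at this
    calc ‖c‖ ≤ ‖c‖ * (R * P.r) := le_mul_of_one_le_right (norm_nonneg _) h3
      _ = R * (‖c‖ * P.r) := by ring
      _ ≤ R * N := by gcongr
  have he : ‖e‖ ≤ R * (1 + R) * N := by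
    have h4 : ‖e‖ ≤ ‖c * P.1.1 + e‖ + ‖c * P.1.1‖ := by
      have := norm_sub_le (c * P.1.1 + e) (c * P.1.1)
      rwa [add_sub_cancel_left] at this
    rw [norm_mul] at h4
    have h5 : ‖c‖ * ‖P.1.1‖ ≤ (R * N) * R := by gcongr
    nlinarith
  have hc' : ‖c‖ ≤ R * (1 + R) * N := hc.trans (by nlinarith [mul_nonneg hN0 (sq_nonneg R)])
  rw [div_mul_eq_mul_div, div_le_iff₀ (by positivity), mul_comm N, ← le_div_iff₀' ha]
  refine (pi_norm_le_iff_of_nonneg (by positivity)).2 fun i => ?_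
  rw [le_div_iff₀' ha]
  rcases i with i | i
  · have h6 := norm_le_pi_norm (x ∘ Sum.inl) i
    calc a * ‖x (Sum.inl i)‖ ≤ a * ‖x ∘ Sum.inl‖ := by gcongr; exact h6
      _ ≤ ‖c‖ := (haM _).1
      _ ≤ _ := hc'
  · have h6 := norm_le_pi_norm (x ∘ Sum.inr) i
    calc a * ‖x (Sum.inr i)‖ ≤ a * ‖x ∘ Sum.inr‖ := by gcongr; exact h6
      _ ≤ ‖e‖ := (haM _).1
      _ ≤ _ := he

theorem exists_bound_of_isCompact {Ω : Set H3} (hΩ : IsCompact Ω) :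
    ∃ R : ℝ, 1 ≤ R ∧ ∀ P ∈ Ω, ‖P.1.1‖ ≤ R ∧ P.r ≤ R ∧ R⁻¹ ≤ P.r := by
  have hr : Continuous fun P : H3 => P.r := continuous_snd.comp continuous_subtype_val
  have hz : Continuous fun P : H3 => P.1.1 := continuous_fst.comp continuous_subtype_val
  obtain ⟨R₁, h1⟩ := hΩ.exists_bound_of_continuousOn hz.continuousOn
  obtain ⟨R₂, h2⟩ := hΩ.exists_bound_of_continuousOn hr.continuousOn
  obtain ⟨R₃, h3⟩ := hΩ.exists_bound_of_continuousOn
    (hr.inv₀ fun P => (show 0 < P.r from P.2).ne').continuousOn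
  refine ⟨1 + |R₁| + |R₂| + |R₃|, ?_, fun P hP => ⟨?_, ?_, ?_⟩⟩
  · linarith [abs_nonneg R₁, abs_nonneg R₂, abs_nonneg R₃]
  · linarith [h1 P hP, le_abs_self R₁, abs_nonneg R₂, abs_nonneg R₃]
  · have := (le_abs_self P.r).trans (h2 P hP)
    linarith [le_abs_self R₂, abs_nonneg R₁, abs_nonneg R₃]
  · have hr0 : 0 < P.r := P.2
    have : P.r⁻¹ ≤ R₃ := (le_abs_self _).trans (h3 P hP)
    rw [inv_le_comm₀ (by positivity) hr0]
    linarith [le_abs_self R₃, abs_nonneg R₁, abs_nonneg R₂]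

/-- The Epstein zeta function of the height form of `P`, multiplied by `w - 2`: continuation, and
convexity bound on the critical line that is uniform for `P` in a compact set. -/
theorem exists_epstein_continuation (φ : K →+* ℂ) {Ω : Set H3} (hΩ : IsCompact Ω) {δ : ℝ}
    (hδ : 0 < δ) : ∃ C : ℝ, 0 < C ∧ ∀ P ∈ Ω, ∃ Z : ℂ → ℂ, Differentiable ℂ Z ∧
      (∀ w : ℂ, 2 < w.re → Summable (fun p : 𝓞 K × 𝓞 K => (heightForm φ P p : ℂ) ^ (-w)) ∧
        Z w = (w - 2) * ∑' p : 𝓞 K × 𝓞 K, (heightForm φ P p : ℂ) ^ (-w)) ∧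
      ∀ w : ℂ, w.re = 1 → ‖Z w‖ ≤ C * (1 + |w.im|) ^ (2 + δ) := by
  obtain ⟨a, M, ha, hM, haM⟩ := exists_bounds_latticeEquiv φ
  obtain ⟨R, hR, hRΩ⟩ := exists_bound_of_isCompact hΩ
  have ha' : 0 < a / (R * (1 + R)) := by positivity
  have hM' : 0 < (2 * R + 1) * M := by positivity
  set κ : ℝ := min ((a / (R * (1 + R))) ^ 2) ((1 / ((2 * R + 1) * M)) ^ 2)
  have hκ : 0 < κ := lt_min (by positivity) (by positivity)
  have hk : ((Fintype.card (BasisIndex K ⊕ BasisIndex K) : ℝ) / 2 : ℝ) = 2 := by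
    rw [Fintype.card_sum, card_basisIndex]; norm_num
  have hkc : ((Fintype.card (BasisIndex K ⊕ BasisIndex K) : ℝ) / 2 : ℂ) = 2 := by
    rw [Fintype.card_sum, card_basisIndex]; norm_num
  obtain ⟨C, hC, h⟩ := ThetaPair.exists_norm_zetaMul_le (d := BasisIndex K ⊕ BasisIndex K) hκ hδ
  refine ⟨C, hC, fun P hP => ?_⟩
  obtain ⟨hz, hr1, hr2⟩ := hRΩ P hP
  obtain ⟨c, q', hpair⟩ := exists_thetaPair (pairEquiv φ P).toContinuousLinearEquiv ha' hM'
    (min_le_left _ _) (min_le_right _ _) (fun x => le_norm_pairEquiv φ ha hR haM hz hr2 x)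
    (fun x => norm_pairEquiv_le φ hM hR haM hz hr1 x)
  have hq : ∀ m : BasisIndex K ⊕ BasisIndex K → ℤ,
      ‖(pairEquiv φ P).toContinuousLinearEquiv (fun i => (m i : ℝ))‖ ^ 2 =
        heightForm φ P (pairCoords K m) := norm_sq_pairEquiv_int φ P
  refine ⟨hpair.zetaMul hκ, hpair.differentiable_zetaMul hκ, fun w hw => ⟨?_, ?_⟩, fun w hw => ?_⟩
  · have := hpair.left.summable_cpow hκ (by linarith) (by rw [hk]; exact hw)
    rw [← (pairCoords K).summable_iff]
    refine this.congr fun m => ?_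
    rw [hq, Function.comp_apply]
  · rw [hpair.zetaMul_eq hκ (by rw [hk]; exact hw), hkc, ← (pairCoords K).tsum_eq]
    simp only [hq]
  · have := h hpair w (by linarith) (by linarith) (by rw [hk]; linarith)
    rw [hk, hw] at this
    convert this using 3
    ring

end RingOfIntegersLattice

/-! ### Euler's sieve and the `3-4-1` inequality -/

section EulerProduct

variable {R : Type*} [CommRing R] [IsDedekindDomain R]

/-- Euler's sieve: for a completely multiplicative summable function on the ideals of a Dedekind
domain, sieving the sum by all the primes leaves the term of the unit ideal. -/
theorem tendsto_prod_one_sub_mul_tsum {f : Ideal R → ℂ} (hf : Summable f)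
    (h0 : f 0 = 0) (h1 : f 1 = 1) (hmul : ∀ I J, f (I * J) = f I * f J) :
    Filter.Tendsto (fun S : Finset {p : Ideal R // Prime p} =>
      (∏ p ∈ S, (1 - f p.1)) * ∑' I, f I) Filter.atTop (𝓝 1) := by
  classical
  -- The terms that survive the sieve by `S`.
  let T : Finset {p : Ideal R // Prime p} → Ideal R → ℂ := fun S I =>
    if ∀ p ∈ S, ¬ p.1 ∣ I then f I else 0
  have hTle : ∀ S I, ‖T S I‖ ≤ ‖f I‖ := fun S I => by
    simp only [T]
    split_ifs
    · exact le_rfl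
    · simp
  have hTs : ∀ S, Summable (T S) := fun S => Summable.of_norm_bounded hf.norm (hTle S)
  have hstep : ∀ (S : Finset {p : Ideal R // Prime p}) (p), p ∉ S →
      ∑' I, T (insert p S) I = (1 - f p.1) * ∑' I, T S I := by
    intro S p hpS
    have hinj : Function.Injective fun J : Ideal R => p.1 * J := fun J J' h =>
      mul_left_cancel₀ p.2.ne_zero h
    have e1 : ∀ I, T (insert p S) I = T S I - if p.1 ∣ I then T S I else 0 := by
      intro I
      simp only [T, Finset.forall_mem_insert]
      by_cases h2 : p.1 ∣ I <;> simp [h2]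
    have e2 : ∑' I, (if p.1 ∣ I then T S I else 0) = f p.1 * ∑' J, T S J := by
      rw [← tsum_mul_left, ← hinj.tsum_eq]
      · refine tsum_congr fun J => ?_
        rw [if_pos (dvd_mul_right _ _)]
        have h3 : (∀ q ∈ S, ¬ q.1 ∣ p.1 * J) ↔ ∀ q ∈ S, ¬ q.1 ∣ J := by
          refine forall₂_congr fun q hq => not_congr ⟨fun h => ?_, fun h => h.mul_left _⟩
          refine (q.2.dvd_or_dvd h).resolve_left fun h4 => hpS ?_
          have : q = p := Subtype.ext (associated_iff_eq.1 (q.2.associated_of_dvd p.2 h4))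
          rwa [← this]
        simp only [T, h3, hmul, mul_ite, mul_zero]
      · intro I hI
        rw [Function.mem_support] at hI
        have : p.1 ∣ I := by
          by_contra h
          exact hI (if_neg h)
        obtain ⟨J, rfl⟩ := this
        exact ⟨J, rfl⟩
    have hs2 : Summable fun I => if p.1 ∣ I then T S I else 0 := by
      refine Summable.of_norm_bounded hf.norm fun I => ?_
      split_ifs
      · exact hTle S I
      · simp
    simp_rw [e1]
    rw [(hTs S).tsum_sub hs2, e2]
    ring
  have hprod : ∀ S, ∑' I, T S I = (∏ p ∈ S, (1 - f p.1)) * ∑' I, f I := by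
    intro S
    induction S using Finset.induction_on with
    | empty => simp [T]
    | insert p S hp ih => rw [hstep S p hp, ih, Finset.prod_insert hp, mul_assoc]
  simp_rw [← hprod]
  have hlim : ∑' I : Ideal R, (if I = 1 then (1 : ℂ) else 0) = 1 := tsum_ite_eq 1 _
  rw [← hlim]
  refine tendsto_tsum_of_dominated_convergence hf.norm (fun I => ?_)
    (Filter.Eventually.of_forall hTle)
  rcases eq_or_ne I 1 with rfl | hI1
  · refine tendsto_const_nhds.congr fun S => ?_
    rw [if_pos rfl]
    simp only [T]
    rw [if_pos fun p _ h => p.2.not_isUnit (isUnit_of_dvd_one h), h1]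
  rw [if_neg hI1]
  rcases eq_or_ne I 0 with rfl | hI0
  · refine tendsto_const_nhds.congr fun S => ?_
    simp only [T, h0, ite_self]
  obtain ⟨p, hp, hpI⟩ := WfDvdMonoid.exists_irreducible_factor
    (fun h => hI1 ((Ideal.isUnit_iff.1 h).trans Ideal.one_eq_top.symm)) hI0
  refine tendsto_const_nhds.congr' ?_
  filter_upwards [Filter.eventually_ge_atTop {⟨p, hp.prime⟩}] with S hS
  simp only [T]
  rw [if_neg fun h => h ⟨p, hp.prime⟩ (hS (Finset.mem_singleton_self _)) hpI]

theorem re_log_comb_nonneg {a : ℝ} (ha₀ : 0 ≤ a) (ha₁ : a < 1) {z : ℂ} (hz : ‖z‖ = 1) :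
    0 ≤ 3 * (-Complex.log (1 - a)).re + 4 * (-Complex.log (1 - a * z)).re +
      (-Complex.log (1 - a * z ^ 2)).re := by
  have hac₀ : ‖(a : ℂ)‖ < 1 := by
    simp only [Complex.norm_of_nonneg ha₀, ha₁]
  have hac₁ : ‖a * z‖ < 1 := by rwa [norm_mul, hz, mul_one]
  have hac₂ : ‖a * z ^ 2‖ < 1 := by rwa [norm_mul, norm_pow, hz, one_pow, mul_one]
  rw [← (((Complex.hasSum_re <| Complex.hasSum_taylorSeries_neg_log hac₀).mul_left 3).add
    ((Complex.hasSum_re <| Complex.hasSum_taylorSeries_neg_log hac₁).mul_left 4) |>.add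
    (Complex.hasSum_re <| Complex.hasSum_taylorSeries_neg_log hac₂) |>.tsum_eq)]
  refine tsum_nonneg fun n => ?_
  simp only [← Complex.ofReal_pow, Complex.div_natCast_re, Complex.ofReal_re, mul_pow,
    Complex.mul_re, Complex.ofReal_im, zero_mul, sub_zero]
  rcases n.eq_zero_or_pos with rfl | hn
  · simp
  -- `3 + 4 cos θ + cos 2θ = 2 (1 + cos θ)²`
  have h2 : ((z ^ 2) ^ n).re = 2 * (z ^ n).re ^ 2 - 1 := by
    have hzn : (z ^ n).re ^ 2 + (z ^ n).im ^ 2 = 1 := by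
      have := Complex.sq_norm (z ^ n)
      rw [norm_pow, hz, one_pow, one_pow, Complex.normSq_apply] at this
      linarith
    rw [← pow_mul, mul_comm 2 n, pow_mul, pow_two, Complex.mul_re]
    linarith
  rw [h2]
  have h3 : 3 * (a ^ n / n) + 4 * (a ^ n * (z ^ n).re / n) +
      a ^ n * (2 * (z ^ n).re ^ 2 - 1) / n = 2 * (a ^ n / n) * ((z ^ n).re + 1) ^ 2 := by ring
  rw [h3]
  positivity

/-- The `3-4-1` inequality for the inverse of an Euler factor. -/
theorem norm_prod_one_sub_le_one {a : ℝ} (ha₀ : 0 ≤ a) (ha₁ : a < 1) {z : ℂ} (hz : ‖z‖ = 1) :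
    ‖1 - (a : ℂ)‖ ^ 3 * ‖1 - a * z‖ ^ 4 * ‖1 - a * z ^ 2‖ ≤ 1 := by
  have hpos : ∀ w : ℂ, ‖w‖ < 1 → 0 < ‖1 - w‖ := fun w hw => by
    rw [norm_pos_iff, sub_ne_zero]
    rintro rfl
    simp at hw
  have hac₀ : ‖(a : ℂ)‖ < 1 := by
    simp only [Complex.norm_of_nonneg ha₀, ha₁]
  have p0 := hpos _ hac₀
  have p1 := hpos (a * z) (by rwa [norm_mul, hz, mul_one])
  have p2 := hpos (a * z ^ 2) (by rwa [norm_mul, norm_pow, hz, one_pow, mul_one])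
  have h := re_log_comb_nonneg ha₀ ha₁ hz
  simp only [Complex.neg_re, Complex.log_re] at h
  rw [← Real.log_nonpos_iff (by positivity), Real.log_mul (by positivity) p2.ne',
    Real.log_mul (by positivity) (by positivity), Real.log_pow, Real.log_pow]
  push_cast
  linarith

end EulerProduct

section IdealZeta

variable {K : Type*} [Field K] [NumberField K]

/-- The term `N(I)⁻ʷ` of the Dedekind zeta function. It vanishes for `I = 0`, unless `w = 0`. -/
def idealTerm (w : ℂ) (I : Ideal (𝓞 K)) : ℂ := (Ideal.absNorm I : ℂ) ^ (-w)

theorem idealTerm_mul (w : ℂ) (I J : Ideal (𝓞 K)) :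
    idealTerm w (I * J) = idealTerm w I * idealTerm w J := by
  simp only [idealTerm, map_mul, Nat.cast_mul, Complex.natCast_mul_natCast_cpow]

theorem idealTerm_zero {w : ℂ} (hw : w ≠ 0) : idealTerm w (0 : Ideal (𝓞 K)) = 0 := by
  simp [idealTerm, hw]

theorem idealTerm_one (w : ℂ) : idealTerm w (1 : Ideal (𝓞 K)) = 1 := by
  simp [idealTerm]

/-- The `3-4-1` inequality for the Dedekind zeta function. -/
theorem one_le_norm_dedekind_prod {σ : ℝ} (hσ : 0 < σ) (t : ℝ)
    (hs : ∀ w : ℂ, w.re = σ → Summable (idealTerm (K := K) w)) :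
    1 ≤ ‖∑' I : Ideal (𝓞 K), idealTerm σ I‖ ^ 3 *
      ‖∑' I : Ideal (𝓞 K), idealTerm (σ + t * Complex.I) I‖ ^ 4 *
      ‖∑' I : Ideal (𝓞 K), idealTerm (σ + 2 * t * Complex.I) I‖ := by
  have key : ∀ w : ℂ, w.re = σ → Filter.Tendsto (fun S : Finset {p : Ideal (𝓞 K) // Prime p} =>
      ‖∏ p ∈ S, (1 - idealTerm w p.1)‖ * ‖∑' I : Ideal (𝓞 K), idealTerm w I‖) Filter.atTop
      (𝓝 1) := by
    intro w hw
    have hw0 : w ≠ 0 := by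
      rintro rfl
      simp at hw
      linarith
    have := (tendsto_prod_one_sub_mul_tsum (hs w hw) (idealTerm_zero hw0) (idealTerm_one w)
      (idealTerm_mul w)).norm
    simpa only [norm_mul, norm_one] using this
  have h0 := key σ (by simp)
  have h1 := key (σ + t * Complex.I) (by simp)
  have h2 := key (σ + 2 * t * Complex.I) (by simp)
  have h3 := ((h0.pow 3).mul (h1.pow 4)).mul h2
  rw [one_pow, one_pow, one_mul, one_mul] at h3
  refine le_of_tendsto h3 (Filter.Eventually.of_forall fun S => ?_)
  set Z0 := ‖∑' I : Ideal (𝓞 K), idealTerm σ I‖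
  set Z1 := ‖∑' I : Ideal (𝓞 K), idealTerm (σ + t * Complex.I) I‖
  set Z2 := ‖∑' I : Ideal (𝓞 K), idealTerm (σ + 2 * t * Complex.I) I‖
  have h4 : ‖∏ p ∈ S, (1 - idealTerm σ p.1)‖ ^ 3 *
      ‖∏ p ∈ S, (1 - idealTerm (σ + t * Complex.I) p.1)‖ ^ 4 *
      ‖∏ p ∈ S, (1 - idealTerm (σ + 2 * t * Complex.I) p.1)‖ ≤ 1 := by
    rw [norm_prod, norm_prod, norm_prod, ← Finset.prod_pow, ← Finset.prod_pow,
      ← Finset.prod_mul_distrib, ← Finset.prod_mul_distrib]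
    refine Finset.prod_le_one (fun p _ => by positivity) fun p _ => ?_
    set n := Ideal.absNorm p.1
    have hn1 : n ≠ 1 := fun h => p.2.not_isUnit (Ideal.isUnit_iff.2 (Ideal.absNorm_eq_one_iff.1 h))
    have hn0 : n ≠ 0 := fun h => p.2.ne_zero (Ideal.absNorm_eq_zero_iff.1 h)
    have hn2 : 1 < (n : ℝ) := by
      exact_mod_cast (show 1 < n by omega)
    have hnc : (n : ℂ) ≠ 0 := by exact_mod_cast hn0
    have e0 : idealTerm (σ : ℂ) p.1 = (((n : ℝ) ^ (-σ) : ℝ) : ℂ) := by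
      rw [idealTerm, Complex.ofReal_cpow (by positivity)]
      push_cast
      rfl
    have e1 : idealTerm (σ + t * Complex.I) p.1 =
        (((n : ℝ) ^ (-σ) : ℝ) : ℂ) * (n : ℂ) ^ (-(t * Complex.I)) := by
      rw [← e0, idealTerm, idealTerm, neg_add, Complex.cpow_add _ _ hnc]
    have e2 : idealTerm (σ + 2 * t * Complex.I) p.1 =
        (((n : ℝ) ^ (-σ) : ℝ) : ℂ) * ((n : ℂ) ^ (-(t * Complex.I))) ^ 2 := by
      rw [← e0, idealTerm, idealTerm, neg_add, Complex.cpow_add _ _ hnc, ← Complex.cpow_nat_mul]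
      congr 2
      push_cast
      ring
    rw [e0, e1, e2]
    refine norm_prod_one_sub_le_one (by positivity) ?_ ?_
    · exact Real.rpow_lt_one_of_one_lt_of_neg hn2 (by linarith)
    · rw [Complex.norm_natCast_cpow_of_pos (by omega)]
      simp
  calc _ = (‖∏ p ∈ S, (1 - idealTerm σ p.1)‖ ^ 3 *
      ‖∏ p ∈ S, (1 - idealTerm (σ + t * Complex.I) p.1)‖ ^ 4 *
      ‖∏ p ∈ S, (1 - idealTerm (σ + 2 * t * Complex.I) p.1)‖) * (Z0 ^ 3 * Z1 ^ 4 * Z2) := by ring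
    _ ≤ 1 * (Z0 ^ 3 * Z1 ^ 4 * Z2) := by gcongr
    _ = _ := one_mul _

end IdealZeta

/-! ### Lower bounds on the edge of the critical strip -/

section LowerBound

/-- A quantitative non-vanishing theorem: the `3-4-1` inequality and growth of order `|t|^ε` near
the line `Re w = 1` bound a zeta function from below on that line. The function `D` is the zeta
function multiplied by `w - 1`. -/
theorem exists_le_norm_of_three_four_one {D : ℂ → ℂ} (hD : Differentiable ℂ D)
    (h341 : ∀ σ t : ℝ, 1 < σ → (σ - 1) ^ 3 * ‖(σ + t * Complex.I - 1 : ℂ)‖ ^ 4 *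
      ‖(σ + 2 * t * Complex.I - 1 : ℂ)‖ ≤
        ‖D σ‖ ^ 3 * ‖D (σ + t * Complex.I)‖ ^ 4 * ‖D (σ + 2 * t * Complex.I)‖)
    (hgrowth : ∀ δ : ℝ, 0 < δ → ∃ C : ℝ, 0 < C ∧ ∀ w : ℂ, 1 / 2 ≤ w.re → w.re ≤ 3 / 2 →
      w.re ≤ 1 + δ → ‖D w‖ ≤ C * (1 + |w.im|) ^ (2 + δ - w.re))
    {ε τ : ℝ} (hε : 0 < ε) (hτ : 0 < τ) (hτ1 : τ ≤ 1) :
    ∃ c : ℝ, 0 < c ∧ ∀ t : ℝ, τ ≤ |t| → c * (1 + |t|) ^ (1 - ε) ≤ ‖D (1 + t * Complex.I)‖ := by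
  set δ : ℝ := min (1 / 4) (ε / 12)
  have hδ : 0 < δ := lt_min (by norm_num) (by positivity)
  have hδ1 : δ ≤ 1 / 4 := min_le_left _ _
  have hδ2 : 12 * δ ≤ ε := by
    have := min_le_right (1 / 4) (ε / 12)
    linarith
  obtain ⟨C, hC, hb⟩ := hgrowth (2 * δ) (by positivity)
  have hpow2 : ∀ x : ℝ, x ≤ 2 → (2 : ℝ) ^ x ≤ 4 := fun x hx => by
    calc (2 : ℝ) ^ x ≤ 2 ^ (2 : ℝ) := Real.rpow_le_rpow_of_exponent_le one_le_two hx
      _ = 4 := by norm_num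
  -- Growth, for imaginary parts comparable to `t`.
  have hgr : ∀ (w : ℂ) (t : ℝ), 1 - δ ≤ w.re → w.re ≤ 1 + 2 * δ → |w.im| ≤ 1 + 2 * |t| →
      ‖D w‖ ≤ 4 * C * (1 + |t|) ^ (1 + 3 * δ) := by
    intro w t h1 h2 h3
    refine (hb w (by linarith) (by linarith) h2).trans ?_
    calc C * (1 + |w.im|) ^ (2 + 2 * δ - w.re) ≤ C * (2 * (1 + |t|)) ^ (2 + 2 * δ - w.re) := by
          gcongr
          · linarith
          · linarith
      _ ≤ C * (2 * (1 + |t|)) ^ (1 + 3 * δ) := by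
          gcongr
          · linarith [abs_nonneg t]
          · linarith
      _ = C * (2 ^ (1 + 3 * δ) * (1 + |t|) ^ (1 + 3 * δ)) := by
          rw [Real.mul_rpow (by positivity) (by positivity)]
      _ ≤ C * (4 * (1 + |t|) ^ (1 + 3 * δ)) := by
          gcongr
          exact hpow2 _ (by linarith)
      _ = _ := by ring
  have hderiv : ∀ (w : ℂ), 1 ≤ w.re → w.re ≤ 1 + δ →
      ‖deriv D w‖ ≤ 4 * C / δ * (1 + |w.im|) ^ (1 + 3 * δ) := by
    intro w h1 h2
    have := Complex.norm_deriv_le_of_forall_mem_sphere_norm_le (f := D) (c := w) hδ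
      hD.diffContOnCl (C := 4 * C * (1 + |w.im|) ^ (1 + 3 * δ)) (fun z hz => by
        rw [mem_sphere_iff_norm] at hz
        have hre := (abs_le.1 ((Complex.abs_re_le_norm (z - w)).trans hz.le))
        have him := (Complex.abs_im_le_norm (z - w)).trans hz.le
        simp only [Complex.sub_re, Complex.sub_im] at hre him
        refine hgr z w.im (by linarith [hre.1]) (by linarith [hre.2]) ?_
        have := abs_sub_abs_le_abs_sub z.im w.im
        linarith [abs_nonneg w.im])
    refine this.trans_eq ?_
    ring
  set C₂ : ℝ := 4 * C / δ
  have hC₂0 : 0 < C₂ := by positivity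
  -- `‖D (σ + i t)‖⁴ ≥ c₁ (σ - 1)³ (1 + |t|)^(4 - 3 δ)`
  set c₁ : ℝ := 2 * (τ / 2) ^ 5 / ((4 * C) ^ 3 * (4 * C)) with hc₁
  have hc₁0 : 0 < c₁ := by positivity
  set c₂ : ℝ := min δ (c₁ / (16 * C₂ ^ 4))
  have hc₂0 : 0 < c₂ := lt_min hδ (by positivity)
  refine ⟨C₂ * c₂, by positivity, fun t ht => ?_⟩
  set T : ℝ := 1 + |t| with hT
  have hT1 : 1 ≤ T := by linarith [abs_nonneg t]
  have hT0 : 0 < T := by linarith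
  -- At distance `η` from the line, the `3-4-1` inequality gives `|D|⁴ ≫ η³ T^(4 - 3δ)`, and the
  -- mean value inequality compares with the line up to an error `≪ η T^(1 + 3δ)`. The exponent
  -- `15 δ` and the constant `c₂` make the former twice the latter.
  set η : ℝ := c₂ * T ^ (-(15 * δ)) with hη
  have hη0 : 0 < η := by positivity
  have hηδ : η ≤ δ := by
    calc η ≤ c₂ * 1 := by
          rw [hη]
          gcongr
          exact Real.rpow_le_one_of_one_le_of_nonpos hT1 (by linarith)
      _ ≤ δ := by rw [mul_one]; exact min_le_left _ _
  set X : ℝ := ‖D ((1 + η : ℝ) + t * Complex.I)‖ with hX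
  set Y : ℝ := C₂ * η * T ^ (1 + 3 * δ) with hY
  have hY0 : 0 < Y := by positivity
  -- The mean value inequality on the segment from `1 + i t` to `1 + η + i t`.
  have hmv : ‖D ((1 + η : ℝ) + t * Complex.I) - D (1 + t * Complex.I)‖ ≤ Y := by
    have hconv : Convex ℝ {w : ℂ | (1 ≤ w.re ∧ w.re ≤ 1 + δ) ∧ w.im = t} := by
      exact ((convex_halfSpace_re_ge 1).inter (convex_halfSpace_re_le (1 + δ))).inter
        (convex_hyperplane (𝕜 := ℝ) (f := Complex.im)
          ⟨Complex.add_im, fun c x => by simp⟩ t)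
    have h2 := hconv.norm_image_sub_le_of_norm_deriv_le (𝕜 := ℂ) (f := D)
      (C := C₂ * T ^ (1 + 3 * δ)) (x := 1 + t * Complex.I) (y := (1 + η : ℝ) + t * Complex.I)
      (fun w _ => hD w) (fun w hw => by
        have h3 := hderiv w hw.1.1 hw.1.2
        rwa [hw.2] at h3)
      ⟨⟨by simp, by simp [hδ.le]⟩, by simp⟩ ⟨⟨by simp [hη0.le], by simp [hηδ]⟩, by simp⟩
    have h4 : ((1 + η : ℝ) + t * Complex.I - (1 + t * Complex.I) : ℂ) = (η : ℂ) := by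
      push_cast
      ring
    rw [h4, Complex.norm_real, Real.norm_of_nonneg hη0.le] at h2
    refine h2.trans_eq ?_
    rw [hY]
    ring
  have hX4 : c₁ * η ^ 3 * T ^ (4 - 3 * δ) ≤ X ^ 4 := by
    have h1 := h341 (1 + η) t (by linarith)
    have h2 : ‖D ((1 + η : ℝ) : ℂ)‖ ≤ 4 * C := by
      have := hgr ((1 + η : ℝ) : ℂ) 0 (by simp; linarith) (by simp; linarith) (by simp)
      simpa using this
    have h3 : ‖D ((1 + η : ℝ) + 2 * t * Complex.I)‖ ≤ 4 * C * T ^ (1 + 3 * δ) := by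
      refine hgr _ t (by simp; linarith) (by simp; linarith) ?_
      simp [abs_mul]
    have hτt : τ / 2 * T ≤ |t| := by
      rw [hT]
      nlinarith [abs_nonneg t]
    have h4 : τ / 2 * T ≤ ‖((1 + η : ℝ) + t * Complex.I - 1 : ℂ)‖ := by
      refine hτt.trans ?_
      have := Complex.abs_im_le_norm ((1 + η : ℝ) + t * Complex.I - 1 : ℂ)
      simpa using this
    have h5 : 2 * (τ / 2 * T) ≤ ‖((1 + η : ℝ) + 2 * t * Complex.I - 1 : ℂ)‖ := by
      have him : ((1 + η : ℝ) + 2 * t * Complex.I - 1 : ℂ).im = 2 * t := by simp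
      refine le_trans ?_ (Complex.abs_im_le_norm _)
      rw [him, abs_mul, abs_two]
      linarith
    have h6 : η ^ 3 * (τ / 2 * T) ^ 4 * (2 * (τ / 2 * T)) ≤
        (4 * C) ^ 3 * X ^ 4 * (4 * C * T ^ (1 + 3 * δ)) := by
      calc _ ≤ (1 + η - 1) ^ 3 * ‖((1 + η : ℝ) + t * Complex.I - 1 : ℂ)‖ ^ 4 *
            ‖((1 + η : ℝ) + 2 * t * Complex.I - 1 : ℂ)‖ := by
            rw [add_sub_cancel_left]
            gcongr
        _ ≤ _ := h1
        _ ≤ _ := by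
            rw [hX]
            gcongr
    have h7 : T ^ 5 = T ^ (4 - 3 * δ) * T ^ (1 + 3 * δ) := by
      rw [← Real.rpow_add hT0, ← Real.rpow_natCast]
      congr 1
      push_cast
      ring
    have h8 : (0 : ℝ) < T ^ (1 + 3 * δ) := by positivity
    have h9 : c₁ * η ^ 3 * T ^ (4 - 3 * δ) * ((4 * C) ^ 3 * (4 * C) * T ^ (1 + 3 * δ)) ≤
        X ^ 4 * ((4 * C) ^ 3 * (4 * C) * T ^ (1 + 3 * δ)) := by
      calc _ = c₁ * ((4 * C) ^ 3 * (4 * C)) * η ^ 3 * (T ^ (4 - 3 * δ) * T ^ (1 + 3 * δ)) := by ring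
        _ = 2 * (τ / 2) ^ 5 * η ^ 3 * T ^ 5 := by
            rw [← h7, hc₁, div_mul_cancel₀ _ (by positivity)]
        _ = η ^ 3 * (τ / 2 * T) ^ 4 * (2 * (τ / 2 * T)) := by ring
        _ ≤ _ := h6
        _ = _ := by ring
    exact le_of_mul_le_mul_right h9 (by positivity)
  have hYX : (2 * Y) ^ 4 ≤ X ^ 4 := by
    refine le_trans ?_ hX4
    have h1 : (T ^ (1 + 3 * δ)) ^ 4 = T ^ (15 * δ) * T ^ (4 - 3 * δ) := by
      rw [← Real.rpow_add hT0, ← Real.rpow_mul_natCast hT0.le]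
      congr 1
      push_cast
      ring
    have h2 : η * T ^ (15 * δ) = c₂ := by
      rw [hη, mul_assoc, ← Real.rpow_add hT0, neg_add_cancel, Real.rpow_zero, mul_one]
    have h3 : c₂ * (16 * C₂ ^ 4) ≤ c₁ := by
      rw [← le_div_iff₀ (by positivity)]
      exact min_le_right _ _
    calc (2 * Y) ^ 4 = (η * T ^ (15 * δ)) * (16 * C₂ ^ 4) * (η ^ 3 * T ^ (4 - 3 * δ)) := by
          rw [hY, show (2 * (C₂ * η * T ^ (1 + 3 * δ))) ^ 4 =
            16 * C₂ ^ 4 * η ^ 4 * (T ^ (1 + 3 * δ)) ^ 4 by ring, h1]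
          ring
      _ ≤ c₁ * (η ^ 3 * T ^ (4 - 3 * δ)) := by
          rw [h2]
          gcongr
      _ = _ := by ring
  have hYX' : 2 * Y ≤ X := le_of_pow_le_pow_left₀ four_ne_zero (norm_nonneg _) hYX
  have hfin : Y ≤ ‖D (1 + t * Complex.I)‖ := by
    have := norm_sub_norm_le (D ((1 + η : ℝ) + t * Complex.I)) (D (1 + t * Complex.I))
    linarith
  refine le_trans ?_ hfin
  have h1 : Y = C₂ * c₂ * T ^ (1 - 12 * δ) := by
    rw [hY, hη, show (1 - 12 * δ) = -(15 * δ) + (1 + 3 * δ) by ring,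
      Real.rpow_add hT0 (-(15 * δ)) (1 + 3 * δ)]
    simp only [mul_assoc]
  rw [h1]
  gcongr

/-- The lower bound of `exists_le_norm_of_three_four_one`, extended by compactness to all `t`. The
hypothesis `D 1 ≠ 0` says that the zeta function has a pole at `1`. -/
theorem exists_le_norm_of_three_four_one_of_ne_zero {D : ℂ → ℂ} (hD : Differentiable ℂ D)
    (hD1 : D 1 ≠ 0)
    (h341 : ∀ σ t : ℝ, 1 < σ → (σ - 1) ^ 3 * ‖(σ + t * Complex.I - 1 : ℂ)‖ ^ 4 *
      ‖(σ + 2 * t * Complex.I - 1 : ℂ)‖ ≤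
        ‖D σ‖ ^ 3 * ‖D (σ + t * Complex.I)‖ ^ 4 * ‖D (σ + 2 * t * Complex.I)‖)
    (hgrowth : ∀ δ : ℝ, 0 < δ → ∃ C : ℝ, 0 < C ∧ ∀ w : ℂ, 1 / 2 ≤ w.re → w.re ≤ 3 / 2 →
      w.re ≤ 1 + δ → ‖D w‖ ≤ C * (1 + |w.im|) ^ (2 + δ - w.re))
    {ε : ℝ} (hε : 0 < ε) :
    ∃ c : ℝ, 0 < c ∧ ∀ t : ℝ, c * (1 + |t|) ^ (1 - ε) ≤ ‖D (1 + t * Complex.I)‖ := by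
  obtain ⟨c, hc, hbig⟩ :=
    exists_le_norm_of_three_four_one hD h341 hgrowth hε one_pos le_rfl
  have hne : ∀ t : ℝ, D (1 + t * Complex.I) ≠ 0 := by
    intro t
    rcases eq_or_ne t 0 with rfl | ht
    · simpa using hD1
    · obtain ⟨b, hb, hlow⟩ := exists_le_norm_of_three_four_one hD h341 hgrowth hε
        (lt_min one_pos (abs_pos.2 ht)) (min_le_left 1 |t|)
      have := hlow t (min_le_right _ _)
      rw [← norm_pos_iff]
      refine lt_of_lt_of_le ?_ this
      positivity
  have hcont : Continuous fun t : ℝ => ‖D (1 + t * Complex.I)‖ :=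
    (hD.continuous.comp (by fun_prop)).norm
  obtain ⟨t₀, -, hmin⟩ := (isCompact_Icc (a := (-1 : ℝ)) (b := 1)).exists_isMinOn
    ⟨0, by simp⟩ hcont.continuousOn
  have hm := norm_pos_iff.2 (hne t₀)
  set m : ℝ := ‖D (1 + t₀ * Complex.I)‖
  refine ⟨min c (m / 2), lt_min hc (by positivity), fun t => ?_⟩
  rcases le_total 1 |t| with ht | ht
  · refine le_trans ?_ (hbig t ht)
    gcongr
    exact min_le_left _ _
  · have h2 : (1 + |t|) ^ (1 - ε) ≤ 2 := by
      have h1 : 1 ≤ 1 + |t| := by linarith [abs_nonneg t]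
      calc (1 + |t|) ^ (1 - ε) ≤ (1 + |t|) ^ (1 : ℝ) :=
            Real.rpow_le_rpow_of_exponent_le h1 (by linarith)
        _ ≤ 2 := by rw [Real.rpow_one]; linarith
    calc min c (m / 2) * (1 + |t|) ^ (1 - ε) ≤ m / 2 * 2 := by
          gcongr
          exact min_le_right _ _
      _ = m := by ring
      _ ≤ _ := hmin (abs_le.1 ht)

end LowerBound

/-! ### Sums over ideals, coprime pairs and cosets -/

section PrincipalIdeals

open Submodule.IsPrincipal

variable {R : Type*} [CommRing R] [IsPrincipalIdealRing R]

theorem generator_ne_zero {I : Ideal R} (hI : I ≠ 0) : generator I ≠ 0 := fun h =>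
  hI ((eq_bot_iff_generator_eq_zero I).2 h)

variable [IsDomain R]

/-- Every nonzero element of a principal ideal domain is uniquely a unit times the chosen generator
of a nonzero ideal. -/
theorem bijective_generator_mul_unit :
    Function.Bijective fun x : {I : Ideal R // I ≠ 0} × Rˣ =>
      (⟨generator x.1.1 * x.2, mul_ne_zero (generator_ne_zero x.1.2) x.2.ne_zero⟩ :
        {a : R // a ≠ 0}) := by
  constructor
  · rintro ⟨⟨I, hI⟩, u⟩ ⟨⟨J, hJ⟩, v⟩ h
    have h : generator I * u = generator J * v := congrArg Subtype.val h
    have hIJ : I = J := by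
      rw [← Ideal.span_singleton_generator I, ← Ideal.span_singleton_generator J,
        ← Ideal.span_singleton_mul_right_unit u.isUnit, h,
        Ideal.span_singleton_mul_right_unit v.isUnit]
    subst hIJ
    have huv : u = v := Units.ext (mul_left_cancel₀ (generator_ne_zero hI) h)
    rw [huv]
  · rintro ⟨a, ha⟩
    have hI : Ideal.span {a} ≠ 0 := fun h => ha (Ideal.span_singleton_eq_bot.1 h)
    obtain ⟨u, hu⟩ := Ideal.span_singleton_eq_span_singleton.1
      (Ideal.span_singleton_generator (Ideal.span {a}))
    exact ⟨(⟨_, hI⟩, u), Subtype.ext hu⟩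

/-- Every nonzero pair in a principal ideal domain is uniquely a coprime pair times the chosen
generator of a nonzero ideal. -/
theorem bijective_generator_mul_coprime :
    Function.Bijective fun x : {I : Ideal R // I ≠ 0} × {p : R × R // IsCoprime p.1 p.2} =>
      (⟨(generator x.1.1 * x.2.1.1, generator x.1.1 * x.2.1.2), fun h => by
        obtain ⟨h1, h2⟩ := Prod.mk.inj h
        have h3 := (mul_eq_zero.1 h1).resolve_left (generator_ne_zero x.1.2)
        have h4 := (mul_eq_zero.1 h2).resolve_left (generator_ne_zero x.1.2)
        have h5 := x.2.2
        rw [h3, h4] at h5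
        exact not_isCoprime_zero_zero h5⟩ : {p : R × R // p ≠ 0}) := by
  have hspan : ∀ (I : Ideal R) (p : R × R), IsCoprime p.1 p.2 →
      Ideal.span {generator I * p.1, generator I * p.2} = I := by
    intro I p hp
    refine le_antisymm (Ideal.span_le.2 ?_) ?_
    · rintro _ (rfl | rfl)
      · exact I.mul_mem_right _ (generator_mem I)
      · exact I.mul_mem_right _ (generator_mem I)
    · obtain ⟨a, b, hab⟩ := hp
      conv_lhs => rw [← Ideal.span_singleton_generator I]
      rw [Ideal.span_singleton_le_iff_mem, Ideal.mem_span_pair]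
      exact ⟨a, b, by linear_combination generator I * hab⟩
  constructor
  · rintro ⟨⟨I, hI⟩, p, hp⟩ ⟨⟨J, hJ⟩, q, hq⟩ h
    have h1 : generator I * p.1 = generator J * q.1 := congrArg (fun x => x.1.1) h
    have h2 : generator I * p.2 = generator J * q.2 := congrArg (fun x => x.1.2) h
    have hIJ : I = J := by
      rw [← hspan I p hp, ← hspan J q hq, h1, h2]
    subst hIJ
    have hpq : p = q := Prod.ext (mul_left_cancel₀ (generator_ne_zero hI) h1)
      (mul_left_cancel₀ (generator_ne_zero hI) h2)
    subst hpq
    rfl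
  · rintro ⟨⟨a, b⟩, hab⟩
    set I : Ideal R := Ideal.span {a, b}
    have hI : I ≠ 0 := by
      intro h
      have ha : a ∈ I := Ideal.subset_span (by simp)
      have hb : b ∈ I := Ideal.subset_span (by simp)
      rw [h] at ha hb
      exact hab (Prod.ext ha hb)
    obtain ⟨c, hc⟩ : generator I ∣ a := (mem_iff_generator_dvd I).1 (Ideal.subset_span (by simp))
    obtain ⟨d, hd⟩ : generator I ∣ b := (mem_iff_generator_dvd I).1 (Ideal.subset_span (by simp))
    obtain ⟨x, y, hxy⟩ := Ideal.mem_span_pair.1 (generator_mem I)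
    refine ⟨(⟨I, hI⟩, ⟨(c, d), x, y, ?_⟩), Subtype.ext (Prod.ext hc.symm hd.symm)⟩
    refine mul_left_cancel₀ (generator_ne_zero hI) ?_
    calc generator I * (x * c + y * d) = x * (generator I * c) + y * (generator I * d) := by ring
      _ = generator I * 1 := by rw [← hc, ← hd, hxy, mul_one]

/-- In the sum of `g (a)` over all elements `a` of a principal ideal domain, each ideal appears once
per unit. Finiteness of the unit group follows from summability, since `g (u) = g 1` for the
units `u`. -/
theorem tsum_span_singleton {g : Ideal R → ℂ} (h0 : g 0 = 0) (h1 : g 1 ≠ 0)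
    (hs : Summable fun a : R => g (Ideal.span {a})) :
    Finite Rˣ ∧ Summable g ∧
      ∑' a : R, g (Ideal.span {a}) = Nat.card Rˣ * ∑' I, g I := by
  have hfin : Finite Rˣ := by
    have h2 := hs.comp_injective (Units.val_injective (α := R))
    have h3 : ((fun a : R => g (Ideal.span {a})) ∘ Units.val : Rˣ → ℂ) = fun _ => g 1 := by
      funext u
      simp only [Function.comp_apply]
      rw [Ideal.span_singleton_eq_top.2 u.isUnit, Ideal.one_eq_top]
    rw [h3] at h2
    by_contra h
    rw [not_finite_iff_infinite] at h
    exact h1 ((summable_const_iff _).1 h2)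
  have hgs : Summable g := by
    have hinj : Function.Injective fun I : Ideal R => generator I := fun I J h => by
      replace h : generator I = generator J := h
      rw [← Ideal.span_singleton_generator I, ← Ideal.span_singleton_generator J, h]
    simpa only [Function.comp_def, Ideal.span_singleton_generator] using hs.comp_injective hinj
  refine ⟨hfin, hgs, ?_⟩
  have e1 : ∑' a : {a : R // a ≠ 0}, g (Ideal.span {a.1}) = ∑' a : R, g (Ideal.span {a}) :=
    tsum_subtype_eq_of_support_subset (f := fun a : R => g (Ideal.span {a})) (s := {a | a ≠ 0})
      fun a ha h => ha (by
        simp only [h, Set.singleton_zero, Ideal.span_zero]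
        exact h0)
  have e2 : ∑' I : {I : Ideal R // I ≠ 0}, g I = ∑' I : Ideal R, g I :=
    tsum_subtype_eq_of_support_subset (f := g) (s := {I | I ≠ 0}) fun I hI h => hI (by rw [h, h0])
  let e := Equiv.ofBijective _ (bijective_generator_mul_unit (R := R))
  have hval : ∀ x, g (Ideal.span {(e x).1}) = g x.1.1 := by
    intro x
    change g (Ideal.span {generator x.1.1 * x.2}) = _
    rw [Ideal.span_singleton_mul_right_unit x.2.isUnit, Ideal.span_singleton_generator]
  have hs' : Summable fun x : {I : Ideal R // I ≠ 0} × Rˣ => g x.1.1 := by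
    simp_rw [← hval]
    exact e.summable_iff.2 (hs.subtype {a | a ≠ 0})
  rw [← e1, ← e.tsum_eq, ← e2]
  simp_rw [hval]
  rw [hs'.tsum_prod]
  simp only [tsum_const, nsmul_eq_mul]
  rw [tsum_mul_left]

/-- The sum of a homogeneous function over all pairs in a principal ideal domain, grouped by the
ideal that the pair generates. -/
theorem tsum_pair_eq_mul_tsum_coprime {g : Ideal R → ℂ} {f : R × R → ℂ} (h0 : g 0 = 0)
    (hf0 : f 0 = 0) (hmul : ∀ a p, f (a * p.1, a * p.2) = g (Ideal.span {a}) * f p)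
    (hg : Summable g) (hf : Summable f) :
    ∑' p, f p = (∑' I, g I) * ∑' p : {p : R × R // IsCoprime p.1 p.2}, f p := by
  have e1 : ∑' p : {p : R × R // p ≠ 0}, f p.1 = ∑' p, f p :=
    tsum_subtype_eq_of_support_subset (s := {a | a ≠ 0}) fun a ha h => ha (by rw [h, hf0])
  have e2 : ∑' I : {I : Ideal R // I ≠ 0}, g I = ∑' I : Ideal R, g I :=
    tsum_subtype_eq_of_support_subset (f := g) (s := {I | I ≠ 0}) fun I hI h => hI (by rw [h, h0])
  let e := Equiv.ofBijective _ (bijective_generator_mul_coprime (R := R))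
  have hval : ∀ x, f (e x).1 = g x.1.1 * f x.2.1 := by
    intro x
    change f (generator x.1.1 * x.2.1.1, generator x.1.1 * x.2.1.2) = _
    rw [hmul, Ideal.span_singleton_generator]
  have hs' : Summable fun x : {I : Ideal R // I ≠ 0} × {p : R × R // IsCoprime p.1 p.2} =>
      g x.1.1 * f x.2.1 := by
    simp_rw [← hval]
    exact e.summable_iff.2 (hf.subtype {a | a ≠ 0})
  rw [← e1, ← e.tsum_eq, ← e2]
  simp_rw [hval]
  exact ((hg.subtype {I | I ≠ 0}).tsum_mul_tsum (hf.subtype {p | IsCoprime p.1 p.2}) hs').symm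

end PrincipalIdeals

section BottomRow

variable {K : Type*} [Field K] [NumberField K] [Algebra.IsQuadraticExtension ℚ K]
  [NumberField.IsTotallyComplex K]

/-- The bottom row of a matrix in `SL₂(𝓞 K)`, as a coprime pair. -/
def bottomRow (γ : SL(2, 𝓞 K)) : {p : 𝓞 K × 𝓞 K // IsCoprime p.1 p.2} :=
  ⟨(γ 1 0, γ 1 1), -γ 0 1, γ 0 0, by
    have := γ.det_coe
    rw [Matrix.det_fin_two] at this
    linear_combination this⟩

/-- Two matrices lie in the same coset of `Γ'_∞` if and only if their bottom rows agree up to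
sign. -/
theorem mk_eq_mk_iff_bottomRow (φ : K →+* ℂ) (x y : SL(2, 𝓞 K)) :
    (Quotient.mk (QuotientGroup.rightRel (parabolicSubgroup φ)) x = Quotient.mk _ y) ↔
      ∃ u : ℤˣ, y 1 0 = ((u : ℤ) : 𝓞 K) * x 1 0 ∧ y 1 1 = ((u : ℤ) : 𝓞 K) * x 1 1 := by
  rw [Quotient.eq, QuotientGroup.rightRel_apply]
  have hx := x.det_coe
  have hy := y.det_coe
  rw [Matrix.det_fin_two] at hx hy
  change (y * x⁻¹) 1 0 = 0 ∧ ‖φ ((y * x⁻¹) 0 0 + (y * x⁻¹) 1 1 : K)‖ = 2 ↔ _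
  rw [parabolic_iff]
  have e00 : (y * x⁻¹) 0 0 = y 0 0 * x 1 1 - y 0 1 * x 1 0 := by
    rw [Matrix.SpecialLinearGroup.coe_mul, Matrix.mul_apply, Fin.sum_univ_two,
      Matrix.SpecialLinearGroup.SL2_inv_expl]
    simp
    ring
  have e10 : (y * x⁻¹) 1 0 = y 1 0 * x 1 1 - y 1 1 * x 1 0 := by
    rw [Matrix.SpecialLinearGroup.coe_mul, Matrix.mul_apply, Fin.sum_univ_two,
      Matrix.SpecialLinearGroup.SL2_inv_expl]
    simp
    ring
  have e11 : (y * x⁻¹) 1 1 = y 1 1 * x 0 0 - y 1 0 * x 0 1 := by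
    rw [Matrix.SpecialLinearGroup.coe_mul, Matrix.mul_apply, Fin.sum_univ_two,
      Matrix.SpecialLinearGroup.SL2_inv_expl]
    simp
    ring
  rw [e00, e10, e11]
  generalize x 0 0 = a at *
  generalize x 0 1 = b at *
  generalize x 1 0 = c at *
  generalize x 1 1 = d at *
  generalize y 0 0 = a' at *
  generalize y 0 1 = b' at *
  generalize y 1 0 = c' at *
  generalize y 1 1 = d' at *
  constructor
  · rintro ⟨h0, ⟨-, h2⟩ | ⟨-, h2⟩⟩
    · refine ⟨1, ?_, ?_⟩
      · push_cast
        linear_combination a * h0 + c * h2 - c' * hx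
      · push_cast
        linear_combination b * h0 + d * h2 - d' * hx
    · refine ⟨-1, ?_, ?_⟩
      · push_cast
        linear_combination a * h0 + c * h2 - c' * hx
      · push_cast
        linear_combination b * h0 + d * h2 - d' * hx
  · rintro ⟨u, h1, h2⟩
    rcases Int.units_eq_one_or u with rfl | rfl
    · push_cast at h1 h2
      rw [one_mul] at h1 h2
      subst h1 h2
      exact ⟨by ring, Or.inl ⟨hy, by linear_combination hx⟩⟩
    · push_cast at h1 h2
      rw [neg_one_mul] at h1 h2
      subst h1 h2
      exact ⟨by ring, Or.inr ⟨by linear_combination -hy, by linear_combination -hx⟩⟩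

/-- Every coprime pair is up to sign the bottom row of the representative of a unique coset of
`Γ'_∞`. -/
theorem bijective_unit_mul_bottomRow (φ : K →+* ℂ) :
    Function.Bijective fun x : Quotient (QuotientGroup.rightRel (parabolicSubgroup φ)) × ℤˣ =>
      (⟨(((x.2 : ℤ) : 𝓞 K) * x.1.out 1 0, ((x.2 : ℤ) : 𝓞 K) * x.1.out 1 1), by
        have h := (bottomRow x.1.out).2
        have hu : IsUnit ((x.2 : ℤ) : 𝓞 K) := x.2.isUnit.map (Int.castRingHom (𝓞 K))
        exact (isCoprime_mul_unit_left hu _ _).2 h⟩ : {p : 𝓞 K × 𝓞 K // IsCoprime p.1 p.2}) := by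
  have hsq : ∀ u : ℤˣ, ((u : ℤ) : 𝓞 K) * ((u : ℤ) : 𝓞 K) = 1 := by
    intro u
    rcases Int.units_eq_one_or u with rfl | rfl <;> simp
  constructor
  · rintro ⟨q, u⟩ ⟨q', v⟩ h
    have h1 : ((u : ℤ) : 𝓞 K) * q.out 1 0 = ((v : ℤ) : 𝓞 K) * q'.out 1 0 :=
      congrArg (fun x => x.1.1) h
    have h2 : ((u : ℤ) : 𝓞 K) * q.out 1 1 = ((v : ℤ) : 𝓞 K) * q'.out 1 1 :=
      congrArg (fun x => x.1.2) h
    have hq : q = q' := by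
      rw [← q.out_eq, ← q'.out_eq]
      refine (mk_eq_mk_iff_bottomRow φ _ _).2 ⟨v * u, ?_, ?_⟩
      · push_cast
        linear_combination ((v : ℤ) : 𝓞 K) * -h1 - q'.out 1 0 * hsq v
      · push_cast
        linear_combination ((v : ℤ) : 𝓞 K) * -h2 - q'.out 1 1 * hsq v
    subst hq
    obtain ⟨a, b, hab⟩ := (bottomRow q.out).2
    replace hab : a * q.out 1 0 + b * q.out 1 1 = 1 := hab
    have huv : ((u : ℤ) : 𝓞 K) = ((v : ℤ) : 𝓞 K) := by
      linear_combination a * h1 + b * h2 - (((u : ℤ) : 𝓞 K) - ((v : ℤ) : 𝓞 K)) * hab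
    rw [Units.ext (Int.cast_injective huv)]
  · rintro ⟨⟨c, d⟩, hcd⟩
    obtain ⟨γ, hγ⟩ := IsCoprime.exists_SL2_row hcd 1
    set q : Quotient (QuotientGroup.rightRel (parabolicSubgroup φ)) := Quotient.mk _ γ with hq
    obtain ⟨u, h1, h2⟩ := (mk_eq_mk_iff_bottomRow φ q.out γ).1 q.out_eq
    refine ⟨(q, u), Subtype.ext (Prod.ext ?_ ?_)⟩
    · exact h1.symm.trans hγ.1
    · exact h2.symm.trans hγ.2

/-- The Eisenstein series as a sum over coprime pairs, where each coset appears twice. -/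
theorem hasSum_eisensteinTerm_of_summable_coprime (φ : K →+* ℂ) (P : H3) (s : ℂ)
    (hs : Summable fun p : {p : 𝓞 K × 𝓞 K // IsCoprime p.1 p.2} =>
      (heightForm φ P p.1 : ℂ) ^ (-(1 + s))) :
    HasSum (eisensteinTerm φ P s) ((P.r : ℂ) ^ (1 + s) / 2 *
      ∑' p : {p : 𝓞 K × 𝓞 K // IsCoprime p.1 p.2}, (heightForm φ P p.1 : ℂ) ^ (-(1 + s))) := by
  let e := Equiv.ofBijective _ (bijective_unit_mul_bottomRow φ)
  have hr : (0 : ℝ) < P.r := P.2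
  have hval : ∀ x, (P.r : ℂ) ^ (1 + s) * (heightForm φ P (e x).1 : ℂ) ^ (-(1 + s)) =
      eisensteinTerm φ P s x.1 := by
    rintro ⟨q, u⟩
    have h1 : heightForm φ P (e (q, u)).1 = heightForm φ P (q.out 1 0, q.out 1 1) := by
      change heightForm φ P (((u : ℤ) : 𝓞 K) * q.out 1 0, ((u : ℤ) : 𝓞 K) * q.out 1 1) = _
      rcases Int.units_eq_one_or u with rfl | rfl
      · simp
      · simp only [heightForm, Units.val_neg, Units.val_one, Int.cast_neg, Int.cast_one,
          neg_mul, one_mul, map_neg, ← neg_add, Complex.normSq_neg]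
    have h2 : eisensteinTerm φ P s q = ((act (toSLC φ q.out) P).r : ℂ) ^ (1 + s) := by
      conv_lhs => rw [← q.out_eq]
      rfl
    have h3 := heightForm_nonneg φ P (q.out 1 0, q.out 1 1)
    rw [h1, h2, r_act]
    simp only [toSLC_apply]
    change _ = ((P.r / heightForm φ P (q.out 1 0, q.out 1 1) : ℝ) : ℂ) ^ (1 + s)
    rw [div_eq_mul_inv, Complex.ofReal_mul, Complex.mul_cpow_ofReal_nonneg hr.le (inv_nonneg.2 h3),
      Complex.ofReal_inv, Complex.inv_cpow _ _ (by
        rw [Complex.arg_ofReal_of_nonneg h3]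
        exact Real.pi_pos.ne), Complex.cpow_neg]
  have hs2 : Summable fun x : Quotient (QuotientGroup.rightRel (parabolicSubgroup φ)) × ℤˣ =>
      eisensteinTerm φ P s x.1 := by
    simp_rw [← hval]
    exact e.summable_iff.2 (hs.mul_left _)
  have hs3 : Summable (eisensteinTerm φ P s) :=
    hs2.comp_injective (i := fun q => (q, (1 : ℤˣ))) fun _ _ h => congrArg Prod.fst h
  have h4 : (P.r : ℂ) ^ (1 + s) * ∑' p : {p : 𝓞 K × 𝓞 K // IsCoprime p.1 p.2},
      (heightForm φ P p.1 : ℂ) ^ (-(1 + s)) = 2 * ∑' q, eisensteinTerm φ P s q := by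
    rw [← tsum_mul_left, ← e.tsum_eq]
    simp_rw [hval]
    rw [hs2.tsum_prod]
    simp only [tsum_fintype, Finset.sum_const, Finset.card_univ, Fintype.card_units_int,
      nsmul_eq_mul]
    rw [tsum_mul_left]
    norm_num
  have h5 : (P.r : ℂ) ^ (1 + s) / 2 * ∑' p : {p : 𝓞 K × 𝓞 K // IsCoprime p.1 p.2},
      (heightForm φ P p.1 : ℂ) ^ (-(1 + s)) = ∑' q, eisensteinTerm φ P s q := by
    rw [div_mul_eq_mul_div, h4, mul_div_cancel_left₀ _ two_ne_zero]
  rw [h5]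
  exact hs3.hasSum

end BottomRow

section Norm

variable {K : Type*} [Field K] [NumberField K] [Algebra.IsQuadraticExtension ℚ K]
  [NumberField.IsTotallyComplex K]

/-- For an imaginary quadratic field, the norm of `a` is `|a|²`. -/
theorem absNorm_span_singleton_eq_normSq (φ : K →+* ℂ) (a : 𝓞 K) :
    (Ideal.absNorm (Ideal.span {a}) : ℝ) = Complex.normSq (φ (a : K)) := by
  have hprod := NumberField.InfinitePlace.prod_eq_abs_norm (a : K)
  have hcard : Fintype.card (NumberField.InfinitePlace K) = 1 := by
    have h1 := NumberField.InfinitePlace.card_add_two_mul_card_eq_rank K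
    have h2 := NumberField.InfinitePlace.card_eq_nrRealPlaces_add_nrComplexPlaces K
    have h3 := NumberField.IsTotallyComplex.nrRealPlaces_eq_zero K
    have h4 := Algebra.IsQuadraticExtension.finrank_eq_two ℚ K
    omega
  obtain ⟨w, hw⟩ := Fintype.card_eq_one_iff.1 hcard
  have huniv : (Finset.univ : Finset (NumberField.InfinitePlace K)) =
      {NumberField.InfinitePlace.mk φ} := by
    ext v
    simp [hw v, hw (NumberField.InfinitePlace.mk φ)]
  rw [huniv, Finset.prod_singleton, NumberField.InfinitePlace.apply,
    (NumberField.IsTotallyComplex.isComplex _).mult_eq_two, ← Algebra.coe_norm_int] at hprod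
  rw [Complex.normSq_eq_norm_sq, hprod, Ideal.absNorm_span_singleton, Nat.cast_natAbs]
  push_cast
  rfl

theorem idealTerm_span_singleton (φ : K →+* ℂ) (w : ℂ) (a : 𝓞 K) :
    idealTerm w (Ideal.span {a}) = (Complex.normSq (φ (a : K)) : ℂ) ^ (-w) := by
  rw [idealTerm, ← absNorm_span_singleton_eq_normSq, Complex.ofReal_natCast]

end Norm

section

variable {K : Type*} [Field K]

theorem heightForm_mul (φ : K →+* ℂ) (P : H3) (a : 𝓞 K) (p : 𝓞 K × 𝓞 K) :
    heightForm φ P (a * p.1, a * p.2) = Complex.normSq (φ (a : K)) * heightForm φ P p := by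
  have h : φ (a : K) * φ (p.1 : K) * P.1.1 + φ (a : K) * φ (p.2 : K) =
    φ (a : K) * (φ (p.1 : K) * P.1.1 + φ (p.2 : K)) := by ring
  simp only [heightForm, map_mul, h]
  ring

theorem heightForm_zero (φ : K →+* ℂ) (P : H3) : heightForm φ P 0 = 0 := by
  simp [heightForm]

end

section

variable {K : Type*} [Field K] [NumberField K] [Algebra.IsQuadraticExtension ℚ K]
  [NumberField.IsTotallyComplex K]

/-- For class number one, the sum of `|a|^(-2w)` over all algebraic integers `a` is the Dedekind
zeta function times the number of units. -/
theorem tsum_normSq_cpow (hK : NumberField.classNumber K = 1) (φ : K →+* ℂ) {w : ℂ} (hw : w ≠ 0)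
    (hs : Summable fun a : 𝓞 K => (Complex.normSq (φ (a : K)) : ℂ) ^ (-w)) :
    Finite (𝓞 K)ˣ ∧ Summable (idealTerm (K := K) w) ∧
      ∑' a : 𝓞 K, (Complex.normSq (φ (a : K)) : ℂ) ^ (-w) =
        Nat.card (𝓞 K)ˣ * ∑' I : Ideal (𝓞 K), idealTerm w I := by
  have : IsPrincipalIdealRing (𝓞 K) := NumberField.classNumber_eq_one_iff.1 hK
  simp_rw [← idealTerm_span_singleton] at hs ⊢
  exact tsum_span_singleton (idealTerm_zero hw) (by rw [idealTerm_one]; exact one_ne_zero) hs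

/-- The Eisenstein series is a quotient of an Epstein zeta function by the Dedekind zeta
function. -/
theorem hasSum_eisensteinTerm (hK : NumberField.classNumber K = 1) (φ : K →+* ℂ) (P : H3) {s : ℂ}
    (hs : 1 + s ≠ 0) (hζ : Summable (idealTerm (K := K) (1 + s)))
    (hζ0 : ∑' I : Ideal (𝓞 K), idealTerm (1 + s) I ≠ 0)
    (hf : Summable fun p : 𝓞 K × 𝓞 K => (heightForm φ P p : ℂ) ^ (-(1 + s))) :
    HasSum (eisensteinTerm φ P s) ((P.r : ℂ) ^ (1 + s) / 2 *
      ((∑' p : 𝓞 K × 𝓞 K, (heightForm φ P p : ℂ) ^ (-(1 + s))) /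
        ∑' I : Ideal (𝓞 K), idealTerm (1 + s) I)) := by
  have : IsPrincipalIdealRing (𝓞 K) := NumberField.classNumber_eq_one_iff.1 hK
  have h := tsum_pair_eq_mul_tsum_coprime (g := idealTerm (1 + s))
    (f := fun p : 𝓞 K × 𝓞 K => (heightForm φ P p : ℂ) ^ (-(1 + s))) (idealTerm_zero hs)
    (by rw [heightForm_zero, Complex.ofReal_zero, Complex.zero_cpow (neg_ne_zero.2 hs)])
    (fun a p => by
      rw [heightForm_mul, idealTerm_span_singleton φ, Complex.ofReal_mul,
        Complex.mul_cpow_ofReal_nonneg (Complex.normSq_nonneg _) (heightForm_nonneg φ P p)])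
    hζ hf
  rw [h, mul_div_cancel_left₀ _ hζ0]
  exact hasSum_eisensteinTerm_of_summable_coprime φ P s (hf.subtype {p | IsCoprime p.1 p.2})

end

/-! ### Continuation of the Eisenstein series -/

section Continuation

variable {K : Type*} [Field K] [NumberField K] [Algebra.IsQuadraticExtension ℚ K]
  [NumberField.IsTotallyComplex K]

/-- The Dedekind zeta function `ζ` of an imaginary quadratic field of class number one:
`n (w - 1) ζ(w)`, with `n` the number of units, has an entire continuation `D` without zeros in
`Re w ≥ 1`, bounded from below by nearly `|Im w|` on the line `Re w = 1`. -/
theorem exists_dedekind_continuation (hK : NumberField.classNumber K = 1) (φ : K →+* ℂ) :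
    ∃ (D : ℂ → ℂ) (n : ℕ), Differentiable ℂ D ∧ n ≠ 0 ∧
      (∀ w : ℂ, 1 < w.re → Summable (idealTerm (K := K) w) ∧
        D w = (w - 1) * (n * ∑' I : Ideal (𝓞 K), idealTerm w I) ∧ D w ≠ 0) ∧
      ∀ ε : ℝ, 0 < ε → ∃ c : ℝ, 0 < c ∧
        ∀ t : ℝ, c * (1 + |t|) ^ (1 - ε) ≤ ‖D (1 + t * Complex.I)‖ := by
  obtain ⟨D, hD, hD1, hDs, hDb⟩ := exists_unitSum_continuation φ
  have hne : ∀ w : ℂ, 1 < w.re → w ≠ 0 := by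
    rintro w hw rfl
    simp at hw
    linarith
  have hfin : Finite (𝓞 K)ˣ :=
    (tsum_normSq_cpow hK φ (hne 2 (by norm_num)) (hDs 2 (by norm_num)).1).1
  have hsum : ∀ w : ℂ, 1 < w.re → Summable (idealTerm (K := K) w) := fun w hw =>
    (tsum_normSq_cpow hK φ (hne w hw) (hDs w hw).1).2.1
  have hval : ∀ w : ℂ, 1 < w.re →
      D w = (w - 1) * (Nat.card (𝓞 K)ˣ * ∑' I : Ideal (𝓞 K), idealTerm w I) := fun w hw => by
    rw [(hDs w hw).2, (tsum_normSq_cpow hK φ (hne w hw) (hDs w hw).1).2.2]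
  have h341 : ∀ σ t : ℝ, 1 < σ → (σ - 1) ^ 3 * ‖(σ + t * Complex.I - 1 : ℂ)‖ ^ 4 *
      ‖(σ + 2 * t * Complex.I - 1 : ℂ)‖ ≤
        ‖D σ‖ ^ 3 * ‖D (σ + t * Complex.I)‖ ^ 4 * ‖D (σ + 2 * t * Complex.I)‖ := by
    intro σ t hσ
    have h := one_le_norm_dedekind_prod (K := K) (by linarith : 0 < σ) t
      fun w hw => hsum w (by rw [hw]; exact hσ)
    rw [hval σ (by simpa using hσ), hval (σ + t * Complex.I) (by simpa using hσ),
      hval (σ + 2 * t * Complex.I) (by simpa using hσ)]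
    simp only [norm_mul, Complex.norm_natCast]
    have hσ1 : ‖(σ - 1 : ℂ)‖ = σ - 1 := by
      rw [← Complex.ofReal_one, ← Complex.ofReal_sub, Complex.norm_real,
        Real.norm_of_nonneg (by linarith)]
    rw [hσ1]
    have hσ2 : 0 < σ - 1 := by linarith
    have hn : (1 : ℝ) ≤ Nat.card (𝓞 K)ˣ := by exact_mod_cast Nat.card_pos
    set n : ℝ := (Nat.card (𝓞 K)ˣ : ℝ)
    set A := ‖(σ + t * Complex.I - 1 : ℂ)‖
    set B := ‖(σ + 2 * t * Complex.I - 1 : ℂ)‖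
    set Z0 := ‖∑' I : Ideal (𝓞 K), idealTerm σ I‖
    set Z1 := ‖∑' I : Ideal (𝓞 K), idealTerm (σ + t * Complex.I) I‖
    set Z2 := ‖∑' I : Ideal (𝓞 K), idealTerm (σ + 2 * t * Complex.I) I‖
    calc (σ - 1) ^ 3 * A ^ 4 * B = (σ - 1) ^ 3 * A ^ 4 * B * (1 * 1) := by ring
      _ ≤ (σ - 1) ^ 3 * A ^ 4 * B * (n ^ 8 * (Z0 ^ 3 * Z1 ^ 4 * Z2)) := by
          gcongr
          exact one_le_pow₀ hn
      _ = _ := by ring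
  refine ⟨D, Nat.card (𝓞 K)ˣ, hD, Nat.card_pos.ne', fun w hw => ⟨hsum w hw, hval w hw, ?_⟩,
    fun ε hε => exists_le_norm_of_three_four_one_of_ne_zero hD hD1 h341 hDb hε⟩
  -- The left hand side of the `3-4-1` inequality is positive for `Re w > 1`.
  intro h0
  have h := h341 w.re w.im hw
  have hpos : ∀ z : ℂ, z.re = w.re - 1 → 0 < ‖z‖ := by
    intro z hz
    rw [norm_pos_iff]
    rintro rfl
    rw [Complex.zero_re] at hz
    linarith
  have h1 := hpos (w.re + w.im * Complex.I - 1) (by simp)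
  have h2 := hpos (w.re + 2 * w.im * Complex.I - 1) (by simp)
  have h3 : 0 < w.re - 1 := by linarith
  rw [Complex.re_add_im, h0, norm_zero, zero_pow four_ne_zero, mul_zero, zero_mul] at h
  rw [Complex.re_add_im] at h1
  exact absurd h (not_le.2 (by positivity))

/-- The continuation of the Eisenstein series and its values on `Re s = 0`, from entire
continuations `Z` of the Epstein zeta function and `D` of the Dedekind zeta function. -/
theorem eisenstein_of_continuation (hK : NumberField.classNumber K = 1) (φ : K →+* ℂ) (P : H3)
    {Z D : ℂ → ℂ} {n : ℕ} (hZ : Differentiable ℂ Z) (hD : Differentiable ℂ D) (hn : n ≠ 0)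
    (hZs : ∀ w : ℂ, 2 < w.re → Summable (fun p => (heightForm φ P p : ℂ) ^ (-w)) ∧
      Z w = (w - 2) * ∑' p, (heightForm φ P p : ℂ) ^ (-w))
    (hDs : ∀ w : ℂ, 1 < w.re → Summable (idealTerm (K := K) w) ∧
        D w = (w - 1) * (n * ∑' I : Ideal (𝓞 K), idealTerm w I) ∧ D w ≠ 0)
    (hD1 : ∀ t : ℝ, D (1 + t * Complex.I) ≠ 0) :
    IsEisensteinContinuation φ P (eisenstein φ P) ∧
      ∀ t : ℝ, AnalyticAt ℂ (eisenstein φ P) (t * Complex.I) ∧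
        eisenstein φ P (t * Complex.I) = (P.r : ℂ) ^ (1 + t * Complex.I) / 2 *
          (n * (t * Complex.I) * Z (1 + t * Complex.I) /
            ((t * Complex.I - 1) * D (1 + t * Complex.I))) := by
  have hr : (P.r : ℂ) ≠ 0 := Complex.ofReal_ne_zero.2 (ne_of_gt P.2)
  set f : ℂ → ℂ := fun s => (P.r : ℂ) ^ (1 + s) / 2 *
    (n * s * Z (1 + s) / ((s - 1) * D (1 + s))) with hf
  have hnum : Differentiable ℂ fun s : ℂ => (n * s * Z (1 + s) : ℂ) :=
    ((differentiable_const _).mul differentiable_id).mul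
      (hZ.comp ((differentiable_const 1).add differentiable_id))
  have hden : Differentiable ℂ fun s : ℂ => ((s - 1) * D (1 + s) : ℂ) :=
    (differentiable_id.sub_const 1).mul
      (hD.comp ((differentiable_const 1).add differentiable_id))
  have hpow : Differentiable ℂ fun s : ℂ => (P.r : ℂ) ^ (1 + s) / 2 := by
    refine Differentiable.div_const (fun s => ?_) 2
    exact (((differentiableAt_const 1).add differentiableAt_id).const_cpow (Or.inl hr))
  have hmer : MeromorphicOn f Set.univ := fun s _ =>
    (hpow.analyticAt s).meromorphicAt.mul
      ((hnum.analyticAt s).meromorphicAt.div (hden.analyticAt s).meromorphicAt)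
  have han : ∀ s, s ≠ 1 → D (1 + s) ≠ 0 → AnalyticAt ℂ f s := fun s hs hDs =>
    (hpow.analyticAt s).mul ((hnum.analyticAt s).div (hden.analyticAt s)
      (mul_ne_zero (sub_ne_zero.2 hs) hDs))
  -- The normal form of `f` does not change its values at the points where `f` is analytic.
  set F := toMeromorphicNFOn f Set.univ
  have heq : ∀ s, AnalyticAt ℂ f s → F =ᶠ[𝓝 s] f := fun s hs => by
    have := toMeromorphicNFOn_eq_toMeromorphicNFAt_on_nhds hmer (Set.mem_univ s)
    rwa [toMeromorphicNFAt_eq_self.2 hs.meromorphicNFAt] at this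
  have hcont : IsEisensteinContinuation φ P F := by
    refine ⟨meromorphicNFOn_toMeromorphicNFOn f Set.univ, fun s hs => ?_⟩
    have hs1 : s ≠ 1 := by
      rintro rfl
      norm_num at hs
    have hw1 : 1 < (1 + s).re := by
      rw [Complex.add_re, Complex.one_re]
      linarith
    have hw2 : 2 < (1 + s).re := by
      rw [Complex.add_re, Complex.one_re]
      linarith
    have hs0 : s ≠ 0 := by
      rintro rfl
      norm_num at hs
    have hs2 : 1 + s ≠ 0 := by
      intro h
      rw [h] at hw1
      norm_num at hw1
    obtain ⟨hζ, hDw, hDw0⟩ := hDs _ hw1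
    obtain ⟨hZ1, hZ2⟩ := hZs _ hw2
    have hζ0 : ∑' I : Ideal (𝓞 K), idealTerm (1 + s) I ≠ 0 := fun h => hDw0 (by
      rw [hDw, h, mul_zero, mul_zero])
    have hsum := hasSum_eisensteinTerm hK φ P hs2 hζ hζ0 hZ1
    rw [(heq s (han s hs1 hDw0)).eq_of_nhds]
    convert hsum using 1
    have hs1' : s - 1 ≠ 0 := sub_ne_zero.2 hs1
    have hnC : (n : ℂ) ≠ 0 := Nat.cast_ne_zero.2 hn
    simp only [hf]
    rw [hZ2, hDw, show (1 + s - 2 : ℂ) = s - 1 by ring, show (1 + s - 1 : ℂ) = s by ring]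
    congr 1
    field_simp
  have hE : eisenstein φ P = F :=
    (Classical.epsilon_spec (⟨F, hcont⟩ : ∃ F, IsEisensteinContinuation φ P F)).unique hcont
  rw [hE]
  refine ⟨hcont, fun t => ?_⟩
  have ht1 : (t * Complex.I : ℂ) ≠ 1 := fun h => by
    have := congrArg Complex.re h
    simp at this
  have hfa := han _ ht1 (hD1 t)
  exact ⟨hfa.congr (heq _ hfa).symm, (heq _ hfa).eq_of_nhds⟩

end Continuation

end HypThree

end

theorem lemma2p5 {K : Type*} [Field K] [NumberField K] [Algebra.IsQuadraticExtension ℚ K]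
    [NumberField.IsTotallyComplex K] (hK : NumberField.classNumber K = 1) (φ : K →+* ℂ) :
    (∀ P : HypThree.H3,
      HypThree.IsEisensteinContinuation φ P (HypThree.eisenstein φ P) ∧
        ∀ t : ℝ, AnalyticAt ℂ (HypThree.eisenstein φ P) (t * Complex.I)) ∧
    ∀ Ω : Set HypThree.H3, IsCompact Ω → ∀ ε : ℝ, 0 < ε →
      ∃ C : ℝ, ∀ t : ℝ, ∀ P ∈ Ω,
        ‖HypThree.eisenstein φ P (t * Complex.I)‖ ≤ C * (1 + |t|) ^ (1 + ε) := by
  obtain ⟨D, n, hD, hn, hDs, hDb⟩ := HypThree.exists_dedekind_continuation hK φ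
  have hD1 : ∀ t : ℝ, D (1 + t * Complex.I) ≠ 0 := fun t => by
    obtain ⟨c, hc, hb⟩ := hDb 1 one_pos
    rw [← norm_pos_iff]
    refine lt_of_lt_of_le ?_ (hb t)
    positivity
  constructor
  · intro P
    obtain ⟨C, hC, hZ⟩ := HypThree.exists_epstein_continuation φ (isCompact_singleton (x := P))
      one_pos
    obtain ⟨Z, hZd, hZs, -⟩ := hZ P rfl
    obtain ⟨h1, h2⟩ := HypThree.eisenstein_of_continuation hK φ P hZd hD hn hZs hDs hD1
    exact ⟨h1, fun t => (h2 t).1⟩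
  · intro Ω hΩ ε hε
    obtain ⟨C, hC, hZ⟩ := HypThree.exists_epstein_continuation φ hΩ (half_pos hε)
    obtain ⟨c, hc, hb⟩ := hDb (ε / 2) (half_pos hε)
    obtain ⟨R, hR⟩ := hΩ.exists_bound_of_continuousOn (f := HypThree.H3.r)
      (continuous_snd.comp continuous_subtype_val).continuousOn
    refine ⟨|R| / 2 * (n * C / c), fun t P hP => ?_⟩
    obtain ⟨Z, hZd, hZs, hZb⟩ := hZ P hP
    obtain ⟨-, h2⟩ := HypThree.eisenstein_of_continuation hK φ P hZd hD hn hZs hDs hD1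
    have hr : (0 : ℝ) < P.r := P.2
    have hPR : P.r ≤ |R| := (le_abs_self _).trans ((hR P hP).trans (le_abs_self R))
    set T : ℝ := 1 + |t|
    have hT1 : 1 ≤ T := by linarith [abs_nonneg t]
    have hT0 : 0 < T := by linarith
    have hZt : ‖Z (1 + t * Complex.I)‖ ≤ C * T ^ (2 + ε / 2) := by
      simpa using hZb (1 + t * Complex.I) (by simp)
    have hfrac : |t| ≤ ‖(t * Complex.I - 1 : ℂ)‖ := by
      simpa using Complex.abs_im_le_norm (t * Complex.I - 1 : ℂ)
    have hone : 1 ≤ ‖(t * Complex.I - 1 : ℂ)‖ := by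
      simpa using Complex.abs_re_le_norm (t * Complex.I - 1 : ℂ)
    have hpow : T ^ (1 + ε) * T ^ (1 - ε / 2) = T ^ (2 + ε / 2) := by
      rw [← Real.rpow_add hT0]
      congr 1
      ring
    rw [(h2 t).2, norm_mul, norm_div, norm_div, norm_mul, norm_mul, norm_mul, norm_mul,
      Complex.norm_cpow_eq_rpow_re_of_pos hr, Complex.norm_natCast, Complex.norm_real,
      Complex.norm_I, Complex.norm_two, Real.norm_eq_abs]
    have hre : (1 + t * Complex.I : ℂ).re = 1 := by simp
    rw [hre, Real.rpow_one, mul_one, mul_assoc (|R| / 2)]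
    have hbt := hb t
    have hcT : 0 < c * T ^ (1 - ε / 2) := by positivity
    have hDpos := hcT.trans_le hbt
    refine mul_le_mul (by linarith) ?_ (by positivity) (by positivity)
    rw [div_le_iff₀ (by positivity)]
    calc n * |t| * ‖Z (1 + t * Complex.I)‖
        ≤ n * ‖(t * Complex.I - 1 : ℂ)‖ * (C * T ^ (2 + ε / 2)) := by gcongr
      _ = n * C / c * T ^ (1 + ε) * (‖(t * Complex.I - 1 : ℂ)‖ * (c * T ^ (1 - ε / 2))) := by
          rw [← hpow]
          field_simp
      _ ≤ _ := by gcongr
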